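/- A mean-zero Gaussian graphical model (GGM) on $n \ge 1$ nodes is a random vector $X \sim N(0,\Theta^{-1})$ with $\Theta \in \mathbb{R}^{n\times n}$ symmetric positive definite (the precision matrix). The neighborhood of node $i$ is $\{j \ne i : \Theta_{ij} \ne 0\}$. The GGM is attractive if $\Theta_{ij} \le 0$ for all $i \ne j$, and, for $0<\kappa\le 1$, it is $\kappa$-nondegenerate if $|\Theta_{ij}| / \sqrt{\Theta_{ii}\Theta_{jj}} \ge \kappa$ whenever $i \ne j$ and $\Theta_{ij} \neq 0$. Given $m$ samples, written as the rows of a matrix $\mathbb{X} \in \mathbb{R}^{m \times n}$ with columns $\mathbb{X}_j$, put $$\mathrm{RSS}(i,S) = \min_{w :\ \mathrm{supp}(w) \subseteq S} \|\mathbb{X}_i - \mathbb{X} w\|_2^2, \qquad \widehat{\mathrm{Var}}(X_i | X_S) = \frac{\mathrm{RSS}(i,S)}{m - |S|}.$$ Algorithm GreedyAndPrune with parameters $T$ and $\nu$ does the following at a node $i$. (1) Orthogonal matching pursuit: start with $S = \emptyset$ and repeat $T$ times: choose $j \ne i$ minimizing $\mathrm{RSS}(i, S \cup \{j\})$ and set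 $S := S \cup \{j\}$ (nothing is done if $n=1$). (2) Define $\hat\Theta_{ii}$ by $1/\hat\Theta_{ii} = \widehat{\mathrm{Var}}(X_i | X_S)$. (3) For each $j$ in the set $S$ found in step (1), one after the other: if $\widehat{\mathrm{Var}}(X_i | X_{S \setminus \{j\}}) - \widehat{\mathrm{Var}}(X_i | X_S) < \nu / \hat\Theta_{ii}$, with $S$ the current set, then replace $S$ by $S \setminus \{j\}$. (4) Return $S$. Ties in step (1) and the order of the loop in step (3) are arbitrary. **Theorem.** There is a universal constant $C > 0$ such that the following holds. Fix a $\kappa$-nondegenerate attractive mean-zero GGM on $n$ nodes in which every node has at most $d$ neighbors, and let $0 < \delta < 1$, $K = 64\, d \log(4/\kappa^2) + 1$ and $\nu = \kappa^2/\sqrt{32}$. If the number $m \ge 1$ of i.i.d. samples satisfies $$m \ \ge\ C \cdot \frac{1}{\kappa^2}\bigl(K \log n + \log(4/\delta)\bigr),$$ then with probability at least $1 - \delta$, GreedyAndPrune with $T = \lceil K \rceil$ and this $\nu$ returns the true neighborhood at every node $i$ simultaneously, however ties and orders are resolved. Moreover, for every $m \ge 1$, GreedyAndPrune can be run at all $n$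 nodes in total time at most $C K^3 m n^2$: there is a single real-RAM program (unit-cost exact real arithmetic, comparisons, and indexed memory access), independent of all the parameters, which on every input $\mathbb{X} \in \mathbb{R}^{m \times n}$, with $T = \lceil K \rceil$ and $\nu$ as above, outputs for every node a set that GreedyAndPrune can return, within that number of steps. -/

import Mathlib

noncomputable section

namespace GGM

/-! ### The model

A mean-zero Gaussian graphical model on the nodes `Fin n` is given by its precision matrix `Θ`, a
positive definite matrix; its law is the centred Gaussian with covariance `Θ⁻¹`. -/

/-- All off-diagonal entries of the precision matrix are nonpositive. -/
def IsAttractive {n : ℕ} (Θ : Matrix (Fin n) (Fin n) ℝ) : Prop :=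
  ∀ i j, i ≠ j → Θ i j ≤ 0

/-- Every edge `i ~ j` satisfies `κ ≤ |Θ i j| / √(Θ i i * Θ j j)`. (The upper bound `≤ 1` on the
right-hand side is automatic for a positive definite matrix.) -/
def IsNondegenerate {n : ℕ} (κ : ℝ) (Θ : Matrix (Fin n) (Fin n) ℝ) : Prop :=
  ∀ i j, i ≠ j → Θ i j ≠ 0 → κ ≤ |Θ i j| / Real.sqrt (Θ i i * Θ j j)

open Classical in
/-- The neighborhood of the node `i`: the nodes `j ≠ i` with `Θ i j ≠ 0`. -/
def neighbors {n : ℕ} (Θ : Matrix (Fin n) (Fin n) ℝ) (i : Fin n) : Finset (Fin n) :=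
  Finset.univ.filter fun j => j ≠ i ∧ Θ i j ≠ 0

/-! ### The algorithm

The data are the rows of a matrix `X` with `m` rows (samples) and `n` columns (nodes). -/

/-- The minimum over all `w` supported in `S` of the squared error of predicting column `i` by
`X w`. -/
def rss {m n : ℕ} (X : Matrix (Fin m) (Fin n) ℝ) (i : Fin n) (S : Finset (Fin n)) : ℝ :=
  ⨅ w : Fin n → ℝ, ∑ k, (X k i - ∑ j ∈ S, w j * X k j) ^ 2

/-- The ordinary-least-squares estimate of `Var(X_i | X_S)`. -/
def condVarEst {m n : ℕ} (X : Matrix (Fin m) (Fin n) ℝ) (i : Fin n) (S : Finset (Fin n)) : ℝ :=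
  rss X i S / ((m : ℝ) - (S.card : ℝ))

/-- `OMPRun X i t S`: after `t` steps of orthogonal matching pursuit, run to predict column `i` of
`X` from the other columns, the current set can be `S`. Each step adds an index `j ≠ i` that
minimizes the squared error, ties being broken arbitrarily. (If `i` is the only index, there is
nothing to choose.) -/
inductive OMPRun {m n : ℕ} (X : Matrix (Fin m) (Fin n) ℝ) (i : Fin n) :
    ℕ → Finset (Fin n) → Prop
  | start : OMPRun X i 0 ∅
  | step {t : ℕ} {S : Finset (Fin n)} (j : Fin n) (hS : OMPRun X i t S) (hj : j ≠ i)
      (hmin : ∀ l, l ≠ i → rss X i (insert j S) ≤ rss X i (insert l S)) :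
      OMPRun X i (t + 1) (insert j S)
  | idle {t : ℕ} {S : Finset (Fin n)} (hS : OMPRun X i t S) (h : ∀ j, j = i) :
      OMPRun X i (t + 1) S

open Classical in
/-- One pruning step: remove `j` from the current set `S` if this raises the estimated conditional
variance by less than `τ`. -/
def pruneStep {m n : ℕ} (X : Matrix (Fin m) (Fin n) ℝ) (i : Fin n) (τ : ℝ)
    (S : Finset (Fin n)) (j : Fin n) : Finset (Fin n) :=
  if condVarEst X i (S.erase j) - condVarEst X i S < τ then S.erase j else S

/-- `IsGreedyAndPruneOutput X T ν i R`: the algorithm GreedyAndPrune, run at node `i` with `T`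
steps of orthogonal matching pursuit and pruning parameter `ν`, can return the set `R`. The
pruning loop goes once through the elements of the set `S` found by the greedy phase, in an
arbitrary order; its threshold is `ν / Θ̂ᵢᵢ`, where `1 / Θ̂ᵢᵢ` is the estimated conditional variance
given that initial `S`. -/
def IsGreedyAndPruneOutput {m n : ℕ} (X : Matrix (Fin m) (Fin n) ℝ) (T : ℕ) (ν : ℝ) (i : Fin n)
    (R : Finset (Fin n)) : Prop :=
  ∃ (S : Finset (Fin n)) (l : List (Fin n)), OMPRun X i T S ∧ l.Nodup ∧ l.toFinset = S ∧
    R = l.foldl (pruneStep X i (ν * condVarEst X i S)) S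

/-! ### The machine model

A real RAM: the memory consists of two-dimensional arrays of natural numbers and of real numbers
(a scalar is the entry `(0, 0)` of an array), which are named by natural numbers and may be
accessed at computed indices. Addition and truncated subtraction of natural numbers, exact real
arithmetic, comparisons and memory accesses cost one step each. Programs are built from
assignments, conditionals and counting loops; a program is a finite object that does not depend on
the size of its input. -/

/-- The contents of the memory. -/
structure Store where
  nat : ℕ → ℕ → ℕ → ℕ
  real : ℕ → ℕ → ℕ → ℝ

/-- Write `v` into entry `(i, j)` of the `a`-th array of natural numbers. -/
def Store.setNat (s : Store) (a i j v : ℕ) : Store where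
  nat := fun a' i' j' => if a' = a ∧ i' = i ∧ j' = j then v else s.nat a' i' j'
  real := s.real

/-- Write `v` into entry `(i, j)` of the `a`-th array of reals. -/
def Store.setReal (s : Store) (a i j : ℕ) (v : ℝ) : Store where
  nat := s.nat
  real := fun a' i' j' => if a' = a ∧ i' = i ∧ j' = j then v else s.real a' i' j'

/-- Expressions for natural numbers. -/
inductive NatExpr
  | const (c : ℕ)
  | cell (a : ℕ) (i j : NatExpr)
  | add (e f : NatExpr)
  | sub (e f : NatExpr)

def NatExpr.eval (s : Store) : NatExpr → ℕ
  | const c => c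
  | cell a i j => s.nat a (i.eval s) (j.eval s)
  | add e f => e.eval s + f.eval s
  | sub e f => e.eval s - f.eval s

/-- The number of steps that evaluating the expression takes. -/
def NatExpr.cost : NatExpr → ℕ
  | const _ => 1
  | cell _ i j => i.cost + j.cost + 1
  | add e f => e.cost + f.cost + 1
  | sub e f => e.cost + f.cost + 1

/-- Expressions for real numbers; `ofNat` converts a natural number, and division by zero gives
zero. -/
inductive RealExpr
  | ofNat (e : NatExpr)
  | cell (a : ℕ) (i j : NatExpr)
  | add (x y : RealExpr)
  | sub (x y : RealExpr)
  | mul (x y : RealExpr)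
  | div (x y : RealExpr)

def RealExpr.eval (s : Store) : RealExpr → ℝ
  | ofNat e => (e.eval s : ℝ)
  | cell a i j => s.real a (i.eval s) (j.eval s)
  | add x y => x.eval s + y.eval s
  | sub x y => x.eval s - y.eval s
  | mul x y => x.eval s * y.eval s
  | div x y => x.eval s / y.eval s

/-- The number of steps that evaluating the expression takes. -/
def RealExpr.cost : RealExpr → ℕ
  | ofNat e => e.cost + 1
  | cell _ i j => i.cost + j.cost + 1
  | add x y => x.cost + y.cost + 1
  | sub x y => x.cost + y.cost + 1
  | mul x y => x.cost + y.cost + 1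
  | div x y => x.cost + y.cost + 1

/-- Tests. -/
inductive Test
  | natLt (e f : NatExpr)
  | natEq (e f : NatExpr)
  | realLt (x y : RealExpr)

def Test.Holds (s : Store) : Test → Prop
  | natLt e f => e.eval s < f.eval s
  | natEq e f => e.eval s = f.eval s
  | realLt x y => x.eval s < y.eval s

/-- The number of steps that evaluating the test takes. -/
def Test.cost : Test → ℕ
  | natLt e f => e.cost + f.cost + 1
  | natEq e f => e.cost + f.cost + 1
  | realLt x y => x.cost + y.cost + 1

/-- Programs. -/
inductive Program
  | skip
  | setNat (a : ℕ) (i j e : NatExpr)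
  | setReal (a : ℕ) (i j : NatExpr) (x : RealExpr)
  | seq (p q : Program)
  | ite (b : Test) (p q : Program)
  /-- Evaluate `e` once, to `N` say, and run `p` with the scalar `a` set to `0, 1, …, N - 1`. -/
  | loop (a : ℕ) (e : NatExpr) (p : Program)

/-- Run `body 0, …, body (N - 1)` one after the other from the store `s`; return the final store
and the total number of steps, each iteration being charged one step more than its body. -/
def iterate (body : ℕ → Store → Store × ℕ) (s : Store) : ℕ → Store × ℕ
  | 0 => (s, 0)
  | N + 1 =>
    let r := iterate body s N
    let r' := body N r.1
    (r'.1, r.2 + r'.2 + 1)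

open Classical in
/-- The final store of a program started on the store `s`, and the number of steps it takes. -/
def Program.exec : Program → Store → Store × ℕ
  | skip, s => (s, 1)
  | setNat a i j e, s =>
    (s.setNat a (i.eval s) (j.eval s) (e.eval s), i.cost + j.cost + e.cost + 1)
  | setReal a i j x, s =>
    (s.setReal a (i.eval s) (j.eval s) (x.eval s), i.cost + j.cost + x.cost + 1)
  | seq p q, s =>
    let r := p.exec s
    let r' := q.exec r.1
    (r'.1, r.2 + r'.2)
  | ite b p q, s =>
    let r := if b.Holds s then p.exec s else q.exec s
    (r.1, r.2 + b.cost + 1)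
  | loop a e p, s =>
    let r := iterate (fun k s' => p.exec (s'.setNat a 0 0 k)) s (e.eval s)
    (r.1, r.2 + e.cost + 1)

/-- The initial memory: the natural scalars `0, 1, 2` hold `n`, `m`, `T`, the real array `0` holds
the data matrix, the real scalar `1` holds `ν`, and everything else is zero. -/
def inputStore {m n : ℕ} (X : Matrix (Fin m) (Fin n) ℝ) (T : ℕ) (ν : ℝ) : Store where
  nat := fun a i j =>
    if i = 0 ∧ j = 0 then
      if a = 0 then n else if a = 1 then m else if a = 2 then T else 0
    else 0
  real := fun a i j =>
    if a = 0 then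
      if h : i < m ∧ j < n then X ⟨i, h.1⟩ ⟨j, h.2⟩ else 0
    else if a = 1 ∧ i = 0 ∧ j = 0 then ν else 0

/-- The neighborhood of `i` that is written in the final memory: the set of all `j` for which
entry `(i, j)` of the natural array `3` is `1`. -/
def outputSet (n : ℕ) (s : Store) (i : Fin n) : Finset (Fin n) :=
  Finset.univ.filter fun j : Fin n => s.nat 3 i j = 1

/-- The sets that the program `P` returns for the nodes, on the input `X`, `T`, `ν`. -/
def Program.result (P : Program) {m n : ℕ} (X : Matrix (Fin m) (Fin n) ℝ) (T : ℕ) (ν : ℝ)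
    (i : Fin n) : Finset (Fin n) :=
  outputSet n (P.exec (inputStore X T ν)).1 i

/-- The number of steps that the program `P` takes on the input `X`, `T`, `ν`. -/
def Program.steps (P : Program) {m n : ℕ} (X : Matrix (Fin m) (Fin n) ℝ) (T : ℕ) (ν : ℝ) : ℕ :=
  (P.exec (inputStore X T ν)).2

end GGM

end

/-! Represent the model by vectors `y j` with Gram matrix `Θ⁻¹`, and let `z` be the dual basis.
Conditioning on `S` projects away the span of the `y s`, `s ∈ S`, so conditional covariances are
inner products of residuals, and the rows of `Θ` outside `S` still invert them (`row_eq`). In an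
attractive model they are all nonnegative (`partialCov_nonneg`, an M-matrix argument). Hence the
excess `Θ i i * Var(X_i | X_S) - 1` splits into nonnegative contributions of the missing neighbors,
each at most the (scaled) drop in variance that this neighbor would cause. So the best missing
neighbor removes a fraction `1 / d` of the excess (`exists_drop`), and any missing one removes at
least `κ²` (`sq_le_drop`). A single neighbor already brings the scaled variance down to `1 / κ²`
(`sq_mul_diag_mul_le_one`), so a multiple of `d log (4 / κ²)` greedy steps pushes the excess below
`κ²`, and then no neighbor can be missing.

The data columns are the images of the `y j` under a random linear map. Chi-squared concentration,
nets and a union bound make it a near isometry with relative error `κ / 100` on the span of any `T +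
1` of the `y j` (`measureReal_not_near_le`). Square roots of drops are then preserved up to a
constant factor and an additive error of order `κ √Var / 100` (`sqrt_drop_comp_le`,
`le_sqrt_drop_comp`), while the drops that matter have square roots of order at least `κ √Var`. Thus
accuracy `κ`, not `κ²`, suffices, and this is why `m` scales like `1 / κ²`. Greedy steps lose only a
constant factor, and the pruning threshold separates neighbors from the rest (`lt_threshold_iff`).
On a good sample the argument is deterministic, so it covers all nodes, ties and orders at once.

For the running time, the program recomputes all residuals given the current set by Gram–Schmidt, in
`O(m n (|S| + 1))` steps, whenever it needs them. This happens `O(T)` times at each of the `n`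
nodes, for a total of `O(T² m n²)`. Correctness and cost are derived together from a Hoare-style
rule for loops (`loop_rule`). -/

namespace GGM

open scoped RealInnerProductSpace

/-! ### Projections, residuals and partial covariances. -/

section Residuals

variable {ι E : Type*} [NormedAddCommGroup E] [InnerProductSpace ℝ E] [FiniteDimensional ℝ E]

/-- The residual of a vector after projecting it onto the span of the vectors `y s`, `s ∈ S`. -/
noncomputable def resid (y : ι → E) (S : Finset ι) : E →L[ℝ] E :=
  (Submodule.span ℝ (y '' S))ᗮ.starProjection

/-- The inner product of the residuals of `y a` and `y b`: their partial covariance given `S`. -/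
noncomputable def partialCov (y : ι → E) (S : Finset ι) (a b : ι) : ℝ :=
  ⟪resid y S (y a), resid y S (y b)⟫

theorem sub_resid_mem (y : ι → E) (S : Finset ι) (v : E) :
    v - resid y S v ∈ Submodule.span ℝ (y '' S) := by
  rw [resid, Submodule.starProjection_orthogonal_val, sub_sub_cancel]
  exact Submodule.starProjection_apply_mem _ _

theorem inner_resid_of_mem (y : ι → E) (S : Finset ι) (v : E) {w : E}
    (hw : w ∈ Submodule.span ℝ (y '' S)) : ⟪resid y S v, w⟫ = 0 := by
  have h := Submodule.starProjection_apply_mem (Submodule.span ℝ (y '' S))ᗮ v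
  rw [real_inner_comm]
  exact (Submodule.mem_orthogonal _ _).1 h w hw

theorem resid_eq_of_forall (y : ι → E) (S : Finset ι) {v r : E}
    (h1 : v - r ∈ Submodule.span ℝ (y '' S)) (h2 : ∀ s ∈ S, ⟪r, y s⟫ = 0) :
    resid y S v = r := by
  refine Submodule.eq_starProjection_of_mem_orthogonal ?_ ?_
  · rw [Submodule.mem_orthogonal']
    intro w hw
    induction hw using Submodule.span_induction with
    | mem x hx => obtain ⟨s, hs, rfl⟩ := hx; exact h2 s hs
    | zero => simp
    | add a b _ _ ha hb => rw [inner_add_right, ha, hb, add_zero]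
    | smul c a _ ha => rw [inner_smul_right, ha, mul_zero]
  · exact Submodule.le_orthogonal_orthogonal _ h1

theorem resid_of_mem_span (y : ι → E) (S : Finset ι) {v : E}
    (hv : v ∈ Submodule.span ℝ (y '' S)) : resid y S v = 0 :=
  resid_eq_of_forall y S (by simpa using hv) (by simp)

theorem resid_self_eq_zero (y : ι → E) {S : Finset ι} {j : ι} (hj : j ∈ S) :
    resid y S (y j) = 0 :=
  resid_of_mem_span y S (Submodule.subset_span ⟨j, hj, rfl⟩)

@[simp]
theorem resid_empty (y : ι → E) (v : E) : resid y ∅ v = v :=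
  resid_eq_of_forall y ∅ (by simp) (by simp)

theorem inner_resid_resid (y : ι → E) (S : Finset ι) (v w : E) :
    ⟪resid y S v, resid y S w⟫ = ⟪resid y S v, w⟫ := by
  have h := inner_resid_of_mem y S v (sub_resid_mem y S w)
  rw [inner_sub_right] at h
  linarith

theorem norm_resid_le_norm_sub (y : ι → E) (S : Finset ι) (v : E) {w : E}
    (hw : w ∈ Submodule.span ℝ (y '' S)) : ‖resid y S v‖ ≤ ‖v - w‖ := by
  have h1 : resid y S (v - w) = resid y S v := by
    rw [map_sub, resid_of_mem_span y S hw, sub_zero]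
  rw [← h1]
  exact Submodule.norm_starProjection_apply_le _ _

theorem norm_resid_le (y : ι → E) (S : Finset ι) (v : E) : ‖resid y S v‖ ≤ ‖v‖ := by
  simpa using norm_resid_le_norm_sub y S v (Submodule.zero_mem _)

/-- One Gram–Schmidt step. No independence is needed: if `y j` already lies in the span, its
residual vanishes, the coefficient is `0 / 0 = 0`, and nothing is subtracted. The program `pivot`
performs exactly this update. -/
theorem resid_insert [DecidableEq ι] (y : ι → E) (S : Finset ι) (j : ι) (v : E) :
    resid y (insert j S) v = resid y S v -
      (⟪resid y S v, resid y S (y j)⟫ / ⟪resid y S (y j), resid y S (y j)⟫) •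
        resid y S (y j) := by
  set c := ⟪resid y S v, resid y S (y j)⟫ / ⟪resid y S (y j), resid y S (y j)⟫ with hc
  have hsub : Submodule.span ℝ (y '' S) ≤ Submodule.span ℝ (y '' (insert j S : Finset ι)) :=
    Submodule.span_mono (Set.image_mono (by simp))
  have hj : y j ∈ Submodule.span ℝ (y '' (insert j S : Finset ι)) :=
    Submodule.subset_span ⟨j, by simp, rfl⟩
  have hrj : resid y S (y j) ∈ Submodule.span ℝ (y '' (insert j S : Finset ι)) := by
    have := Submodule.sub_mem _ hj (hsub (sub_resid_mem y S (y j)))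
    simpa using this
  apply resid_eq_of_forall
  · have := Submodule.add_mem _ (hsub (sub_resid_mem y S v)) (Submodule.smul_mem _ c hrj)
    convert this using 1
    abel
  · intro s hs
    rw [inner_sub_left, inner_smul_left]
    rcases Finset.mem_insert.1 hs with rfl | hs
    · rw [← inner_resid_resid, ← inner_resid_resid y S (y s)]
      by_cases h0 : resid y S (y s) = 0
      · simp [h0]
      · have : ⟪resid y S (y s), resid y S (y s)⟫ ≠ 0 := by simpa using h0
        simp only [hc, RCLike.conj_to_real]
        field_simp
        ring
    · have hm : y s ∈ Submodule.span ℝ (y '' S) := Submodule.subset_span ⟨s, hs, rfl⟩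
      rw [inner_resid_of_mem y S _ hm, inner_resid_of_mem y S _ hm]
      simp

theorem partialCov_comm (y : ι → E) (S : Finset ι) (a b : ι) :
    partialCov y S a b = partialCov y S b a := real_inner_comm _ _

theorem partialCov_self_nonneg (y : ι → E) (S : Finset ι) (a : ι) : 0 ≤ partialCov y S a a :=
  real_inner_self_nonneg

theorem partialCov_eq_zero_of_mem_right (y : ι → E) {S : Finset ι} (a : ι) {b : ι} (hb : b ∈ S) :
    partialCov y S a b = 0 := by
  simp [partialCov, resid_self_eq_zero y hb]

/-- The Schur complement formula; the subtracted term is what a greedy step gains. -/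
theorem partialCov_insert [DecidableEq ι] (y : ι → E) (S : Finset ι) (j a : ι) :
    partialCov y (insert j S) a a =
      partialCov y S a a - partialCov y S a j ^ 2 / partialCov y S j j := by
  rw [partialCov, inner_resid_resid, resid_insert, inner_sub_left, inner_smul_left,
    ← inner_resid_resid, ← inner_resid_resid y S (y j) (y a), RCLike.conj_to_real,
    real_inner_comm (resid y S (y a)) (resid y S (y j))]
  simp only [partialCov]
  ring

end Residuals

section RSS

variable {m n : ℕ}

/-- The columns of the data matrix, as vectors of a Euclidean space. -/
noncomputable def dataCol (X : Matrix (Fin m) (Fin n) ℝ) (j : Fin n) : EuclideanSpace ℝ (Fin m) :=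
  WithLp.toLp 2 fun k => X k j

/-- The infimum is attained at the orthogonal projection. From here on the algorithm's quantities
and the population quantities are the same expression, in the data columns and in the vectors `y j`
respectively. -/
theorem rss_eq_partialCov (X : Matrix (Fin m) (Fin n) ℝ) (i : Fin n) (S : Finset (Fin n)) :
    rss X i S = partialCov (dataCol X) S i i := by
  have hval : ∀ w : Fin n → ℝ, ∑ k, (X k i - ∑ j ∈ S, w j * X k j) ^ 2 =
      ‖dataCol X i - ∑ j ∈ S, w j • dataCol X j‖ ^ 2 := by
    intro w
    rw [EuclideanSpace.real_norm_sq_eq]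
    refine Finset.sum_congr rfl fun k _ => ?_
    simp [dataCol]
  have hmem : ∀ w : Fin n → ℝ, ∑ j ∈ S, w j • dataCol X j ∈
      Submodule.span ℝ (dataCol X '' S) := fun w =>
    Submodule.sum_mem _ fun j hj => Submodule.smul_mem _ _ (Submodule.subset_span ⟨j, hj, rfl⟩)
  unfold rss
  simp_rw [hval]
  rw [partialCov, real_inner_self_eq_norm_sq]
  apply le_antisymm
  · obtain ⟨w, hw⟩ := Submodule.mem_span_image_finset_iff_exists_fun' ℝ |>.1
      (sub_resid_mem (dataCol X) S (dataCol X i))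
    refine ciInf_le_of_le ⟨0, ?_⟩ w ?_
    · rintro _ ⟨w, rfl⟩; positivity
    · rw [hw]; simp
  · refine le_ciInf fun w => ?_
    gcongr
    exact norm_resid_le_norm_sub _ _ _ (hmem w)

end RSS

end GGM

namespace GGM

open scoped RealInnerProductSpace

/-! ### Conditional variances in an attractive model. -/

section Population

variable {n : ℕ} {E : Type*} [NormedAddCommGroup E] [InnerProductSpace ℝ E]

/-- `y` and `z` are dual bases of a Euclidean space, and `Θ` is the Gram matrix of `z`; so `Θ⁻¹` is
the Gram matrix of `y`. -/
structure IsPrecisionPair (Θ : Matrix (Fin n) (Fin n) ℝ) (y z : Fin n → E) : Prop where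
  inner_eq : ∀ i j, ⟪z i, y j⟫ = if i = j then 1 else 0
  eq_sum : ∀ i, z i = ∑ j, Θ i j • y j

namespace IsPrecisionPair

variable {Θ : Matrix (Fin n) (Fin n) ℝ} {y z : Fin n → E}

theorem gram (h : IsPrecisionPair Θ y z) (i j : Fin n) : ⟪z i, z j⟫ = Θ i j := by
  rw [real_inner_comm, h.eq_sum i, inner_sum]
  simp [inner_smul_right, h.inner_eq]

theorem symm (h : IsPrecisionPair Θ y z) (i j : Fin n) : Θ i j = Θ j i := by
  rw [← h.gram, ← h.gram, real_inner_comm]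

theorem diag_pos (h : IsPrecisionPair Θ y z) (i : Fin n) : 0 < Θ i i := by
  rw [← h.gram, real_inner_self_pos]
  intro h0
  have := h.inner_eq i i
  simp [h0] at this

variable {κ : ℝ}

theorem mem_neighbors {i j : Fin n} : j ∈ neighbors Θ i ↔ j ≠ i ∧ Θ i j ≠ 0 := by
  simp [neighbors]

theorem sq_le_of_isNondegenerate (h : IsPrecisionPair Θ y z) (hκ : 0 < κ)
    (hN : IsNondegenerate κ Θ) {i j : Fin n} (hj : j ∈ neighbors Θ i) :
    κ ^ 2 * (Θ i i * Θ j j) ≤ Θ i j ^ 2 := by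
  obtain ⟨hji, h0⟩ := mem_neighbors.1 hj
  have hpos : 0 < Θ i i * Θ j j := mul_pos (h.diag_pos i) (h.diag_pos j)
  have h1 := hN i j hji.symm h0
  rw [le_div_iff₀ (Real.sqrt_pos.2 hpos)] at h1
  have h2 : (κ * √(Θ i i * Θ j j)) ^ 2 ≤ |Θ i j| ^ 2 := by gcongr
  rwa [mul_pow, Real.sq_sqrt hpos.le, sq_abs] at h2

variable [FiniteDimensional ℝ E]

theorem inner_resid (h : IsPrecisionPair Θ y z) {S : Finset (Fin n)} {a : Fin n} (ha : a ∉ S)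
    (v : E) : ⟪z a, resid y S v⟫ = ⟪z a, v⟫ := by
  have h0 : ∀ w ∈ Submodule.span ℝ (y '' S), ⟪z a, w⟫ = 0 := by
    intro w hw
    induction hw using Submodule.span_induction with
    | mem x hx =>
      obtain ⟨s, hs, rfl⟩ := hx
      rw [h.inner_eq, if_neg]
      rintro rfl
      exact ha hs
    | zero => simp
    | add p q _ _ hp hq => rw [inner_add_right, hp, hq, add_zero]
    | smul c p _ hp => rw [inner_smul_right, hp, mul_zero]
  have := h0 _ (sub_resid_mem y S v)
  rw [inner_sub_right] at this
  linarith

/-- Expands `z a` in the `y k` and uses that the residual projection is symmetric and idempotent. No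
condition on `a` is imposed, since the case `a ∈ S` is also needed, where the right-hand side is
minus a regression coefficient. -/
theorem sum_mul_partialCov (h : IsPrecisionPair Θ y z) (S : Finset (Fin n)) (a b : Fin n) :
    ∑ k, Θ a k * partialCov y S k b = ⟪z a, resid y S (y b)⟫ := by
  rw [h.eq_sum a, sum_inner]
  refine Finset.sum_congr rfl fun k _ => ?_
  rw [real_inner_smul_left, partialCov, real_inner_comm, inner_resid_resid, real_inner_comm]

/-- For `a ∉ S` the dual vector `z a` is orthogonal to the span that is projected away, so it does
not notice the projection. -/
theorem row_eq (h : IsPrecisionPair Θ y z) {S : Finset (Fin n)} {a : Fin n} (ha : a ∉ S)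
    (b : Fin n) : ∑ k, Θ a k * partialCov y S k b = if a = b then 1 else 0 := by
  rw [h.sum_mul_partialCov, h.inner_resid ha, h.inner_eq]

/-- Partial covariances of an attractive model are nonnegative. -/
theorem partialCov_nonneg (h : IsPrecisionPair Θ y z) (hA : IsAttractive Θ) (S : Finset (Fin n))
    (a b : Fin n) : 0 ≤ partialCov y S a b := by
  set u : Fin n → ℝ := fun k => partialCov y S k b with hu
  -- The row equations are tested against the negative part `q` of the column `u`. The result is
  -- nonnegative by `row_eq`. It is also at most `-‖∑ k, q k • z k‖ ^ 2`, because off-diagonal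
  -- entries of `Θ` are nonpositive and `q k * (u k + q k) = 0`. Hence `∑ k, q k • z k = 0`, and
  -- pairing with `y a` gives `q a = 0`.
  set q : Fin n → ℝ := fun k => max (-u k) 0 with hq
  have hq0 : ∀ k, 0 ≤ q k := fun k => le_max_right _ _
  have hrow : 0 ≤ ∑ k, q k * ∑ l, Θ k l * u l := by
    refine Finset.sum_nonneg fun k _ => ?_
    by_cases hk : k ∈ S
    · have : u k = 0 := by
        simp only [hu]; rw [partialCov_comm, partialCov_eq_zero_of_mem_right y b hk]
      simp [hq, this]
    · refine mul_nonneg (hq0 k) ?_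
      rw [h.row_eq hk b]
      split_ifs <;> norm_num
  have hle : ∑ k, q k * ∑ l, Θ k l * u l ≤ - ∑ k, q k * ∑ l, Θ k l * q l := by
    rw [← Finset.sum_neg_distrib]
    refine Finset.sum_le_sum fun k _ => ?_
    rw [← mul_neg, ← Finset.sum_neg_distrib, Finset.mul_sum, Finset.mul_sum]
    refine Finset.sum_le_sum fun l _ => ?_
    have hp : 0 ≤ u l + q l := by
      have := le_max_left (-u l) 0
      simp only [hq]; linarith
    by_cases hkl : k = l
    · subst hkl
      have : q k * (u k + q k) = 0 := by
        simp only [hq]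
        rcases le_total (-u k) 0 with h1 | h1
        · rw [max_eq_right h1]; ring
        · rw [max_eq_left h1]; ring
      linear_combination Θ k k * this
    · have h1 := hA k l hkl
      have h2 : q k * (Θ k l * (u l + q l)) ≤ 0 :=
        mul_nonpos_of_nonneg_of_nonpos (hq0 k) (mul_nonpos_of_nonpos_of_nonneg h1 hp)
      nlinarith
  have hnorm : ∑ k, q k * ∑ l, Θ k l * q l = ‖∑ k, q k • z k‖ ^ 2 := by
    rw [← real_inner_self_eq_norm_sq, sum_inner]
    refine Finset.sum_congr rfl fun k _ => ?_
    rw [inner_sum, Finset.mul_sum]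
    refine Finset.sum_congr rfl fun l _ => ?_
    rw [real_inner_smul_left, real_inner_smul_right, h.gram]
    ring
  have hz : ∑ k, q k • z k = 0 := by
    have : ‖∑ k, q k • z k‖ ^ 2 ≤ 0 := by linarith
    have := pow_eq_zero_iff (two_ne_zero) |>.1 (le_antisymm this (sq_nonneg _))
    simpa using this
  have hqa : q a = 0 := by
    have : ⟪∑ k, q k • z k, y a⟫ = q a := by
      rw [sum_inner]
      simp [real_inner_smul_left, h.inner_eq]
    rw [← this, hz, inner_zero_left]
  have := le_max_left (-u a) 0
  change -u a ≤ q a at this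
  change 0 ≤ u a
  linarith

/-- The row equation, with the diagonal term singled out. -/
theorem diag_mul_partialCov (h : IsPrecisionPair Θ y z) {S : Finset (Fin n)} {a : Fin n}
    (ha : a ∉ S) (b : Fin n) :
    Θ a a * partialCov y S a b =
      (if a = b then 1 else 0) + ∑ k ∈ Finset.univ.erase a, -Θ a k * partialCov y S k b := by
  have := h.row_eq ha b
  rw [← Finset.add_sum_erase _ _ (Finset.mem_univ a)] at this
  simp only [neg_mul, Finset.sum_neg_distrib]
  linarith

/-- In an attractive model all terms of the row equation are nonnegative, so all but one may be
dropped. -/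
theorem single_le_diag_mul (h : IsPrecisionPair Θ y z) (hA : IsAttractive Θ)
    {S : Finset (Fin n)} {a b j : Fin n} (ha : a ∉ S) (haj : j ≠ a) :
    (if a = b then 1 else 0) + -Θ a j * partialCov y S j b ≤ Θ a a * partialCov y S a b := by
  rw [h.diag_mul_partialCov ha b]
  gcongr
  refine Finset.single_le_sum (f := fun k => -Θ a k * partialCov y S k b) ?_ (by simp [haj])
  intro k hk
  have := hA a k (Finset.ne_of_mem_erase hk).symm
  exact mul_nonneg (by linarith) (h.partialCov_nonneg hA S k b)

theorem one_le_diag_mul (h : IsPrecisionPair Θ y z) (hA : IsAttractive Θ)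
    {S : Finset (Fin n)} {a : Fin n} (ha : a ∉ S) : 1 ≤ Θ a a * partialCov y S a a := by
  rw [h.diag_mul_partialCov ha a, if_pos rfl]
  have : 0 ≤ ∑ k ∈ Finset.univ.erase a, -Θ a k * partialCov y S k a := by
    refine Finset.sum_nonneg fun k hk => ?_
    have := hA a k (Finset.ne_of_mem_erase hk).symm
    exact mul_nonneg (by linarith) (h.partialCov_nonneg hA S k a)
  linarith

theorem partialCov_self_pos (h : IsPrecisionPair Θ y z) (hA : IsAttractive Θ)
    {S : Finset (Fin n)} {a : Fin n} (ha : a ∉ S) : 0 < partialCov y S a a := by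
  have h1 := h.one_le_diag_mul hA ha
  have h2 := h.diag_pos a
  by_contra h3
  nlinarith [mul_nonneg h2.le (neg_nonneg.2 (not_lt.1 h3))]

/-- The excess of the conditional variance is a sum over the neighbors that are not conditioned
on. -/
theorem diag_mul_eq_sum_neighbors (h : IsPrecisionPair Θ y z) {S : Finset (Fin n)} {i : Fin n}
    (hi : i ∉ S) :
    Θ i i * partialCov y S i i = 1 + ∑ j ∈ neighbors Θ i \ S, -Θ i j * partialCov y S j i := by
  rw [h.diag_mul_partialCov hi i, if_pos rfl]
  congr 1
  symm
  refine Finset.sum_subset ?_ ?_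
  · intro j hj
    simp only [Finset.mem_sdiff, mem_neighbors] at hj
    simp [hj.1.1]
  · intro j hj1 hj2
    simp only [Finset.mem_sdiff, mem_neighbors, not_and, not_not] at hj2
    by_cases h0 : Θ i j = 0
    · simp [h0]
    · rw [partialCov_comm,
        partialCov_eq_zero_of_mem_right y i (hj2 ⟨Finset.ne_of_mem_erase hj1, h0⟩), mul_zero]

theorem diag_mul_eq_one (h : IsPrecisionPair Θ y z) {S : Finset (Fin n)} {i : Fin n}
    (hi : i ∉ S) (hN : neighbors Θ i ⊆ S) : Θ i i * partialCov y S i i = 1 := by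
  rw [h.diag_mul_eq_sum_neighbors hi, Finset.sdiff_eq_empty_iff_subset.2 hN]
  simp

/-- Keeping only the term of `j` in row `i` bounds `-Θ i j * partialCov y S j j` by `Θ i i *
partialCov y S i j`; multiply by `partialCov y S i j / partialCov y S j j`. This compares each
summand of the excess with the gain of a greedy step. -/
theorem neg_mul_le_drop (h : IsPrecisionPair Θ y z) (hA : IsAttractive Θ)
    {S : Finset (Fin n)} {i j : Fin n} (hi : i ∉ S) (hj : j ∉ S) (hij : j ≠ i) :
    -Θ i j * partialCov y S j i ≤ Θ i i * (partialCov y S i j ^ 2 / partialCov y S j j) := by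
  have h1 := h.single_le_diag_mul hA (b := j) hi hij
  rw [if_neg hij.symm, zero_add] at h1
  have hp := h.partialCov_self_pos hA hj
  rw [mul_div_assoc', le_div_iff₀ hp, partialCov_comm y S j i]
  nlinarith [h.partialCov_nonneg hA S i j]

/-- Adding a missing neighbor lowers the conditional variance by at least `κ² / Θ i i`. -/
theorem sq_le_drop (h : IsPrecisionPair Θ y z) (hA : IsAttractive Θ) (hκ : 0 < κ)
    (hN : IsNondegenerate κ Θ) {S : Finset (Fin n)} {i j : Fin n} (hi : i ∉ S) (hj : j ∉ S)
    (hjN : j ∈ neighbors Θ i) :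
    κ ^ 2 ≤ Θ i i * (partialCov y S i j ^ 2 / partialCov y S j j) := by
  have hij := (mem_neighbors.1 hjN).1
  have h1 := h.single_le_diag_mul hA (b := j) hi hij
  rw [if_neg hij.symm, zero_add] at h1
  have hp := h.partialCov_self_pos hA hj
  have h2 := h.one_le_diag_mul hA hj
  have h3 := h.sq_le_of_isNondegenerate hκ hN hjN
  have hi' := h.diag_pos i
  have hj' := h.diag_pos j
  have h4 : (-Θ i j * partialCov y S j j) ^ 2 ≤ (Θ i i * partialCov y S i j) ^ 2 := by
    have := hA i j hij.symm
    have : 0 ≤ -Θ i j * partialCov y S j j := mul_nonneg (by linarith) hp.le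
    gcongr
  rw [mul_div_assoc', le_div_iff₀ hp]
  set c := partialCov y S j j
  set b := partialCov y S i j
  -- The chain is `(Θ i i * b)² ≥ (Θ i j * c)² ≥ κ² Θ i i Θ j j c² ≥ κ² Θ i i c`, the last step by
  -- `Θ j j * c ≥ 1`.
  have h5 : κ ^ 2 * (Θ i i * Θ j j) * c ^ 2 ≤ (Θ i i * b) ^ 2 := by
    nlinarith [mul_le_mul_of_nonneg_right h3 (sq_nonneg c)]
  have h6 : κ ^ 2 * Θ i i * c ≤ κ ^ 2 * (Θ i i * Θ j j) * c ^ 2 := by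
    have : 0 ≤ κ ^ 2 * Θ i i * c := by positivity
    nlinarith [mul_le_mul_of_nonneg_left h2 this]
  have h7 : Θ i i * (κ ^ 2 * c) ≤ Θ i i * (Θ i i * b ^ 2) := by nlinarith
  exact le_of_mul_le_mul_left h7 hi'

/-- A missing neighbor would lower the scaled variance by `κ²`, and it can never fall below `1`. An
excess smaller than `κ²` therefore certifies that all neighbors have been found. -/
theorem one_add_sq_le_diag_mul (h : IsPrecisionPair Θ y z) (hA : IsAttractive Θ) (hκ : 0 < κ)
    (hN : IsNondegenerate κ Θ) {S : Finset (Fin n)} {i : Fin n} (hi : i ∉ S)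
    (hNS : ¬ neighbors Θ i ⊆ S) : 1 + κ ^ 2 ≤ Θ i i * partialCov y S i i := by
  obtain ⟨j, hjN, hj⟩ := Finset.not_subset.1 hNS
  have h1 := h.sq_le_drop hA hκ hN hi hj hjN
  have hij := (mem_neighbors.1 hjN).1
  have h2 := h.one_le_diag_mul hA (S := insert j S) (a := i) (by simp [hi, hij.symm])
  rw [partialCov_insert] at h2
  linarith

/-- Some missing neighbor makes up a fraction of the excess of the conditional variance. -/
theorem exists_drop (h : IsPrecisionPair Θ y z) (hA : IsAttractive Θ)
    {S : Finset (Fin n)} {i : Fin n} (hi : i ∉ S) (hNS : ¬ neighbors Θ i ⊆ S) :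
    ∃ j ∈ neighbors Θ i \ S, Θ i i * partialCov y S i i - 1 ≤
      (neighbors Θ i).card * (Θ i i * (partialCov y S i j ^ 2 / partialCov y S j j)) := by
  have hne : (neighbors Θ i \ S).Nonempty := by
    rwa [Finset.nonempty_iff_ne_empty, Ne, Finset.sdiff_eq_empty_iff_subset]
  obtain ⟨j, hj, hmax⟩ := Finset.exists_max_image (neighbors Θ i \ S)
    (fun j => Θ i i * (partialCov y S i j ^ 2 / partialCov y S j j)) hne
  refine ⟨j, hj, ?_⟩
  rw [h.diag_mul_eq_sum_neighbors hi, add_sub_cancel_left]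
  set D := Θ i i * (partialCov y S i j ^ 2 / partialCov y S j j) with hD
  have hD0 : 0 ≤ D :=
    mul_nonneg (h.diag_pos i).le (div_nonneg (sq_nonneg _) (partialCov_self_nonneg _ _ _))
  calc ∑ l ∈ neighbors Θ i \ S, -Θ i l * partialCov y S l i
      ≤ ∑ l ∈ neighbors Θ i \ S, D := by
        refine Finset.sum_le_sum fun l hl => (h.neg_mul_le_drop hA hi ?_ ?_).trans (hmax l hl)
        · exact (Finset.mem_sdiff.1 hl).2
        · exact (mem_neighbors.1 (Finset.mem_sdiff.1 hl).1).1
    _ = (neighbors Θ i \ S).card * D := by simp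
    _ ≤ (neighbors Θ i).card * D := by
        gcongr
        exact Finset.sdiff_subset

/-- A node has at most `1 / κ²` neighbors. -/
theorem card_neighbors_mul_sq_le (h : IsPrecisionPair Θ y z) (hA : IsAttractive Θ) (hκ : 0 < κ)
    (hN : IsNondegenerate κ Θ) (i : Fin n) : (neighbors Θ i).card * κ ^ 2 ≤ 1 := by
  have h1 := h.diag_mul_eq_sum_neighbors (S := ∅) (i := i) (by simp)
  have hp := h.partialCov_self_pos hA (S := ∅) (a := i) (by simp)
  set c := partialCov y ∅ i i
  -- Row `j` bounds the covariance of `j` and `i` below by `-Θ i j * c / Θ j j`, so nondegeneracy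
  -- makes every neighbor account for a fraction at least `κ²` of `Θ i i * c`. By row `i` these
  -- fractions add up to at most `1`.
  have h2 : ∑ j ∈ neighbors Θ i \ ∅, κ ^ 2 * Θ i i * c ≤
      ∑ j ∈ neighbors Θ i \ ∅, -Θ i j * partialCov y ∅ j i := by
    refine Finset.sum_le_sum fun j hj => ?_
    have hjN : j ∈ neighbors Θ i := (Finset.mem_sdiff.1 hj).1
    have hij := (mem_neighbors.1 hjN).1
    have h3 := h.single_le_diag_mul hA (S := ∅) (a := j) (b := i) (by simp) hij.symm
    rw [if_neg hij, zero_add, h.symm j i] at h3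
    have h4 := h.sq_le_of_isNondegenerate hκ hN hjN
    have h5 : 0 ≤ -Θ i j := by linarith [hA i j hij.symm]
    have hj' := h.diag_pos j
    refine le_of_mul_le_mul_left ?_ hj'
    change -Θ i j * c ≤ Θ j j * partialCov y ∅ j i at h3
    nlinarith [mul_le_mul_of_nonneg_left h3 h5, mul_le_mul_of_nonneg_right h4 hp.le]
  rw [Finset.sum_const, nsmul_eq_mul, Finset.sdiff_empty] at h2
  have h6 : 0 < Θ i i * c := mul_pos (h.diag_pos i) hp
  rw [Finset.sdiff_empty] at h1
  have h7 : (Θ i i * c) * ((neighbors Θ i).card * κ ^ 2) ≤ (Θ i i * c) * 1 := by linarith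
  exact le_of_mul_le_mul_left h7 h6

/-- Conditioning on any one neighbor bounds the conditional variance by `1 / (κ² Θ i i)`. -/
theorem sq_mul_diag_mul_le_one (h : IsPrecisionPair Θ y z) (hA : IsAttractive Θ) (hκ : 0 < κ)
    (hN : IsNondegenerate κ Θ) {i j : Fin n} (hj : j ∈ neighbors Θ i) :
    κ ^ 2 * (Θ i i * partialCov y {j} i i) ≤ 1 := by
  obtain ⟨hij, -⟩ := mem_neighbors.1 hj
  have ha := h.partialCov_self_pos hA (S := ∅) (a := i) (by simp)
  have hc := h.partialCov_self_pos hA (S := ∅) (a := j) (by simp)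
  set a := partialCov y ∅ i i with had
  set c := partialCov y ∅ j j with hcd
  set b := partialCov y ∅ i j with hbd
  have hb : 0 ≤ b := h.partialCov_nonneg hA ∅ i j
  have hV : partialCov y {j} i i = a - b ^ 2 / c := by
    have := partialCov_insert y ∅ j i
    simpa using this
  have hW : partialCov y {i} j j = c - b ^ 2 / a := by
    have := partialCov_insert y ∅ i j
    rw [partialCov_comm y ∅ j i] at this
    simpa using this
  have hVpos := h.partialCov_self_pos hA (S := {j}) (a := i) (by simpa using hij.symm)
  have hW1 := h.one_le_diag_mul hA (S := {i}) (a := j) (by simpa using hij)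
  -- Row `j` is used although `j` is conditioned on: its value is then `-(b / c)`, minus the
  -- regression coefficient of `i` on `j`. All its terms are nonpositive, so the term of `i` alone
  -- is bounded.
  have hrow : -Θ i j * partialCov y {j} i i ≤ b / c := by
    have h1 : ∑ k, Θ j k * partialCov y {j} k i = -(b / c) := by
      rw [h.sum_mul_partialCov]
      have := resid_insert y ∅ j (y i)
      simp only [insert_empty_eq] at this
      rw [this, inner_sub_right, inner_smul_right]
      simp [h.inner_eq, hij, hbd, hcd, partialCov]
    rw [← Finset.add_sum_erase _ _ (Finset.mem_univ i)] at h1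
    have h2 : ∑ k ∈ Finset.univ.erase i, Θ j k * partialCov y {j} k i ≤ 0 := by
      refine Finset.sum_nonpos fun k _ => ?_
      by_cases hk : k = j
      · subst hk
        rw [partialCov_comm, partialCov_eq_zero_of_mem_right y i (by simp), mul_zero]
      · exact mul_nonpos_of_nonpos_of_nonneg (hA j k (Ne.symm hk)) (h.partialCov_nonneg hA _ k i)
    rw [h.symm j i] at h1
    linarith
  set V := partialCov y {j} i i with hVd
  have h3 := h.sq_le_of_isNondegenerate hκ hN hj
  have hi' := h.diag_pos i
  have hj' := h.diag_pos j
  have hVc : V * c = a * c - b ^ 2 := by rw [hV]; field_simp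
  have hWa : a ≤ Θ j j * (a * c - b ^ 2) := by
    rw [hW] at hW1
    have := mul_le_mul_of_nonneg_left hW1 ha.le
    have h9 : a * (Θ j j * (c - b ^ 2 / a)) = Θ j j * (a * c - b ^ 2) := by field_simp
    linarith
  have hneg : 0 ≤ -Θ i j := by linarith [hA i j hij.symm]
  have h4 : Θ i j ^ 2 * V ^ 2 ≤ (b / c) ^ 2 := by
    have : (-Θ i j * V) ^ 2 ≤ (b / c) ^ 2 := by
      have : 0 ≤ -Θ i j * V := mul_nonneg hneg hVpos.le
      gcongr
    nlinarith
  -- Cauchy–Schwarz gives `b² ≤ a * c`. The bound `1 ≤ Θ j j * partialCov y {i} j j`, cleared of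
  -- denominators, gives `a ≤ Θ j j * V * c`.
  have h5 : (b / c) ^ 2 ≤ V * Θ j j := by
    rw [div_pow, div_le_iff₀ (by positivity)]
    have : b ^ 2 ≤ a * c := by nlinarith [mul_pos hVpos hc]
    have h8 : V * Θ j j * c ^ 2 = Θ j j * (a * c - b ^ 2) * c := by rw [← hVc]; ring
    rw [h8]
    exact this.trans (mul_le_mul_of_nonneg_right hWa hc.le)
  have h6 : κ ^ 2 * (Θ i i * Θ j j) * V ^ 2 ≤ V * Θ j j := by
    nlinarith [mul_le_mul_of_nonneg_right h3 (sq_nonneg V)]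
  have h7 : (V * Θ j j) * (κ ^ 2 * (Θ i i * V)) ≤ (V * Θ j j) * 1 := by nlinarith
  exact le_of_mul_le_mul_left h7 (mul_pos hVpos hj')

end IsPrecisionPair

end Population

end GGM

namespace GGM

open scoped RealInnerProductSpace

/-! ### Near isometries. -/

section NearIsometry

variable {E F : Type*} [NormedAddCommGroup E] [InnerProductSpace ℝ E]
  [NormedAddCommGroup F] [InnerProductSpace ℝ F]

/-- On the subspace `W`, the map `A` multiplies squared norms by `M`, up to the relative error
`ε`. -/
def IsNearIsometry (A : E →ₗ[ℝ] F) (W : Submodule ℝ E) (M ε : ℝ) : Prop :=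
  ∀ v ∈ W, |‖A v‖ ^ 2 - M * ‖v‖ ^ 2| ≤ ε * M * ‖v‖ ^ 2

namespace IsNearIsometry

variable {A : E →ₗ[ℝ] F} {W : Submodule ℝ E} {M ε : ℝ}

theorem le_norm_sq (h : IsNearIsometry A W M ε) {v : E} (hv : v ∈ W) :
    (1 - ε) * M * ‖v‖ ^ 2 ≤ ‖A v‖ ^ 2 := by
  have := (abs_le.1 (h v hv)).1
  linarith

theorem norm_sq_le (h : IsNearIsometry A W M ε) {v : E} (hv : v ∈ W) :
    ‖A v‖ ^ 2 ≤ (1 + ε) * M * ‖v‖ ^ 2 := by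
  have := (abs_le.1 (h v hv)).2
  linarith

/-- Polarization, applied to `a + b` and `a - b`, gives the bound with the mean of the squared
norms. Rescaling to `‖b‖ • a` and `‖a‖ • b`, which have equal norms, turns the mean into the
product. -/
theorem abs_inner_sub_le (h : IsNearIsometry A W M ε) {a b : E} (ha : a ∈ W) (hb : b ∈ W) :
    |⟪A a, A b⟫ - M * ⟪a, b⟫| ≤ ε * M * (‖a‖ * ‖b‖) := by
  have key : ∀ p ∈ W, ∀ q ∈ W,
      |⟪A p, A q⟫ - M * ⟪p, q⟫| ≤ ε * M * ((‖p‖ ^ 2 + ‖q‖ ^ 2) / 2) := by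
    intro p hp q hq
    have h1 := h _ (W.add_mem hp hq)
    have h2 := h _ (W.sub_mem hp hq)
    rw [map_add, norm_add_sq_real, norm_add_sq_real] at h1
    rw [map_sub, norm_sub_sq_real, norm_sub_sq_real] at h2
    rw [abs_le] at h1 h2 ⊢
    constructor <;> linarith [h1.1, h1.2, h2.1, h2.2]
  rcases eq_or_ne a 0 with rfl | ha0
  · simp
  rcases eq_or_ne b 0 with rfl | hb0
  · simp
  have hab : 0 < ‖a‖ * ‖b‖ := mul_pos (norm_pos_iff.2 ha0) (norm_pos_iff.2 hb0)
  have h3 := key (‖b‖ • a) (W.smul_mem _ ha) (‖a‖ • b) (W.smul_mem _ hb)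
  rw [map_smul, map_smul, real_inner_smul_left, real_inner_smul_right, real_inner_smul_left,
    real_inner_smul_right, norm_smul, norm_smul, norm_norm, norm_norm] at h3
  have h4 : ‖b‖ * (‖a‖ * ⟪A a, A b⟫) - M * (‖b‖ * (‖a‖ * ⟪a, b⟫)) =
      (‖a‖ * ‖b‖) * (⟪A a, A b⟫ - M * ⟪a, b⟫) := by ring
  rw [h4, abs_mul, abs_of_pos hab] at h3
  have h5 : ε * M * (((‖b‖ * ‖a‖) ^ 2 + (‖a‖ * ‖b‖) ^ 2) / 2) =
      (‖a‖ * ‖b‖) * (ε * M * (‖a‖ * ‖b‖)) := by ring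
  rw [h5] at h3
  exact le_of_mul_le_mul_left h3 hab

end IsNearIsometry

end NearIsometry

/-! ### Passing partial covariances through a near isometry. -/

section Transfer

variable {ι E F : Type*} [NormedAddCommGroup E] [InnerProductSpace ℝ E]
  [FiniteDimensional ℝ E] [NormedAddCommGroup F] [InnerProductSpace ℝ F] [FiniteDimensional ℝ F]
  {A : E →ₗ[ℝ] F} {M ε : ℝ} {y : ι → E}

omit [FiniteDimensional ℝ E] [FiniteDimensional ℝ F] in
theorem span_image_comp (A : E →ₗ[ℝ] F) (y : ι → E) (S : Finset ι) :
    Submodule.span ℝ ((fun j => A (y j)) '' S) = (Submodule.span ℝ (y '' S)).map A := by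
  rw [Submodule.map_span, ← Set.image_comp]
  rfl

theorem resid_comp (A : E →ₗ[ℝ] F) (y : ι → E) (S : Finset ι) (j : ι) :
    resid (fun j => A (y j)) S (A (y j)) = resid (fun j => A (y j)) S (A (resid y S (y j))) := by
  have h1 : A (y j - resid y S (y j)) ∈ Submodule.span ℝ ((fun j => A (y j)) '' S) := by
    rw [span_image_comp]
    exact Submodule.mem_map_of_mem (sub_resid_mem y S _)
  have h2 := resid_of_mem_span _ _ h1
  rw [map_sub, map_sub, sub_eq_zero] at h2
  exact h2

theorem resid_mem_span (y : ι → E) {S U : Finset ι} (hSU : S ⊆ U) {i : ι} (hi : i ∈ U) :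
    resid y S (y i) ∈ Submodule.span ℝ (y '' U) := by
  have h1 : y i ∈ Submodule.span ℝ (y '' U) := Submodule.subset_span ⟨i, hi, rfl⟩
  have h2 := Submodule.span_mono (Set.image_mono hSU) (sub_resid_mem y S (y i))
  simpa using Submodule.sub_mem _ h1 h2

variable {S U : Finset ι} {i j : ι}

theorem partialCov_comp_le (hA : IsNearIsometry A (Submodule.span ℝ (y '' U)) M ε)
    (hSU : S ⊆ U) (hi : i ∈ U) :
    partialCov (fun j => A (y j)) S i i ≤ (1 + ε) * M * partialCov y S i i := by
  simp only [partialCov, real_inner_self_eq_norm_sq]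
  rw [resid_comp]
  refine le_trans ?_ (hA.norm_sq_le (resid_mem_span y hSU hi))
  gcongr
  exact norm_resid_le _ _ _

/-- The vector `s` measures how far projecting after `A` differs from projecting before. It is
orthogonal to the population residual, so Pythagoras adds the two squared norms; the extra `‖s‖ ^ 2`
is what later shows that `s` is small. -/
theorem le_norm_sq_resid_comp (hA : IsNearIsometry A (Submodule.span ℝ (y '' U)) M ε)
    (hSU : S ⊆ U) (hi : i ∈ U) :
    ∃ s ∈ Submodule.span ℝ (y '' S),
      resid (fun j => A (y j)) S (A (y i)) = A (resid y S (y i)) - A s ∧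
      (1 - ε) * M * (‖resid y S (y i)‖ ^ 2 + ‖s‖ ^ 2) ≤
        ‖resid (fun j => A (y j)) S (A (y i))‖ ^ 2 := by
  have h1 := sub_resid_mem (fun j => A (y j)) S (A (resid y S (y i)))
  rw [span_image_comp] at h1
  obtain ⟨s, hs, hs'⟩ := h1
  have h2 : resid (fun j => A (y j)) S (A (y i)) = A (resid y S (y i)) - A s := by
    rw [hs', resid_comp]; abel
  refine ⟨s, hs, h2, ?_⟩
  rw [h2, ← map_sub]
  refine le_trans (le_of_eq ?_) (hA.le_norm_sq (Submodule.sub_mem _ (resid_mem_span y hSU hi)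
    (Submodule.span_mono (Set.image_mono hSU) hs)))
  rw [norm_sub_sq_real, inner_resid_of_mem y S _ hs]
  ring

theorem le_partialCov_comp (hA : IsNearIsometry A (Submodule.span ℝ (y '' U)) M ε)
    (hM : 0 < M) (hε1 : ε ≤ 1) (hSU : S ⊆ U) (hi : i ∈ U) :
    (1 - ε) * M * partialCov y S i i ≤ partialCov (fun j => A (y j)) S i i := by
  obtain ⟨s, -, -, h⟩ := le_norm_sq_resid_comp hA hSU hi
  simp only [partialCov, real_inner_self_eq_norm_sq]
  refine le_trans ?_ h
  have : 0 ≤ (1 - ε) * M := mul_nonneg (by linarith) hM.le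
  gcongr
  linarith [sq_nonneg ‖s‖]

/-- With `u`, `t` the population residuals, the sample covariance is `⟪A u, A t⟫ - ⟪A u, A s⟫`. Each
product has error `ε`, and the second has population value `0`. The upper and lower bounds on the
residual of `y j` give `(1 - ε) ‖s‖² ≤ 2 ε ‖t‖²`, hence `‖s‖ ≤ ‖t‖` as `ε ≤ 1 / 3`. -/
theorem abs_partialCov_comp_sub_le (hA : IsNearIsometry A (Submodule.span ℝ (y '' U)) M ε)
    (hM : 0 < M) (hε0 : 0 ≤ ε) (hε : ε ≤ 1 / 3) (hSU : S ⊆ U) (hi : i ∈ U) (hj : j ∈ U) :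
    |partialCov (fun j => A (y j)) S i j - M * partialCov y S i j| ≤
      2 * ε * M * (√(partialCov y S i i) * √(partialCov y S j j)) := by
  obtain ⟨s, hs, hts, h⟩ := le_norm_sq_resid_comp hA hSU hj
  have hup := partialCov_comp_le hA hSU hj
  simp only [partialCov, real_inner_self_eq_norm_sq] at hup
  set u := resid y S (y i) with hu
  set t := resid y S (y j) with ht
  have hsU := Submodule.span_mono (Set.image_mono hSU) hs
  have huU := resid_mem_span y hSU hi
  have htU := resid_mem_span y hSU hj
  have hst : ‖s‖ ≤ ‖t‖ := by
    have h1 : (1 - ε) * M * (‖t‖ ^ 2 + ‖s‖ ^ 2) ≤ (1 + ε) * M * ‖t‖ ^ 2 := h.trans hup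
    have h2 : (1 - ε) * (‖t‖ ^ 2 + ‖s‖ ^ 2) ≤ (1 + ε) * ‖t‖ ^ 2 := by
      refine le_of_mul_le_mul_left ?_ hM
      linarith
    have h3 : ‖s‖ ^ 2 ≤ ‖t‖ ^ 2 := by nlinarith [sq_nonneg ‖s‖, sq_nonneg ‖t‖]
    exact (le_abs_self _).trans (abs_le_of_sq_le_sq h3 (norm_nonneg _))
  have e1 : partialCov (fun j => A (y j)) S i j = ⟪A u, A t⟫ - ⟪A u, A s⟫ := by
    rw [partialCov, real_inner_comm, hts, resid_comp A y S i, ← hu, ← inner_sub_right, ← hts,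
      inner_resid_resid, hts, real_inner_comm]
  have b1 := hA.abs_inner_sub_le huU htU
  have b2 := hA.abs_inner_sub_le huU hsU
  rw [inner_resid_of_mem y S _ hs, mul_zero, sub_zero] at b2
  have e2 : √(partialCov y S i i) = ‖u‖ := by
    rw [partialCov, real_inner_self_eq_norm_sq, Real.sqrt_sq (norm_nonneg _)]
  have e3 : √(partialCov y S j j) = ‖t‖ := by
    rw [partialCov, real_inner_self_eq_norm_sq, Real.sqrt_sq (norm_nonneg _)]
  have e4 : partialCov y S i j = ⟪u, t⟫ := rfl
  rw [e1, e2, e3, e4]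
  have b3 : ε * M * (‖u‖ * ‖s‖) ≤ ε * M * (‖u‖ * ‖t‖) := by gcongr
  rw [abs_le] at b1 b2 ⊢
  constructor <;> linarith [b1.1, b1.2, b2.1, b2.2]

/-- The decrease of the residual sum of squares of `y i` when `y j` joins the regressors. -/
noncomputable def drop (y : ι → E) (S : Finset ι) (i j : ι) : ℝ :=
  partialCov y S i j ^ 2 / partialCov y S j j

theorem drop_nonneg (y : ι → E) (S : Finset ι) (i j : ι) : 0 ≤ drop y S i j :=
  div_nonneg (sq_nonneg _) (partialCov_self_nonneg _ _ _)

theorem abs_partialCov_eq (y : ι → E) (S : Finset ι) (i j : ι) :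
    |partialCov y S i j| = √(drop y S i j) * √(partialCov y S j j) := by
  rw [← Real.sqrt_mul (drop_nonneg y S i j), drop]
  by_cases h0 : partialCov y S j j = 0
  · have : resid y S (y j) = 0 := by simpa [partialCov] using h0
    simp [partialCov, this]
  · rw [div_mul_cancel₀ _ h0, Real.sqrt_sq_eq_abs]

/-- The root of the drop is `|Cov| / √Var_j`, which is linear in the covariance, so its additive
error is linear in `ε`. Comparing the drops themselves near zero without this would hide that an
error `ε` costs only `ε²` there. -/
theorem sqrt_drop_comp_le (hA : IsNearIsometry A (Submodule.span ℝ (y '' U)) M ε)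
    (hM : 0 < M) (hε0 : 0 ≤ ε) (hε : ε ≤ 1 / 3) (hSU : S ⊆ U) (hi : i ∈ U) (hj : j ∈ U) :
    √(drop (fun j => A (y j)) S i j) ≤
      √M * ((1 + ε) * (√(drop y S i j) + 2 * ε * √(partialCov y S i i))) := by
  have h1 := abs_partialCov_comp_sub_le hA hM hε0 hε hSU hi hj
  have h2 := le_partialCov_comp hA hM (by linarith) hSU hj
  have h3 := abs_partialCov_eq y S i j
  have h4 := abs_partialCov_eq (fun j => A (y j)) S i j
  set g := √(drop y S i j)
  set g' := √(drop (fun j => A (y j)) S i j) with hg'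
  set v := √(partialCov y S i i)
  set w := √(partialCov y S j j) with hw
  set w' := √(partialCov (fun j => A (y j)) S j j) with hw'
  have hg0 : 0 ≤ g := Real.sqrt_nonneg _
  have hv0 : 0 ≤ v := Real.sqrt_nonneg _
  have hw0 : 0 ≤ w := Real.sqrt_nonneg _
  have hw'0 : 0 ≤ w' := Real.sqrt_nonneg _
  have hM0 : 0 ≤ √M := Real.sqrt_nonneg _
  have hMM : √M * √M = M := Real.mul_self_sqrt hM.le
  by_cases hz : w' = 0
  · have : partialCov (fun j => A (y j)) S j j = 0 := by
      rw [← Real.mul_self_sqrt (partialCov_self_nonneg _ S j), ← hw', hz, mul_zero]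
    have : g' = 0 := by simp [hg', drop, this]
    rw [this]; positivity
  · have hw'p : 0 < w' := lt_of_le_of_ne hw'0 (Ne.symm hz)
    have h5 : √M * w ≤ (1 + ε) * w' := by
      refine (le_abs_self _).trans (abs_le_of_sq_le_sq ?_ (by positivity))
      rw [mul_pow, mul_pow, hw, hw', Real.sq_sqrt hM.le,
        Real.sq_sqrt (partialCov_self_nonneg _ _ _), Real.sq_sqrt (partialCov_self_nonneg _ _ _)]
      -- This allows the factor `1 / √(1 - ε)` to be replaced by `1 + ε`.
      have h6 : 1 ≤ (1 + ε) ^ 2 * (1 - ε) := by nlinarith [mul_nonneg hε0 hε0]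
      have h7 := mul_le_mul_of_nonneg_left h2 (sq_nonneg (1 + ε))
      have h8 : 0 ≤ M * partialCov y S j j := mul_nonneg hM.le (partialCov_self_nonneg _ _ _)
      nlinarith [mul_le_mul_of_nonneg_right h6 h8]
    have h9 : g' * w' ≤ M * (g * w) + 2 * ε * M * (v * w) := by
      rw [← h3, ← h4]
      have h10 := abs_sub_abs_le_abs_sub (partialCov (fun j => A (y j)) S i j)
        (M * partialCov y S i j)
      rw [abs_mul, abs_of_pos hM] at h10
      linarith
    refine le_of_mul_le_mul_right ?_ hw'p
    calc g' * w' ≤ M * (g * w) + 2 * ε * M * (v * w) := h9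
      _ = √M * (g + 2 * ε * v) * (√M * w) := by
        linear_combination (-(g * w + 2 * ε * v * w)) * hMM
      _ ≤ √M * (g + 2 * ε * v) * ((1 + ε) * w') := by gcongr
      _ = _ := by ring

theorem le_sqrt_drop_comp (hA : IsNearIsometry A (Submodule.span ℝ (y '' U)) M ε)
    (hM : 0 < M) (hε0 : 0 ≤ ε) (hε : ε ≤ 1 / 3) (hSU : S ⊆ U) (hi : i ∈ U) (hj : j ∈ U) :
    √M * ((1 - ε) * (√(drop y S i j) - 2 * ε * √(partialCov y S i i))) ≤
      √(drop (fun j => A (y j)) S i j) := by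
  have h1 := abs_partialCov_comp_sub_le hA hM hε0 hε hSU hi hj
  have h2 := partialCov_comp_le hA hSU hj
  have h3 := abs_partialCov_eq y S i j
  have h4 := abs_partialCov_eq (fun j => A (y j)) S i j
  set g := √(drop y S i j) with hg
  set g' := √(drop (fun j => A (y j)) S i j) with hg'
  set v := √(partialCov y S i i)
  set w := √(partialCov y S j j) with hw
  set w' := √(partialCov (fun j => A (y j)) S j j) with hw'
  have hg0 : 0 ≤ g := Real.sqrt_nonneg _
  have hg'0 : 0 ≤ g' := Real.sqrt_nonneg _
  have hv0 : 0 ≤ v := Real.sqrt_nonneg _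
  have hw0 : 0 ≤ w := Real.sqrt_nonneg _
  have hw'0 : 0 ≤ w' := Real.sqrt_nonneg _
  have hM0 : 0 ≤ √M := Real.sqrt_nonneg _
  have hMM : √M * √M = M := Real.mul_self_sqrt hM.le
  rcases le_or_gt (g - 2 * ε * v) 0 with hneg | hpos
  · refine le_trans (mul_nonpos_of_nonneg_of_nonpos hM0 ?_) hg'0
    exact mul_nonpos_of_nonneg_of_nonpos (by linarith) hneg
  by_cases hz : w = 0
  · have : partialCov y S j j = 0 := by
      rw [← Real.mul_self_sqrt (partialCov_self_nonneg _ S j), ← hw, hz, mul_zero]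
    have : g = 0 := by simp [hg, drop, this]
    have : 0 ≤ ε * v := mul_nonneg hε0 hv0
    linarith
  · have hwp : 0 < w := lt_of_le_of_ne hw0 (Ne.symm hz)
    have h5 : (1 - ε) * w' ≤ √M * w := by
      refine (le_abs_self _).trans (abs_le_of_sq_le_sq ?_ (by positivity))
      rw [mul_pow, mul_pow, hw, hw', Real.sq_sqrt hM.le,
        Real.sq_sqrt (partialCov_self_nonneg _ _ _), Real.sq_sqrt (partialCov_self_nonneg _ _ _)]
      -- Here `1 / √(1 + ε)` is replaced by the smaller `1 - ε`.
      have h6 : (1 - ε) ^ 2 * (1 + ε) ≤ 1 := by nlinarith [mul_nonneg hε0 hε0]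
      have h7 := mul_le_mul_of_nonneg_left h2 (sq_nonneg (1 - ε))
      have h8 : 0 ≤ M * partialCov y S j j := mul_nonneg hM.le (partialCov_self_nonneg _ _ _)
      nlinarith [mul_le_mul_of_nonneg_right h6 h8]
    have h9 : M * (g * w) - 2 * ε * M * (v * w) ≤ g' * w' := by
      rw [← h3, ← h4]
      have h10 := abs_sub_abs_le_abs_sub (M * partialCov y S i j)
        (partialCov (fun j => A (y j)) S i j)
      rw [abs_mul, abs_of_pos hM, abs_sub_comm] at h10
      linarith
    have hMw : 0 < √M * w := mul_pos (Real.sqrt_pos.2 hM) hwp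
    refine le_of_mul_le_mul_right ?_ hMw
    calc √M * ((1 - ε) * (g - 2 * ε * v)) * (√M * w)
        = (1 - ε) * (M * (g * w) - 2 * ε * M * (v * w)) := by
          linear_combination ((1 - ε) * (g * w - 2 * ε * v * w)) * hMM
      _ ≤ (1 - ε) * (g' * w') := mul_le_mul_of_nonneg_left h9 (by linarith)
      _ = g' * ((1 - ε) * w') := by ring
      _ ≤ g' * (√M * w) := by gcongr

end Transfer

end GGM

/-! ### The greedy phase on a good sample. -/

namespace GGM

open scoped RealInnerProductSpace

/-- An attractive nondegenerate model with covariance vectors `y`, and a linear map `A`, standing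
for the normalized sample, that nearly preserves norms on the span of any `k` of the `y j`. -/
structure IsGoodSample {n : ℕ} {E F : Type*} [NormedAddCommGroup E] [InnerProductSpace ℝ E]
    [NormedAddCommGroup F] [InnerProductSpace ℝ F] (Θ : Matrix (Fin n) (Fin n) ℝ) (κ : ℝ)
    (y z : Fin n → E) (A : E →ₗ[ℝ] F) (M : ℝ) (k : ℕ) : Prop where
  pair : IsPrecisionPair Θ y z
  attractive : IsAttractive Θ
  nondeg : IsNondegenerate κ Θ
  κ_pos : 0 < κ
  κ_le_one : κ ≤ 1
  M_pos : 0 < M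
  near : ∀ U : Finset (Fin n), U.card ≤ k →
    IsNearIsometry A (Submodule.span ℝ (y '' U)) M (κ / 100)

namespace IsGoodSample

variable {n : ℕ} {E F : Type*} [NormedAddCommGroup E] [InnerProductSpace ℝ E]
  [FiniteDimensional ℝ E] [NormedAddCommGroup F] [InnerProductSpace ℝ F] [FiniteDimensional ℝ F]
  {Θ : Matrix (Fin n) (Fin n) ℝ} {κ : ℝ} {y z : Fin n → E} {A : E →ₗ[ℝ] F} {M : ℝ} {k : ℕ}
  {S : Finset (Fin n)} {i j : Fin n}

theorem sqrt_drop_le (h : IsGoodSample Θ κ y z A M k) (hS : (insert i (insert j S)).card ≤ k) :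
    √(drop (fun j => A (y j)) S i j) ≤
      √M * ((1 + κ / 100) * (√(drop y S i j) + 2 * (κ / 100) * √(partialCov y S i i))) := by
  have := h.κ_pos
  have := h.κ_le_one
  refine sqrt_drop_comp_le (h.near _ hS) h.M_pos (by linarith) (by linarith) ?_ (by simp) (by simp)
  exact fun s hs => by simp [hs]

theorem le_sqrt_drop (h : IsGoodSample Θ κ y z A M k) (hS : (insert i (insert j S)).card ≤ k) :
    √M * ((1 - κ / 100) * (√(drop y S i j) - 2 * (κ / 100) * √(partialCov y S i i))) ≤
      √(drop (fun j => A (y j)) S i j) := by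
  have := h.κ_pos
  have := h.κ_le_one
  refine le_sqrt_drop_comp (h.near _ hS) h.M_pos (by linarith) (by linarith) ?_ (by simp) (by simp)
  exact fun s hs => by simp [hs]

theorem partialCov_le (h : IsGoodSample Θ κ y z A M k) (hS : (insert i S).card ≤ k) :
    partialCov (fun j => A (y j)) S i i ≤ (1 + κ / 100) * M * partialCov y S i i :=
  partialCov_comp_le (h.near _ hS) (fun s hs => by simp [hs]) (by simp)

theorem le_partialCov (h : IsGoodSample Θ κ y z A M k) (hS : (insert i S).card ≤ k) :
    (1 - κ / 100) * M * partialCov y S i i ≤ partialCov (fun j => A (y j)) S i i := by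
  have := h.κ_pos
  have := h.κ_le_one
  exact le_partialCov_comp (h.near _ hS) h.M_pos (by linarith) (fun s hs => by simp [hs]) (by simp)

/-- One greedy step reduces the excess of the conditional variance by a constant fraction of what
an optimal step would do. -/
theorem greedy_step (h : IsGoodSample Θ κ y z A M k) (hS : S.card + 2 ≤ k) (hi : i ∉ S)
    (hNS : ¬ neighbors Θ i ⊆ S)
    (hmin : ∀ l, l ≠ i → partialCov (fun j => A (y j)) (insert j S) i i ≤
      partialCov (fun j => A (y j)) (insert l S) i i) :
    Θ i i * partialCov y (insert j S) i i - 1 ≤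
      (1 - 1 / (2 * (neighbors Θ i).card)) * (Θ i i * partialCov y S i i - 1) := by
  have hκ := h.κ_pos
  have hκ1 := h.κ_le_one
  have hcard : ∀ l, (insert i (insert l S)).card ≤ k := fun l => by
    have h1 := Finset.card_insert_le i (insert l S)
    have h2 := Finset.card_insert_le l S
    omega
  obtain ⟨l, hl, hld⟩ := h.pair.exists_drop h.attractive hi hNS
  obtain ⟨hlN, hlS⟩ := Finset.mem_sdiff.1 hl
  have hlκ := h.pair.sq_le_drop h.attractive hκ h.nondeg hi hlS hlN
  change κ ^ 2 ≤ Θ i i * drop y S i l at hlκ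
  change _ ≤ _ * (Θ i i * drop y S i l) at hld
  have hθ := h.pair.diag_pos i
  have hdκ := h.pair.card_neighbors_mul_sq_le h.attractive hκ h.nondeg i
  have hd : (1 : ℝ) ≤ (neighbors Θ i).card := by
    exact_mod_cast Finset.card_pos.2 ⟨l, hlN⟩
  have hdrop := hmin l (IsPrecisionPair.mem_neighbors.1 hlN).1
  rw [partialCov_insert, partialCov_insert] at hdrop
  rw [partialCov_insert]
  change _ - drop _ S i j ≤ _ - drop _ S i l at hdrop
  change Θ i i * (_ - drop y S i j) - 1 ≤ _
  set d : ℝ := ((neighbors Θ i).card : ℝ) with hddef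
  set V := partialCov y S i i with hV
  have hV0 : 0 ≤ V := partialCov_self_nonneg _ _ _
  set D := drop y S i l with hD
  have hD0 : 0 ≤ D := drop_nonneg _ _ _ _
  set D' := drop y S i j with hD'
  have hD'0 : 0 ≤ D' := drop_nonneg _ _ _ _
  -- The transfer error is of order `κ √V`, so it must be compared with `√D`. If `Θ i i * V ≤ 2`,
  -- use `κ² ≤ Θ i i * D`. Otherwise the excess is at least half of `Θ i i * V` and at most `d * (Θ
  -- i i * D)`, and `d * κ² ≤ 1`.
  have hVD : κ ^ 2 * V ≤ 2 * D := by
    have : κ ^ 2 * (Θ i i * V) ≤ 2 * (Θ i i * D) := by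
      rcases le_total (Θ i i * V) 2 with h1 | h1
      · nlinarith [sq_nonneg κ]
      · have h2 : κ ^ 2 * (Θ i i * V) ≤ κ ^ 2 * (2 * (d * (Θ i i * D))) :=
          mul_le_mul_of_nonneg_left (by linarith) (sq_nonneg κ)
        have h3 : 0 ≤ Θ i i * D := mul_nonneg hθ.le hD0
        nlinarith [mul_le_mul_of_nonneg_right hdκ h3]
    refine le_of_mul_le_mul_left ?_ hθ
    linarith
  have hsV : κ * √V ≤ 3 / 2 * √D := by
    refine (le_abs_self _).trans (abs_le_of_sq_le_sq ?_ (by positivity))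
    rw [mul_pow, mul_pow, Real.sq_sqrt hV0, Real.sq_sqrt hD0]
    linarith
  have hup := h.sqrt_drop_le (hcard j)
  have hlow := h.le_sqrt_drop (hcard l)
  have hmid : √(drop (fun j => A (y j)) S i l) ≤ √(drop (fun j => A (y j)) S i j) :=
    Real.sqrt_le_sqrt (by linarith)
  have hcomp := le_of_mul_le_mul_left (hlow.trans (hmid.trans hup)) (Real.sqrt_pos.2 h.M_pos)
  rw [← hV, ← hD, ← hD'] at hcomp
  have hs : 0 ≤ √D := Real.sqrt_nonneg _
  have hs' : 0 ≤ √D' := Real.sqrt_nonneg _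
  -- By `hsV` the error `2 (κ / 100) √V` is at most `3 / 100 * √D`. The greedy choice thus attains
  -- nine tenths of the best root, hence at least half of the best drop; this is the `2` in the
  -- contraction factor.
  have h1 : 97 / 100 * √D ≤ √D - 2 * (κ / 100) * √V := by linarith
  have h2 : 99 / 100 * (97 / 100 * √D) ≤ (1 - κ / 100) * (√D - 2 * (κ / 100) * √V) :=
    mul_le_mul (by linarith) h1 (by positivity) (by linarith)
  have h3 : (1 + κ / 100) * (√D' + 2 * (κ / 100) * √V) ≤ 101 / 100 * (√D' + 3 / 100 * √D) :=
    mul_le_mul (by linarith) (by linarith) (by positivity) (by norm_num)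
  have h4 : 9 / 10 * √D ≤ √D' := by linarith
  have h5 : D / 2 ≤ D' := by
    have : (9 / 10 * √D) ^ 2 ≤ √D' ^ 2 := by gcongr
    rw [mul_pow, Real.sq_sqrt hD0, Real.sq_sqrt hD'0] at this
    linarith
  have h6 : Θ i i * (D / 2) ≤ Θ i i * D' := by gcongr
  have h7 : 1 / (2 * d) * (Θ i i * V - 1) ≤ Θ i i * (D / 2) := by
    rw [div_mul_eq_mul_div, div_le_iff₀ (by positivity)]
    linarith
  linarith

/-- Conditioning on a true neighbor would give `1 / κ²`; the greedy choice is at most a factor `(1 +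
κ / 100) / (1 - κ / 100) ≤ 2` worse. The initial variance has no such bound, so the first step is
treated separately. -/
theorem greedy_first_step (h : IsGoodSample Θ κ y z A M k) (hk : 2 ≤ k)
    (hNS : (neighbors Θ i).Nonempty)
    (hmin : ∀ l, l ≠ i → partialCov (fun j => A (y j)) {j} i i ≤
      partialCov (fun j => A (y j)) {l} i i) :
    Θ i i * partialCov y {j} i i ≤ 2 / κ ^ 2 := by
  obtain ⟨l, hl⟩ := hNS
  have hκ := h.κ_pos
  have hκ1 := h.κ_le_one
  have hcard : ∀ l : Fin n, (insert i {l} : Finset (Fin n)).card ≤ k := fun l =>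
    (Finset.card_insert_le _ _).trans (by simpa using hk)
  have h1 := (h.le_partialCov (hcard j)).trans
    ((hmin l (IsPrecisionPair.mem_neighbors.1 hl).1).trans (h.partialCov_le (hcard l)))
  have h2 := h.pair.sq_mul_diag_mul_le_one h.attractive hκ h.nondeg hl
  have hθ := h.pair.diag_pos i
  set V := partialCov y {j} i i
  set W := partialCov y {l} i i
  have hV : 0 ≤ V := partialCov_self_nonneg _ _ _
  have hW : 0 ≤ W := partialCov_self_nonneg _ _ _
  have h3 : (1 - κ / 100) * V ≤ (1 + κ / 100) * W := by
    refine le_of_mul_le_mul_left ?_ h.M_pos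
    linarith
  have h4 : V ≤ 2 * W := by nlinarith
  rw [le_div_iff₀ (by positivity)]
  have : κ ^ 2 * (Θ i i * V) ≤ κ ^ 2 * (Θ i i * (2 * W)) := by gcongr
  linarith

variable {m : ℕ} {X : Matrix (Fin m) (Fin n) ℝ}
  {B : E →ₗ[ℝ] EuclideanSpace ℝ (Fin m)}

theorem _root_.GGM.OMPRun.card_le {t : ℕ} (hrun : OMPRun X i t S) : S.card ≤ t := by
  induction hrun with
  | start => simp
  | step j _ _ _ ih => exact (Finset.card_insert_le _ _).trans (by omega)
  | idle _ _ ih => omega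

theorem _root_.GGM.OMPRun.notMem {t : ℕ} (hrun : OMPRun X i t S) : i ∉ S := by
  induction hrun with
  | start => simp
  | step j _ hj _ ih => simp [ih, hj.symm]
  | idle _ _ ih => exact ih

/-- The first step makes the excess at most `2 / κ²` and every later one contracts it. The
alternative is needed because `greedy_step` presupposes a missing neighbor. The bound on `t` leaves
room for `i` next to the `t + 1` chosen indices. -/
theorem excess_le_of_ompRun (h : IsGoodSample Θ κ y z B M k)
    (hX : dataCol X = fun j => B (y j)) {t : ℕ} (hrun : OMPRun X i (t + 1) S) (ht : t + 2 ≤ k) :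
    neighbors Θ i ⊆ S ∨ Θ i i * partialCov y S i i - 1 ≤
      (1 - 1 / (2 * (neighbors Θ i).card)) ^ t * (2 / κ ^ 2) := by
  induction t generalizing S with
  | zero =>
    rw [or_iff_not_imp_left]
    intro hNS
    have hne : (neighbors Θ i).Nonempty := by
      rw [Finset.nonempty_iff_ne_empty]
      rintro h0
      exact hNS (by simp [h0])
    cases hrun with
    | @step _ S j hS hj hmin =>
      cases hS
      simp only [rss_eq_partialCov, hX, insert_empty_eq] at hmin
      have := h.greedy_first_step (by omega) hne hmin
      simp only [insert_empty_eq, pow_zero, one_mul]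
      linarith
    | idle hS hall =>
      obtain ⟨l, hl⟩ := hne
      exact absurd (hall l) (IsPrecisionPair.mem_neighbors.1 hl).1
  | succ t ih =>
    cases hrun with
    | @step _ S j hS hj hmin =>
      rcases ih hS (by omega) with h1 | h1
      · exact Or.inl (h1.trans (Finset.subset_insert _ _))
      · by_cases hNS : neighbors Θ i ⊆ S
        · exact Or.inl (hNS.trans (Finset.subset_insert _ _))
        right
        simp only [rss_eq_partialCov, hX] at hmin
        have := h.greedy_step (by have := hS.card_le; omega) hS.notMem hNS hmin
        refine this.trans ?_
        rw [pow_succ', mul_assoc]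
        refine mul_le_mul_of_nonneg_left h1 ?_
        have hd : (1 : ℝ) ≤ (neighbors Θ i).card := by
          obtain ⟨l, hl, -⟩ := Finset.not_subset.1 hNS
          exact_mod_cast Finset.card_pos.2 ⟨l, hl⟩
        rw [sub_nonneg, div_le_one (by positivity)]
        linarith
    | idle hS hall =>
      left
      intro l hl
      exact absurd (hall l) (IsPrecisionPair.mem_neighbors.1 hl).1

theorem neighbors_subset_of_ompRun (h : IsGoodSample Θ κ y z B M k)
    (hX : dataCol X = fun j => B (y j)) {d T : ℕ} (hd : (neighbors Θ i).card ≤ d)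
    (hT : 64 * d * Real.log (4 / κ ^ 2) + 1 ≤ T) (hTk : T + 1 ≤ k) (hrun : OMPRun X i T S) :
    neighbors Θ i ⊆ S := by
  by_contra hNS
  have hκ := h.κ_pos
  have hκ1 := h.κ_le_one
  have hκ2 : κ ^ 2 ≤ 1 := pow_le_one₀ hκ.le hκ1
  have hlog : 0 ≤ Real.log (4 / κ ^ 2) := by
    refine Real.log_nonneg ?_
    rw [le_div_iff₀ (by positivity)]
    linarith
  obtain ⟨t, rfl⟩ : ∃ t, T = t + 1 := by
    refine Nat.exists_eq_succ_of_ne_zero ?_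
    rintro rfl
    have : 0 ≤ 64 * d * Real.log (4 / κ ^ 2) := by positivity
    norm_num at hT
    linarith
  have h1 := (h.excess_le_of_ompRun hX hrun (by omega)).resolve_left hNS
  have h2 := h.pair.one_add_sq_le_diag_mul h.attractive hκ h.nondeg hrun.notMem hNS
  have hd1 : (1 : ℝ) ≤ (neighbors Θ i).card := by
    obtain ⟨l, hl, -⟩ := Finset.not_subset.1 hNS
    exact_mod_cast Finset.card_pos.2 ⟨l, hl⟩
  have hdd : ((neighbors Θ i).card : ℝ) ≤ d := by exact_mod_cast hd
  set e : ℝ := ((neighbors Θ i).card : ℝ)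
  -- Already `t ≥ 4 e log (4 / κ²)` would do, so the constant `64` is generous. The excess becomes
  -- at most `κ² / 8`, contradicting the bound `κ²` for an incomplete set.
  have h3 : (1 - 1 / (2 * e)) ^ t ≤ (κ ^ 2 / 4) ^ 2 := by
    have h4 : 1 - 1 / (2 * e) ≤ Real.exp (-(1 / (2 * e))) := by
      have := Real.add_one_le_exp (-(1 / (2 * e)))
      linarith
    have h5 : 0 ≤ 1 - 1 / (2 * e) := by
      rw [sub_nonneg, div_le_one (by positivity)]; linarith
    calc (1 - 1 / (2 * e)) ^ t ≤ Real.exp (-(1 / (2 * e))) ^ t := by gcongr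
      _ = Real.exp (-(t / (2 * e))) := by rw [← Real.exp_nat_mul]; ring_nf
      _ ≤ Real.exp (-(2 * Real.log (4 / κ ^ 2))) := by
        gcongr
        rw [le_div_iff₀ (by positivity)]
        push_cast at hT
        have : e * Real.log (4 / κ ^ 2) ≤ d * Real.log (4 / κ ^ 2) := by gcongr
        nlinarith [mul_nonneg (by linarith : 0 ≤ e) hlog]
      _ = (κ ^ 2 / 4) ^ 2 := by
        rw [← Real.log_rpow (by positivity), ← Real.log_inv, Real.exp_log (by positivity)]
        norm_num
        field_simp
  have h6 : κ ^ 2 ≤ (κ ^ 2 / 4) ^ 2 * (2 / κ ^ 2) := by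
    have : (1 - 1 / (2 * e)) ^ t * (2 / κ ^ 2) ≤ (κ ^ 2 / 4) ^ 2 * (2 / κ ^ 2) := by gcongr
    linarith
  have h7 : (κ ^ 2 / 4) ^ 2 * (2 / κ ^ 2) = κ ^ 2 / 8 := by field_simp; norm_num
  have : 0 < κ ^ 2 := by positivity
  linarith

end IsGoodSample

end GGM

/-! ### The pruning phase on a good sample. -/

namespace GGM

open scoped RealInnerProductSpace

namespace IsGoodSample

variable {n m : ℕ} {E : Type*} [NormedAddCommGroup E] [InnerProductSpace ℝ E]
  [FiniteDimensional ℝ E] {Θ : Matrix (Fin n) (Fin n) ℝ} {κ : ℝ} {y z : Fin n → E} {k T : ℕ}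
  {S S₀ : Finset (Fin n)} {i j : Fin n} {X : Matrix (Fin m) (Fin n) ℝ}
  {B : E →ₗ[ℝ] EuclideanSpace ℝ (Fin m)}

theorem diag_mul_rss_bounds (h : IsGoodSample Θ κ y z B m k) (hX : dataCol X = fun j => B (y j))
    (hi : i ∉ S) (hN : neighbors Θ i ⊆ S) (hS : S.card + 1 ≤ k) :
    99 / 100 * (m : ℝ) ≤ Θ i i * rss X i S ∧ Θ i i * rss X i S ≤ 101 / 100 * m := by
  have hκ := h.κ_pos
  have hκ1 := h.κ_le_one
  have hcard : (insert i S).card ≤ k := (Finset.card_insert_le _ _).trans hS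
  have h1 := h.partialCov_le hcard
  have h2 := h.le_partialCov hcard
  have h3 := h.pair.diag_mul_eq_one hi hN
  have hθ := h.pair.diag_pos i
  have hm := h.M_pos
  rw [rss_eq_partialCov, hX]
  have h4 := mul_le_mul_of_nonneg_left h1 hθ.le
  have h5 := mul_le_mul_of_nonneg_left h2 hθ.le
  have h6 : Θ i i * ((1 + κ / 100) * m * partialCov y S i i) = (1 + κ / 100) * m := by
    linear_combination (1 + κ / 100) * m * h3
  have h7 : Θ i i * ((1 - κ / 100) * m * partialCov y S i i) = (1 - κ / 100) * m := by
    linear_combination (1 - κ / 100) * m * h3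
  constructor <;> nlinarith

/-- Erasing `j` raises the residual sum of squares but also frees one degree of freedom, which
enlarges the denominator. The second term is this correction. -/
theorem condVarEst_erase_sub (hs : (S.card : ℝ) < m) (hj : j ∈ S) :
    condVarEst X i (S.erase j) - condVarEst X i S =
      drop (dataCol X) (S.erase j) i j / ((m : ℝ) - S.card + 1) -
        rss X i S / (((m : ℝ) - S.card) * ((m : ℝ) - S.card + 1)) := by
  have h1 : rss X i S = rss X i (S.erase j) - drop (dataCol X) (S.erase j) i j := by
    conv_lhs => rw [← Finset.insert_erase hj]
    rw [rss_eq_partialCov, rss_eq_partialCov, partialCov_insert, drop]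
  have h2 : ((S.erase j).card : ℝ) = S.card - 1 := by
    rw [Finset.card_erase_of_mem hj, Nat.cast_sub (Finset.card_pos.2 ⟨j, hj⟩), Nat.cast_one]
  have h3 : (0 : ℝ) < m - S.card := by linarith
  have h4 : (0 : ℝ) < m - S.card + 1 := by linarith
  have h5 : (m : ℝ) - (S.card - 1) = m - S.card + 1 := by ring
  rw [condVarEst, condVarEst, h2, h5, h1]
  field_simp
  ring

set_option maxHeartbeats 1000000 in
-- In units of `κ² / Θ i i`: the threshold lies between `0.17` and `0.2`, since `1 / √32` is about
-- `0.177`; removing a neighbor raises the estimate by at least `0.92 - 0.02`, removing another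
-- index by at most `0.01`. The bound on `T` keeps all denominators within one percent of `m`. The
-- set `S₀` that fixes the threshold may differ from the current `S`.
theorem lt_threshold_iff (h : IsGoodSample Θ κ y z B m k) (hX : dataCol X = fun j => B (y j))
    (hTm : (T : ℝ) ≤ κ ^ 2 * m / 100) (hTk : T + 1 ≤ k)
    (hi : i ∉ S) (hN : neighbors Θ i ⊆ S) (hS : S.card ≤ T)
    (hi₀ : i ∉ S₀) (hN₀ : neighbors Θ i ⊆ S₀) (hS₀ : S₀.card ≤ T) (hj : j ∈ S) :
    condVarEst X i (S.erase j) - condVarEst X i S < κ ^ 2 / √32 * condVarEst X i S₀ ↔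
      j ∉ neighbors Θ i := by
  have hκ := h.κ_pos
  have hκ1 := h.κ_le_one
  have hκ2 : 0 < κ ^ 2 := by positivity
  have hκ3 : κ ^ 2 ≤ 1 := pow_le_one₀ hκ.le hκ1
  have hm := h.M_pos
  have hθ := h.pair.diag_pos i
  obtain ⟨ha, hb⟩ := h.diag_mul_rss_bounds hX hi hN (by omega)
  obtain ⟨ha₀, hb₀⟩ := h.diag_mul_rss_bounds hX hi₀ hN₀ (by omega)
  have hs1 : (1 : ℝ) ≤ S.card := by exact_mod_cast Finset.card_pos.2 ⟨j, hj⟩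
  have hsT : (S.card : ℝ) ≤ T := by exact_mod_cast hS
  have hs₀T : (S₀.card : ℝ) ≤ T := by exact_mod_cast hS₀
  have hs₀ : (0 : ℝ) ≤ S₀.card := by positivity
  have hTm' : (T : ℝ) ≤ m / 100 := by nlinarith
  rw [condVarEst_erase_sub (by linarith) hj]
  set D := drop (dataCol X) (S.erase j) i j with hD
  have hD0 : 0 ≤ D := drop_nonneg _ _ _ _
  have hthr : κ ^ 2 / √32 * condVarEst X i S₀ =
      κ ^ 2 * ((Θ i i * rss X i S₀) / ((m - S₀.card) * √32)) / Θ i i := by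
    rw [condVarEst]; field_simp
  have hlhs : D / ((m : ℝ) - S.card + 1) -
        rss X i S / (((m : ℝ) - S.card) * ((m : ℝ) - S.card + 1)) =
      ((Θ i i * D) / ((m : ℝ) - S.card + 1) -
        (Θ i i * rss X i S) / (((m : ℝ) - S.card) * ((m : ℝ) - S.card + 1))) / Θ i i := by
    field_simp
  rw [hthr, hlhs, div_lt_div_iff_of_pos_right hθ]
  set R := Θ i i * rss X i S
  set R₀ := Θ i i * rss X i S₀
  set p : ℝ := m - S.card with hp
  have hsq1 : √32 ≤ 57 / 10 := by
    rw [Real.sqrt_le_left (by norm_num)]; norm_num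
  have hsq2 : 56 / 10 ≤ √32 := by
    apply Real.le_sqrt_of_sq_le; norm_num
  have hsq3 : 0 < √32 := by linarith
  have hi' : i ∉ S.erase j := fun h' => hi (Finset.mem_of_mem_erase h')
  have hcard : (insert i (insert j (S.erase j))).card ≤ k := by
    rw [Finset.insert_erase hj]
    exact (Finset.card_insert_le _ _).trans (by omega)
  have hsplit := partialCov_insert y (S.erase j) j i
  rw [Finset.insert_erase hj] at hsplit
  change _ = _ - drop y (S.erase j) i j at hsplit
  have hone := h.pair.diag_mul_eq_one hi hN
  set D' := drop y (S.erase j) i j with hD'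
  have hD'0 : 0 ≤ D' := drop_nonneg _ _ _ _
  set V := partialCov y (S.erase j) i i with hV
  have hV0 : 0 ≤ V := partialCov_self_nonneg _ _ _
  rw [hsplit] at hone
  constructor
  · intro hlt hjN
    refine absurd hlt (not_lt.2 ?_)
    have hκD := h.pair.sq_le_drop h.attractive hκ h.nondeg hi' (by simp) hjN
    change κ ^ 2 ≤ Θ i i * D' at hκD
    have hlow := h.le_sqrt_drop hcard
    rw [← hX, ← hD, ← hD', ← hV] at hlow
    -- By `hone`, `Θ i i * V = 1 + Θ i i * D'`; multiply by `κ²`, with `κ² ≤ Θ i i * D'` and `κ² ≤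
    -- 1`, to get `κ² V ≤ 2 D'`.
    have hVD : κ * √V ≤ 3 / 2 * √D' := by
      refine (le_abs_self _).trans (abs_le_of_sq_le_sq ?_ (by positivity))
      rw [mul_pow, mul_pow, Real.sq_sqrt hV0, Real.sq_sqrt hD'0]
      refine le_of_mul_le_mul_left ?_ hθ
      nlinarith
    have h2 : 96 / 100 * √D' ≤ (1 - κ / 100) * (√D' - 2 * (κ / 100) * √V) := by
      have h1 : 97 / 100 * √D' ≤ √D' - 2 * (κ / 100) * √V := by linarith
      have := mul_le_mul (by linarith : 99 / 100 ≤ 1 - κ / 100) h1 (by positivity) (by linarith)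
      linarith [Real.sqrt_nonneg D']
    have h3 : 92 / 100 * m * D' ≤ D := by
      have h4 : √(m : ℝ) * (96 / 100 * √D') ≤ √D :=
        (mul_le_mul_of_nonneg_left h2 (Real.sqrt_nonneg _)).trans hlow
      have h5 : (√(m : ℝ) * (96 / 100 * √D')) ^ 2 ≤ √D ^ 2 := by gcongr
      rw [mul_pow, mul_pow, Real.sq_sqrt hm.le, Real.sq_sqrt hD'0, Real.sq_sqrt hD0] at h5
      nlinarith [mul_nonneg hm.le hD'0]
    have h6 : 92 / 100 * κ ^ 2 ≤ Θ i i * D / (p + 1) := by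
      rw [le_div_iff₀ (by linarith)]
      have h7 : κ ^ 2 * m ≤ Θ i i * D' * m := by gcongr
      have h8 : κ ^ 2 * (p + 1) ≤ κ ^ 2 * m := by gcongr; linarith
      have h9 := mul_le_mul_of_nonneg_left h3 hθ.le
      linarith
    -- The correction is about `1 / m`. As `S` contains `j`, `1 ≤ T ≤ κ² m / 100`, so `1 / m ≤ κ² /
    -- 100`.
    have h7 : R / (p * (p + 1)) ≤ 2 / 100 * κ ^ 2 := by
      have hp1 : 99 / 100 * (m : ℝ) ≤ p := by linarith
      rw [div_le_iff₀ (by nlinarith)]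
      have h8 : 99 / 100 * (m : ℝ) * (99 / 100 * m) ≤ p * (p + 1) :=
        mul_le_mul hp1 (by linarith) (by positivity) (by linarith)
      have h9 : 1 ≤ κ ^ 2 * m / 100 := by linarith
      have h10 : 2 / 100 * κ ^ 2 * (99 / 100 * (m : ℝ) * (99 / 100 * m)) ≤
        2 / 100 * κ ^ 2 * (p * (p + 1)) := by gcongr
      nlinarith
    have h8 : κ ^ 2 * (R₀ / ((m - S₀.card) * √32)) ≤ κ ^ 2 * (2 / 10) := by
      refine mul_le_mul_of_nonneg_left ?_ hκ2.le
      have h9 : 99 / 100 * (m : ℝ) * (56 / 10) ≤ (m - S₀.card) * √32 :=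
        mul_le_mul (by linarith) hsq2 (by norm_num) (by linarith)
      rw [div_le_iff₀ (by nlinarith)]
      linarith
    linarith
  · intro hjN
    have hN' : neighbors Θ i ⊆ S.erase j := fun l hl =>
      Finset.mem_erase.2 ⟨fun e => hjN (e ▸ hl), hN hl⟩
    have hone' := h.pair.diag_mul_eq_one hi' hN'
    rw [← hV] at hone'
    -- Without `j` the set still contains all neighbors, so both population variances equal `1 / Θ i
    -- i`. The sample drop is then pure error, of order `(2 κ / 100)²`.
    have hD'z : D' = 0 := by
      have : Θ i i * D' = 0 := by linarith
      exact (mul_eq_zero.1 this).resolve_left hθ.ne'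
    have hup := h.sqrt_drop_le hcard
    rw [← hX, ← hD, ← hD', ← hV, hD'z, Real.sqrt_zero, zero_add] at hup
    have h1 : Θ i i * D ≤ 5 / 10000 * κ ^ 2 * m := by
      have h2 : √D ≤ √(m : ℝ) * (101 / 100 * (2 * (κ / 100) * √V)) := by
        refine hup.trans ?_
        gcongr
        linarith
      have h3 : √D ^ 2 ≤ (√(m : ℝ) * (101 / 100 * (2 * (κ / 100) * √V))) ^ 2 := by gcongr
      rw [mul_pow, mul_pow, mul_pow, Real.sq_sqrt hm.le, Real.sq_sqrt hV0, Real.sq_sqrt hD0] at h3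
      have h4 := mul_le_mul_of_nonneg_left h3 hθ.le
      have h5 : Θ i i * (m * ((101 / 100) ^ 2 * ((2 * (κ / 100)) ^ 2 * V))) =
          (101 / 100) ^ 2 * (4 / 10000) * κ ^ 2 * m := by
        linear_combination ((101 / 100) ^ 2 * (4 / 10000) * κ ^ 2 * m) * hone'
      rw [h5] at h4
      have : 0 ≤ κ ^ 2 * m := by positivity
      linarith
    have h2 : Θ i i * D / (p + 1) ≤ κ ^ 2 * (1 / 100) := by
      rw [div_le_iff₀ (by linarith)]
      have : κ ^ 2 * (99 / 100 * m) ≤ κ ^ 2 * (p + 1) := by gcongr; linarith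
      have : 0 ≤ κ ^ 2 * m := by positivity
      linarith
    have h3 : 0 ≤ R / (p * (p + 1)) := by
      have hp0 : 0 ≤ p := by linarith
      have hR0 : 0 ≤ R := by linarith
      positivity
    have h4 : κ ^ 2 * (17 / 100) ≤ κ ^ 2 * (R₀ / ((m - S₀.card) * √32)) := by
      refine mul_le_mul_of_nonneg_left ?_ hκ2.le
      have h9 : (m - S₀.card) * √32 ≤ (m : ℝ) * (57 / 10) :=
        mul_le_mul (by linarith) hsq1 hsq3.le hm.le
      rw [le_div_iff₀ (mul_pos (by linarith) hsq3)]
      linarith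
    linarith

/-- Only non-neighbors are ever removed, so the current set keeps containing the neighborhood and
`lt_threshold_iff` applies again at each step. This is why the order of the loop is irrelevant. -/
theorem foldl_pruneStep (h : IsGoodSample Θ κ y z B m k) (hX : dataCol X = fun j => B (y j))
    (hTm : (T : ℝ) ≤ κ ^ 2 * m / 100) (hTk : T + 1 ≤ k)
    (hi₀ : i ∉ S₀) (hN₀ : neighbors Θ i ⊆ S₀) (hS₀ : S₀.card ≤ T) (l : List (Fin n)) :
    ∀ S ⊆ S₀, neighbors Θ i ⊆ S →
      l.foldl (pruneStep X i (κ ^ 2 / √32 * condVarEst X i S₀)) S =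
        S.filter fun j => j ∈ l → j ∈ neighbors Θ i := by
  induction l with
  | nil => simp
  | cons j l ih =>
    intro S hSS₀ hN
    rw [List.foldl_cons]
    have hstep : pruneStep X i (κ ^ 2 / √32 * condVarEst X i S₀) S j =
        if j ∈ neighbors Θ i then S else S.erase j := by
      by_cases hj : j ∈ S
      · have := h.lt_threshold_iff hX hTm hTk (fun h' => hi₀ (hSS₀ h')) hN
          ((Finset.card_le_card hSS₀).trans hS₀) hi₀ hN₀ hS₀ hj
        rw [pruneStep]
        by_cases hjN : j ∈ neighbors Θ i
        · rw [if_neg (by rw [this]; simpa using hjN), if_pos hjN]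
        · rw [if_pos (this.2 hjN), if_neg hjN]
      · rw [pruneStep, Finset.erase_eq_of_notMem hj]
        simp
    rw [hstep]
    split_ifs with hjN
    · rw [ih S hSS₀ hN]
      refine Finset.filter_congr fun a _ => ?_
      simp only [List.mem_cons]
      constructor
      · rintro h1 (rfl | h2)
        · exact hjN
        · exact h1 h2
      · exact fun h1 h2 => h1 (Or.inr h2)
    · rw [ih (S.erase j) ((Finset.erase_subset _ _).trans hSS₀)
        (fun a ha => Finset.mem_erase.2 ⟨fun e => hjN (e ▸ ha), hN ha⟩)]
      ext a
      simp only [Finset.mem_filter, Finset.mem_erase, List.mem_cons]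
      constructor
      · rintro ⟨⟨h1, h2⟩, h3⟩
        exact ⟨h2, fun h4 => h3 (h4.resolve_left h1)⟩
      · rintro ⟨h1, h2⟩
        refine ⟨⟨?_, h1⟩, fun h3 => h2 (Or.inr h3)⟩
        rintro rfl
        exact hjN (h2 (Or.inl rfl))

/-- On a good sample, every run of the algorithm returns the true neighborhood. -/
theorem eq_neighbors_of_isGreedyAndPruneOutput (h : IsGoodSample Θ κ y z B m k)
    (hX : dataCol X = fun j => B (y j)) {d : ℕ} (hd : (neighbors Θ i).card ≤ d)
    (hT : 64 * d * Real.log (4 / κ ^ 2) + 1 ≤ T)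
    (hTm : (T : ℝ) ≤ κ ^ 2 * m / 100) (hTk : T + 1 ≤ k) {R : Finset (Fin n)}
    (hR : IsGreedyAndPruneOutput X T (κ ^ 2 / √32) i R) : R = neighbors Θ i := by
  obtain ⟨S, l, hrun, -, hl, rfl⟩ := hR
  have hN := h.neighbors_subset_of_ompRun hX hd hT hTk hrun
  rw [h.foldl_pruneStep hX hTm hTk hrun.notMem hN hrun.card_le l S subset_rfl hN]
  ext a
  simp only [Finset.mem_filter]
  constructor
  · rintro ⟨h1, h2⟩
    exact h2 (by rwa [← hl, List.mem_toFinset] at h1)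
  · exact fun h1 => ⟨hN h1, fun _ => h1⟩

end IsGoodSample

theorem exists_ompRun {m n : ℕ} (X : Matrix (Fin m) (Fin n) ℝ) (i : Fin n) (t : ℕ) :
    ∃ S, OMPRun X i t S := by
  induction t with
  | zero => exact ⟨∅, .start⟩
  | succ t ih =>
    obtain ⟨S, hS⟩ := ih
    by_cases hall : ∀ j, j = i
    · exact ⟨S, .idle hS hall⟩
    · obtain ⟨j₀, hj₀⟩ := not_forall.1 hall
      obtain ⟨j, hj, hmin⟩ := Finset.exists_min_image (Finset.univ.erase i)
        (fun j => rss X i (insert j S)) ⟨j₀, by simpa using hj₀⟩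
      exact ⟨_, .step j hS (by simpa using hj) fun l hl => hmin l (by simpa using hl)⟩

theorem exists_isGreedyAndPruneOutput {m n : ℕ} (X : Matrix (Fin m) (Fin n) ℝ) (T : ℕ) (ν : ℝ)
    (i : Fin n) : ∃ R, IsGreedyAndPruneOutput X T ν i R := by
  obtain ⟨S, hS⟩ := exists_ompRun X i T
  exact ⟨_, S, S.toList, hS, S.nodup_toList, S.toList_toFinset, rfl⟩

end GGM

namespace GGM

open scoped RealInnerProductSpace
open MeasureTheory ProbabilityTheory

/-! ### Chi-squared concentration. -/

section ChiSquare

theorem neg_log_one_sub_le {x : ℝ} (hx : |x| ≤ 1 / 2) : -Real.log (1 - x) ≤ x + 2 * x ^ 2 := by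
  have h := Real.abs_log_sub_add_sum_range_le (x := x) (by linarith) 1
  simp only [Finset.range_one, Finset.sum_singleton, Nat.cast_zero, zero_add, pow_one, div_one] at h
  norm_num at h
  have h2 : x ^ 2 / (1 - |x|) ≤ 2 * x ^ 2 := by
    rw [div_le_iff₀ (by linarith)]
    nlinarith [sq_nonneg x]
  have := (abs_le.1 h).1
  linarith

theorem integrable_exp_sq_gaussianReal {s : ℝ} (hs : s < 1 / 2) :
    Integrable (fun t => Real.exp (s * (t ^ 2 - 1))) (gaussianReal 0 1) := by
  rw [gaussianReal_of_var_ne_zero _ one_ne_zero,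
    integrable_withDensity_iff (measurable_gaussianPDF _ _) (ae_of_all _ fun _ => gaussianPDF_lt_top)]
  have h := (integrable_exp_neg_mul_sq (b := 1 / 2 - s) (by linarith)).const_mul
    (Real.exp (-s) * (√(2 * Real.pi))⁻¹)
  refine h.congr (ae_of_all _ fun t => ?_)
  simp only [toReal_gaussianPDF, gaussianPDFReal, NNReal.coe_one, mul_one, sub_zero]
  rw [mul_left_comm, mul_comm (Real.exp (-s)), mul_assoc, ← Real.exp_add, ← Real.exp_add]
  ring_nf

/-- The integral is `(1 - 2 s)^(-1/2) * exp (-s)`. In the expansion of the logarithm the linear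
terms cancel. -/
theorem integral_exp_sq_gaussianReal_le {s : ℝ} (hs : |s| ≤ 1 / 4) :
    ∫ t, Real.exp (s * (t ^ 2 - 1)) ∂(gaussianReal 0 1) ≤ Real.exp (4 * s ^ 2) := by
  have hs' := abs_le.1 hs
  rw [integral_gaussianReal_eq_integral_smul one_ne_zero]
  have h1 : ∀ t : ℝ, gaussianPDFReal 0 1 t • Real.exp (s * (t ^ 2 - 1)) =
      (√(2 * Real.pi))⁻¹ * Real.exp (-s) * Real.exp (-(1 / 2 - s) * t ^ 2) := by
    intro t
    simp only [gaussianPDFReal, NNReal.coe_one, mul_one, sub_zero, smul_eq_mul]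
    rw [mul_assoc, mul_assoc, ← Real.exp_add, ← Real.exp_add]
    ring_nf
  simp_rw [h1]
  rw [integral_const_mul, integral_gaussian]
  have h2 : (√(2 * Real.pi))⁻¹ * √(Real.pi / (1 / 2 - s)) = √((1 - 2 * s)⁻¹) := by
    rw [← Real.sqrt_inv, ← Real.sqrt_mul (by positivity)]
    congr 1
    have : 1 - 2 * s ≠ 0 := by linarith
    have : 1 / 2 - s ≠ 0 := by linarith
    field_simp
  rw [mul_right_comm, h2]
  have h3 : √((1 - 2 * s)⁻¹) ≤ Real.exp (s + 4 * s ^ 2) := by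
    rw [Real.sqrt_le_left (Real.exp_pos _).le, ← Real.exp_nat_mul]
    have h4 : 0 < 1 - 2 * s := by linarith
    rw [← Real.exp_log (inv_pos.2 h4), Real.log_inv]
    gcongr
    have := neg_log_one_sub_le (x := 2 * s) (by rw [abs_mul, abs_two]; linarith)
    push_cast
    linarith
  calc √((1 - 2 * s)⁻¹) * Real.exp (-s) ≤ Real.exp (s + 4 * s ^ 2) * Real.exp (-s) := by gcongr
    _ = Real.exp (4 * s ^ 2) := by rw [← Real.exp_add]; ring_nf

variable {Ω : Type*} [MeasurableSpace Ω] {μ : Measure Ω} [IsProbabilityMeasure μ] {f : Ω → ℝ}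

/-- The Chernoff bound. The sign of `s` is free, so one statement serves both tails. -/
theorem measureReal_exp_sq_le (hf : Measurable f) (hfμ : μ.map f = gaussianReal 0 1) (m : ℕ)
    {s : ℝ} (hs : |s| ≤ 1 / 4) (a : ℝ) :
    (Measure.pi fun _ : Fin m => μ).real {x | a ≤ s * ∑ k, (f (x k) ^ 2 - 1)} ≤
      Real.exp (4 * s ^ 2 * m - a) := by
  set ν := Measure.pi fun _ : Fin m => μ
  have hs' := abs_le.1 hs
  have hint : Integrable (fun ω => Real.exp (s * (f ω ^ 2 - 1))) μ := by
    have h := integrable_exp_sq_gaussianReal (s := s) (by linarith)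
    rw [← hfμ] at h
    exact h.comp_measurable hf
  have hI : ∫ ω, Real.exp (s * (f ω ^ 2 - 1)) ∂μ ≤ Real.exp (4 * s ^ 2) := by
    refine le_of_eq_of_le ?_ (integral_exp_sq_gaussianReal_le hs)
    rw [← hfμ, integral_map hf.aemeasurable]
    fun_prop
  set F : (Fin m → Ω) → ℝ := fun x => ∏ k, Real.exp (s * (f (x k) ^ 2 - 1)) with hF
  have hFint : Integrable F ν := Integrable.fintype_prod fun _ => hint
  have hFI : ∫ x, F x ∂ν ≤ Real.exp (4 * s ^ 2 * m) := by
    rw [hF, integral_fintype_prod_eq_pow (fun ω => Real.exp (s * (f ω ^ 2 - 1))),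
      mul_comm (4 * s ^ 2), Real.exp_nat_mul, Fintype.card_fin]
    have : 0 ≤ ∫ ω, Real.exp (s * (f ω ^ 2 - 1)) ∂μ := integral_nonneg fun _ => (Real.exp_pos _).le
    gcongr
  have hset : {x : Fin m → Ω | a ≤ s * ∑ k, (f (x k) ^ 2 - 1)} = {x | Real.exp a ≤ F x} := by
    ext x
    simp only [Set.mem_ofPred_eq, hF, ← Real.exp_sum, ← Finset.mul_sum, Real.exp_le_exp]
  have hM := mul_meas_ge_le_integral_of_nonneg (μ := ν)
    (ae_of_all _ fun x => Finset.prod_nonneg fun k _ => (Real.exp_pos _).le) hFint (Real.exp a)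
  rw [hset, Real.exp_sub, le_div_iff₀ (Real.exp_pos _), mul_comm]
  exact hM.trans hFI

/-- Concentration of the chi-squared distribution. -/
theorem measureReal_abs_sum_sq_sub_le (hf : Measurable f) (hfμ : μ.map f = gaussianReal 0 1)
    (m : ℕ) {ε : ℝ} (hε : 0 < ε) (hε1 : ε ≤ 1) :
    (Measure.pi fun _ : Fin m => μ).real {x | ε * m < |∑ k, f (x k) ^ 2 - m|} ≤
      2 * Real.exp (-(m * ε ^ 2 / 16)) := by
  -- The choice `s = ± ε / 8` minimizes the exponent `4 s² m - |s| ε m`, with value `-m ε² / 16`.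
  have hsub : {x : Fin m → Ω | ε * m < |∑ k, f (x k) ^ 2 - m|} ⊆
      {x | ε ^ 2 * m / 8 ≤ ε / 8 * ∑ k, (f (x k) ^ 2 - 1)} ∪
        {x | ε ^ 2 * m / 8 ≤ -(ε / 8) * ∑ k, (f (x k) ^ 2 - 1)} := by
    intro x hx
    simp only [Set.mem_union, Set.mem_ofPred_eq, Finset.sum_sub_distrib, Finset.sum_const,
      Finset.card_univ, Fintype.card_fin, nsmul_eq_mul, mul_one] at hx ⊢
    rcases lt_abs.1 hx with h | h
    · left; nlinarith
    · right; nlinarith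
  have h8 : |ε / 8| ≤ 1 / 4 := by rw [abs_of_pos (by positivity)]; linarith
  have h1 := measureReal_exp_sq_le hf hfμ m h8 (ε ^ 2 * m / 8)
  have h2 := measureReal_exp_sq_le hf hfμ m (s := -(ε / 8)) (by rwa [abs_neg]) (ε ^ 2 * m / 8)
  refine (measureReal_mono hsub).trans ((measureReal_union_le _ _).trans ?_)
  have e1 : 4 * (ε / 8) ^ 2 * m - ε ^ 2 * m / 8 = -(m * ε ^ 2 / 16) := by ring
  have e2 : 4 * (-(ε / 8)) ^ 2 * m - ε ^ 2 * m / 8 = -(m * ε ^ 2 / 16) := by ring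
  rw [e1] at h1
  rw [e2] at h2
  linarith

end ChiSquare

/-! ### Nets for unit spheres of subspaces. -/

section Net

variable {E F : Type*} [NormedAddCommGroup E] [InnerProductSpace ℝ E] [FiniteDimensional ℝ E]
  [NormedAddCommGroup F] [InnerProductSpace ℝ F]

/-- The unit sphere of a subspace of dimension at most `n` has a net made of grid points. -/
theorem exists_grid_net (W : Submodule ℝ E) {n : ℕ} (hn : 0 < n) (hW : Module.finrank ℝ W ≤ n) :
    ∃ N : Finset E, N.card ≤ (8 * n + 1) ^ Module.finrank ℝ W ∧ (∀ v ∈ N, v ∈ W) ∧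
      ∀ u ∈ W, ‖u‖ = 1 → ∃ v ∈ N, ‖u - v‖ ≤ 1 / 4 := by
  classical
  set b := stdOrthonormalBasis ℝ W
  -- Coordinates in an orthonormal basis run through the multiples of `1 / (4 n)` in `[-1, 1]`,
  -- which are `8 n + 1` values. Rounding down costs at most `1 / (4 n)` per coordinate, so at most
  -- `√n / (4 n) ≤ 1 / 4` in norm. A grid this fine only contributes a multiple of `log n` per
  -- dimension to the union bound.
  let g : (Fin (Module.finrank ℝ W) → Fin (8 * n + 1)) → E := fun t =>
    ((∑ a, ((((t a : ℕ) : ℝ) - 4 * n) / (4 * n)) • b a : W) : E)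
  refine ⟨Finset.univ.image g, ?_, ?_, ?_⟩
  · refine Finset.card_image_le.trans ?_
    simp
  · intro v hv
    obtain ⟨t, -, rfl⟩ := Finset.mem_image.1 hv
    exact Submodule.coe_mem _
  · intro u hu hu1
    have hn' : (0 : ℝ) < n := by exact_mod_cast hn
    set u' : W := ⟨u, hu⟩
    have hu'1 : ‖u'‖ = 1 := hu1
    have hc : ∀ a, |b.repr u' a| ≤ 1 := fun a => by
      rw [b.repr_apply_apply]
      refine (abs_real_inner_le_norm _ _).trans ?_
      rw [b.norm_eq_one, hu'1, one_mul]
    have hfl : ∀ a, ⌊4 * n * (b.repr u' a + 1)⌋₊ < 8 * n + 1 := fun a => by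
      have h1 := (abs_le.1 (hc a)).1
      have h2 := (abs_le.1 (hc a)).2
      rw [Nat.floor_lt (by nlinarith)]
      push_cast
      nlinarith
    refine ⟨g fun a => ⟨_, hfl a⟩, Finset.mem_image_of_mem _ (Finset.mem_univ _), ?_⟩
    have hdiff : u - g (fun a => ⟨_, hfl a⟩) = ((∑ a, (b.repr u' a -
        ((⌊4 * n * (b.repr u' a + 1)⌋₊ : ℝ) - 4 * n) / (4 * n)) • b a : W) : E) := by
      have hsum : u = ((∑ a, b.repr u' a • b a : W) : E) := by rw [b.sum_repr]
      conv_lhs => rw [hsum]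
      simp only [g, sub_smul, Finset.sum_sub_distrib, Submodule.coe_sub]
    rw [hdiff, ← Submodule.coe_norm]
    set w : Fin (Module.finrank ℝ W) → ℝ := fun a => b.repr u' a -
        ((⌊4 * n * (b.repr u' a + 1)⌋₊ : ℝ) - 4 * n) / (4 * n) with hw
    have hwa : ∀ a, |w a| ≤ 1 / (4 * n) := fun a => by
      have h1 := (abs_le.1 (hc a)).1
      have h3 := Nat.floor_le (a := 4 * n * (b.repr u' a + 1)) (by nlinarith)
      have h4 := Nat.lt_floor_add_one (4 * n * (b.repr u' a + 1))
      have h5 : w a = (4 * n * (b.repr u' a + 1) - ⌊4 * n * (b.repr u' a + 1)⌋₊) / (4 * n) := by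
        simp only [hw]; field_simp; ring
      rw [h5, abs_of_nonneg (div_nonneg (by linarith) (by positivity))]
      gcongr
      linarith
    have hnorm : ‖∑ a, w a • b a‖ ^ 2 ≤ (1 / 4) ^ 2 := by
      rw [← real_inner_self_eq_norm_sq, b.orthonormal.inner_sum]
      calc ∑ a, (starRingEnd ℝ) (w a) * w a ≤ ∑ _a : Fin (Module.finrank ℝ W), (1 / (4 * (n : ℝ))) ^ 2 := by
            refine Finset.sum_le_sum fun a _ => ?_
            rw [RCLike.conj_to_real, ← sq, ← sq_abs]
            gcongr
            exact hwa a
        _ = Module.finrank ℝ W * (1 / (4 * n)) ^ 2 := by simp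
        _ ≤ n * (1 / (4 * n)) ^ 2 := by gcongr
        _ ≤ (1 / 4) ^ 2 := by
            have : (1 : ℝ) ≤ n := by exact_mod_cast hn
            rw [div_pow, div_pow, mul_div_assoc', div_le_div_iff₀ (by positivity) (by norm_num)]
            nlinarith
    exact (le_abs_self _).trans (abs_le_of_sq_le_sq hnorm (by norm_num))

/-- It suffices to check the near isometry property on a net. -/
theorem isNearIsometry_of_net {A : E →ₗ[ℝ] F} {W : Submodule ℝ E} {M ε : ℝ} (hM : 0 < M)
    (hε : 0 ≤ ε) {N : Finset E} (hNW : ∀ v ∈ N, v ∈ W)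
    (hN : ∀ u ∈ W, ‖u‖ = 1 → ∃ v ∈ N, ‖u - v‖ ≤ 1 / 4)
    (hA : ∀ v ∈ N, |‖A v‖ ^ 2 - M * ‖v‖ ^ 2| ≤ ε / 4 * M * ‖v‖ ^ 2) :
    IsNearIsometry A W M ε := by
  set K : Set E := {u | u ∈ W ∧ ‖u‖ = 1} with hK
  have hKc : IsCompact K := by
    have h1 : K = (W : Set E) ∩ Metric.sphere 0 1 := by ext; simp [hK]
    rw [h1, Set.inter_comm]
    exact (isCompact_sphere 0 1).inter_right W.closed_of_finiteDimensional
  have hcont : Continuous fun u => |‖A u‖ ^ 2 - M * ‖u‖ ^ 2| := by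
    have := A.continuous_of_finiteDimensional
    fun_prop
  rcases K.eq_empty_or_nonempty with hKe | hKn
  · intro v hv
    by_cases h0 : v = 0
    · simp [h0]
    · exfalso
      have : (‖v‖⁻¹ • v) ∈ K := ⟨W.smul_mem _ hv, by
        rw [norm_smul, norm_inv, norm_norm, inv_mul_cancel₀ (norm_ne_zero_iff.2 h0)]⟩
      rw [hKe] at this
      exact this
  obtain ⟨u₀, ⟨hu₀W, hu₀1⟩, hmax⟩ := hKc.exists_isMaxOn hKn hcont.continuousOn
  set h := |‖A u₀‖ ^ 2 - M * ‖u₀‖ ^ 2| with hh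
  have hiso : IsNearIsometry A W M (h / M) := by
    intro v hv
    by_cases h0 : v = 0
    · simp [h0]
    have hvn : ‖v‖ ≠ 0 := norm_ne_zero_iff.2 h0
    have hmem : (‖v‖⁻¹ • v) ∈ K := ⟨W.smul_mem _ hv, by
      rw [norm_smul, norm_inv, norm_norm, inv_mul_cancel₀ hvn]⟩
    have h1 : |‖A (‖v‖⁻¹ • v)‖ ^ 2 - M * ‖‖v‖⁻¹ • v‖ ^ 2| ≤ h := hmax hmem
    rw [map_smul, norm_smul, norm_smul, norm_inv, norm_norm] at h1
    have h2 : (‖v‖⁻¹ * ‖A v‖) ^ 2 - M * (‖v‖⁻¹ * ‖v‖) ^ 2 =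
        (‖A v‖ ^ 2 - M * ‖v‖ ^ 2) / ‖v‖ ^ 2 := by
      field_simp
    rw [h2, abs_div, abs_of_pos (by positivity : 0 < ‖v‖ ^ 2), div_le_iff₀ (by positivity)] at h1
    rwa [div_mul_cancel₀ _ hM.ne']
  -- The error form at the maximizer `u₀` differs from that at a net point `v` by its bilinear value
  -- on `u₀ - v` and `u₀ + v`, at most `h * (1 / 4) * (9 / 4)`. At `v` it is at most `(ε / 4) M (5 /
  -- 4)²`. Solving for `h` gives `25 / 28 * ε M`.
  have hle : h ≤ ε * M := by
    obtain ⟨v, hvN, hv⟩ := hN u₀ hu₀W hu₀1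
    have h1 := hA v hvN
    have h2 := hiso.abs_inner_sub_le (W.sub_mem hu₀W (hNW v hvN)) (W.add_mem hu₀W (hNW v hvN))
    rw [div_mul_cancel₀ _ hM.ne'] at h2
    have hvn : ‖v‖ ≤ 5 / 4 := by
      have : ‖v‖ ≤ ‖u₀‖ + ‖u₀ - v‖ := by
        have := norm_sub_le u₀ (u₀ - v)
        rwa [sub_sub_cancel] at this
      linarith
    have hsum : ‖u₀ + v‖ ≤ 9 / 4 := (norm_add_le _ _).trans (by linarith)
    have hh0 : 0 ≤ h := abs_nonneg _
    have h3 : h * (‖u₀ - v‖ * ‖u₀ + v‖) ≤ h * (1 / 4 * (9 / 4)) := by gcongr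
    have h4 : ε / 4 * M * ‖v‖ ^ 2 ≤ ε / 4 * M * (5 / 4) ^ 2 := by gcongr
    have h5 : ⟪A (u₀ - v), A (u₀ + v)⟫ - M * ⟪u₀ - v, u₀ + v⟫ =
        (‖A u₀‖ ^ 2 - M * ‖u₀‖ ^ 2) - (‖A v‖ ^ 2 - M * ‖v‖ ^ 2) := by
      simp only [map_sub, map_add, inner_sub_left, inner_add_right, real_inner_self_eq_norm_sq]
      rw [real_inner_comm (A u₀) (A v), real_inner_comm u₀ v]
      ring
    rw [h5] at h2
    have h6 := abs_sub_abs_le_abs_sub (‖A u₀‖ ^ 2 - M * ‖u₀‖ ^ 2) (‖A v‖ ^ 2 - M * ‖v‖ ^ 2)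
    rw [← hh] at h6
    have h7 : 0 ≤ ε * M := by positivity
    linarith
  intro v hv
  refine (hiso v hv).trans ?_
  rw [div_mul_cancel₀ _ hM.ne']
  gcongr

end Net

end GGM

namespace GGM

open scoped RealInnerProductSpace
open MeasureTheory ProbabilityTheory Matrix

/-! ### The random sample is good with high probability. -/

section Sample

variable {n m : ℕ}

/-- The linear map whose matrix has the rows `x k`. -/
noncomputable def sampleMap (x : Fin m → EuclideanSpace ℝ (Fin n)) :
    EuclideanSpace ℝ (Fin n) →ₗ[ℝ] EuclideanSpace ℝ (Fin m) where
  toFun v := WithLp.toLp 2 fun k => ⟪x k, v⟫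
  map_add' u v := by ext k; simp [inner_add_right]
  map_smul' c v := by ext k; simp [inner_smul_right]

theorem norm_sampleMap_sq (x : Fin m → EuclideanSpace ℝ (Fin n)) (v : EuclideanSpace ℝ (Fin n)) :
    ‖sampleMap x v‖ ^ 2 = ∑ k, ⟪x k, v⟫ ^ 2 := by
  rw [EuclideanSpace.real_norm_sq_eq]
  rfl

open scoped MatrixOrder in
/-- A positive definite matrix is the Gram matrix of a basis; the dual basis is carried to the
standard basis by a linear map that turns the Gaussian with this precision matrix into a standard
one. -/
theorem exists_isPrecisionPair {Θ : Matrix (Fin n) (Fin n) ℝ} (hΘ : Θ.PosDef) :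
    ∃ (y z : Fin n → EuclideanSpace ℝ (Fin n))
      (L : EuclideanSpace ℝ (Fin n) →ₗ[ℝ] EuclideanSpace ℝ (Fin n)),
      IsPrecisionPair Θ y z ∧ (∀ j, L (y j) = EuclideanSpace.single j 1) ∧
      ∀ v, (L v).ofLp ⬝ᵥ (Θ⁻¹ *ᵥ (L v).ofLp) = ‖v‖ ^ 2 := by
  obtain ⟨B, hB⟩ := CStarAlgebra.nonneg_iff_eq_star_mul_self.mp hΘ.posSemidef.nonneg
  rw [star_eq_conjTranspose, conjTranspose_eq_transpose_of_trivial] at hB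
  have hdet : IsUnit B.det := by
    have h1 : Θ.det ≠ 0 := hΘ.det_pos.ne'
    rw [hB, det_mul] at h1
    exact isUnit_iff_ne_zero.2 (right_ne_zero_of_mul h1)
  have hdetT : IsUnit Bᵀ.det := by rwa [det_transpose]
  have hinv : Θ⁻¹ = B⁻¹ * Bᵀ⁻¹ := by rw [hB, Matrix.mul_inv_rev]
  -- From `Θ = Bᵀ * B`: the columns of `B` have Gram matrix `Θ`, those of `Bᵀ⁻¹` form the dual
  -- basis, and `L` is `Bᵀ`. Since `Θ⁻¹ = B⁻¹ * Bᵀ⁻¹`, the variance of `⟪x, L v⟫` is `‖v‖ ^ 2`.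
  refine ⟨fun j => WithLp.toLp 2 (Bᵀ⁻¹.col j), fun j => WithLp.toLp 2 (B.col j),
    Matrix.toEuclideanLin Bᵀ, ⟨?_, ?_⟩, ?_, ?_⟩
  · intro i j
    have : (Bᵀ * Bᵀ⁻¹) i j = (1 : Matrix (Fin n) (Fin n) ℝ) i j := by
      rw [mul_nonsing_inv _ hdetT]
    rw [one_apply, mul_apply] at this
    rw [← this, PiLp.inner_apply]
    refine Finset.sum_congr rfl fun k _ => ?_
    simp [mul_comm]
  · intro i
    have h1 : B = Bᵀ⁻¹ * Θ := by
      rw [hB, ← Matrix.mul_assoc, nonsing_inv_mul _ hdetT, Matrix.one_mul]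
    ext k
    have h2 : B k i = (Bᵀ⁻¹ * Θ) k i := by rw [← h1]
    have hsymm : ∀ j, Θ j i = Θ i j := fun j => by
      have := hΘ.isHermitian.apply i j
      simpa using this
    simp only [mul_apply, hsymm] at h2
    simp [h2, mul_comm]
  · intro j
    ext k
    have : (Bᵀ * Bᵀ⁻¹) k j = (1 : Matrix (Fin n) (Fin n) ℝ) k j := by
      rw [mul_nonsing_inv _ hdetT]
    rw [one_apply, mul_apply] at this
    simp only [transpose_apply] at this
    simpa [mulVec, dotProduct] using this
  · intro v
    rw [hinv, Matrix.toLpLin_apply, EuclideanSpace.real_norm_sq_eq]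
    have h1 : (B⁻¹ * Bᵀ⁻¹) *ᵥ (Bᵀ *ᵥ v.ofLp) = B⁻¹ *ᵥ v.ofLp := by
      rw [mulVec_mulVec, Matrix.mul_assoc, nonsing_inv_mul _ hdetT, Matrix.mul_one]
    rw [h1, mulVec_transpose, ← dotProduct_mulVec, mulVec_mulVec, mul_nonsing_inv _ hdet,
      one_mulVec, dotProduct]
    simp [sq]

theorem map_inner_multivariateGaussian {S : Matrix (Fin n) (Fin n) ℝ} (hS : S.PosSemidef)
    (v : EuclideanSpace ℝ (Fin n)) (hv : v.ofLp ⬝ᵥ (S *ᵥ v.ofLp) = 1) :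
    (multivariateGaussian 0 S).map (fun x => ⟪x, v⟫) = gaussianReal 0 1 := by
  have h := IsGaussian.map_eq_gaussianReal (μ := multivariateGaussian 0 S) (innerSL ℝ v)
  have h1 : (⇑(innerSL ℝ v) : EuclideanSpace ℝ (Fin n) → ℝ) = fun x => ⟪x, v⟫ := by
    ext x; simp [real_inner_comm]
  have hmean : (multivariateGaussian 0 S)[⇑(innerSL ℝ v)] = 0 := by
    rw [ContinuousLinearMap.integral_comp_id_comm, integral_id_multivariateGaussian, map_zero]
    exact IsGaussian.integrable_id
  have hvar : Var[⇑(innerSL ℝ v); multivariateGaussian 0 S] = 1 := by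
    have h2 := covarianceBilin_self (μ := multivariateGaussian 0 S) IsGaussian.memLp_two_id v
    rw [covarianceBilin_multivariateGaussian hS, hv] at h2
    exact h2.symm
  rw [hmean, hvar, h1] at h
  simpa using h

theorem exists_subset_range {U : Finset (Fin n)} {k : ℕ} (hn : 0 < n) (hU : U.card ≤ k) :
    ∃ f : Fin k → Fin n, ∀ j ∈ U, j ∈ Set.range f := by
  refine ⟨fun a => U.toList.getD a ⟨0, hn⟩, fun j hj => ?_⟩
  obtain ⟨a, ha, rfl⟩ := List.mem_iff_getElem.1 (Finset.mem_toList.2 hj)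
  refine ⟨⟨a, by rw [Finset.length_toList] at ha; omega⟩, ?_⟩
  exact List.getD_eq_getElem _ _ ha

/-- With high probability, the sample map is a near isometry on all sparse subspaces. -/
theorem measureReal_not_near_le {μ : Measure (EuclideanSpace ℝ (Fin n))} [IsProbabilityMeasure μ]
    (L : EuclideanSpace ℝ (Fin n) →ₗ[ℝ] EuclideanSpace ℝ (Fin n))
    (hμ : ∀ v, ‖v‖ = 1 → μ.map (fun x => ⟪x, L v⟫) = gaussianReal 0 1)
    (y : Fin n → EuclideanSpace ℝ (Fin n)) (k : ℕ) (hn : 0 < n) (hm : 0 < m) {ε : ℝ}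
    (hε : 0 < ε) (hε1 : ε ≤ 1) :
    (Measure.pi fun _ : Fin m => μ).real {x | ¬ ∀ U : Finset (Fin n), U.card ≤ k →
      IsNearIsometry (sampleMap x ∘ₗ L) (Submodule.span ℝ (y '' U)) m ε} ≤
      n ^ k * (8 * n + 1) ^ k * (2 * Real.exp (-(m * ε ^ 2 / 256))) := by
  classical
  -- The union bound runs over `k`-tuples instead of sets: there are `n ^ k` of them, and every `U`
  -- with at most `k` elements lies in the range of one.
  set W : (Fin k → Fin n) → Submodule ℝ (EuclideanSpace ℝ (Fin n)) := fun f =>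
    Submodule.span ℝ (Set.range fun a => y (f a)) with hW
  have hfin : ∀ f, Module.finrank ℝ (W f) ≤ n := fun f => by
    have := Submodule.finrank_le (W f)
    rwa [finrank_euclideanSpace_fin] at this
  choose N hNcard hNW hN using fun f => exists_grid_net (W f) hn (hfin f)
  have hm' : (0 : ℝ) < m := by exact_mod_cast hm
  set bad : EuclideanSpace ℝ (Fin n) → Set (Fin m → EuclideanSpace ℝ (Fin n)) := fun v =>
    {x | ¬ |‖sampleMap x (L v)‖ ^ 2 - m * ‖v‖ ^ 2| ≤ ε / 4 * m * ‖v‖ ^ 2}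
  have hbad : ∀ v, (Measure.pi fun _ : Fin m => μ).real (bad v) ≤
      2 * Real.exp (-(m * ε ^ 2 / 256)) := by
    intro v
    by_cases hv : v = 0
    · have : bad v = ∅ := by
        ext x; simp [bad, hv]
      rw [this]
      simp only [measureReal_empty]
      positivity
    · have hvn : 0 < ‖v‖ := norm_pos_iff.2 hv
      set w := ‖v‖⁻¹ • v with hw
      have hw1 : ‖w‖ = 1 := by
        rw [hw, norm_smul, norm_inv, norm_norm, inv_mul_cancel₀ hvn.ne']
      -- Net points need not be unit vectors, so `v` is rescaled. The net argument requires accuracy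
      -- `ε / 4`, whence `256 = 16 * 4²`.
      have h1 := measureReal_abs_sum_sq_sub_le (f := fun x => ⟪x, L w⟫)
        (by fun_prop) (hμ w hw1) m (ε := ε / 4) (by positivity) (by linarith)
      have e : (m : ℝ) * (ε / 4) ^ 2 / 16 = m * ε ^ 2 / 256 := by ring
      rw [e] at h1
      refine le_trans (measureReal_mono ?_) h1
      intro x hx
      simp only [bad, Set.mem_ofPred_eq, not_le] at hx ⊢
      have hLv : L v = ‖v‖ • L w := by
        rw [hw, map_smul, smul_smul, mul_inv_cancel₀ hvn.ne', one_smul]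
      rw [hLv, map_smul, norm_smul, norm_norm, mul_pow, norm_sampleMap_sq, mul_comm (m : ℝ),
        ← mul_sub, abs_mul, abs_of_pos (by positivity : 0 < ‖v‖ ^ 2), mul_comm] at hx
      exact lt_of_mul_lt_mul_left hx (by positivity)
  have hsub : {x : Fin m → EuclideanSpace ℝ (Fin n) | ¬ ∀ U : Finset (Fin n), U.card ≤ k →
      IsNearIsometry (sampleMap x ∘ₗ L) (Submodule.span ℝ (y '' U)) m ε} ⊆
      ⋃ f ∈ (Finset.univ : Finset (Fin k → Fin n)), ⋃ v ∈ N f, bad v := by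
    intro x hx
    by_contra hx'
    refine hx fun U hU => ?_
    obtain ⟨f, hf⟩ := exists_subset_range hn hU
    have hiso : IsNearIsometry (sampleMap x ∘ₗ L) (W f) m ε := by
      refine isNearIsometry_of_net hm' hε.le (hNW f) (hN f) fun v hv => ?_
      by_contra hvx
      refine hx' ?_
      simp only [Set.mem_iUnion]
      exact ⟨f, Finset.mem_univ _, v, hv, hvx⟩
    intro v hv
    refine hiso v (Submodule.span_mono ?_ hv)
    rintro _ ⟨j, hj, rfl⟩
    obtain ⟨a, rfl⟩ := hf j hj
    exact ⟨a, rfl⟩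
  set t := 2 * Real.exp (-(m * ε ^ 2 / 256)) with ht
  have ht0 : 0 ≤ t := by positivity
  calc (Measure.pi fun _ : Fin m => μ).real _
      ≤ (Measure.pi fun _ : Fin m => μ).real
          (⋃ f ∈ (Finset.univ : Finset (Fin k → Fin n)), ⋃ v ∈ N f, bad v) := measureReal_mono hsub (measure_ne_top _ _)
    _ ≤ ∑ f : Fin k → Fin n, (Measure.pi fun _ : Fin m => μ).real (⋃ v ∈ N f, bad v) :=
        measureReal_biUnion_finset_le _ _
    _ ≤ ∑ _f : Fin k → Fin n, (8 * (n : ℝ) + 1) ^ k * t := by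
        refine Finset.sum_le_sum fun f _ => (measureReal_biUnion_finset_le _ _).trans ?_
        refine (Finset.sum_le_sum fun v _ => hbad v).trans ?_
        rw [Finset.sum_const, nsmul_eq_mul]
        refine mul_le_mul_of_nonneg_right ?_ ht0
        have h1 : Module.finrank ℝ (W f) ≤ k := by
          have := finrank_range_le_card (R := ℝ) fun a => y (f a)
          rwa [Fintype.card_fin] at this
        have h2 : (N f).card ≤ (8 * n + 1) ^ k :=
          (hNcard f).trans (Nat.pow_le_pow_right (by omega) h1)
        exact_mod_cast h2
    _ = n ^ k * (8 * n + 1) ^ k * t := by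
        simp [mul_assoc]

/-- Disposes of `n = 1`, where `log n = 0` and the sample size does not control `T`. -/
theorem isGreedyAndPruneOutput_iff_of_forall_eq (X : Matrix (Fin m) (Fin n) ℝ) (T : ℕ) (ν : ℝ)
    (Θ : Matrix (Fin n) (Fin n) ℝ) {i : Fin n} (hi : ∀ j, j = i) (R : Finset (Fin n)) :
    IsGreedyAndPruneOutput X T ν i R ↔ R = neighbors Θ i := by
  have hΘ : neighbors Θ i = ∅ := by simp [neighbors, hi]
  have hrun : ∀ t S, OMPRun X i t S → S = ∅ := by
    intro t S h
    induction h with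
    | start => rfl
    | step j _ hj _ _ => exact absurd (hi j) hj
    | idle _ _ ih => exact ih
  have key : ∀ R, IsGreedyAndPruneOutput X T ν i R → R = neighbors Θ i := by
    rintro R ⟨S, l, hS, -, hl, rfl⟩
    obtain rfl := hrun T S hS
    obtain rfl := List.toFinset_eq_empty_iff l |>.1 hl
    rw [hΘ]; rfl
  refine ⟨key R, ?_⟩
  rintro rfl
  obtain ⟨R', hR'⟩ := exists_isGreedyAndPruneOutput X T ν i
  rwa [← key R' hR']

/-- The number of samples bounds the number of steps, and makes the failure probability small. -/
theorem failure_bound {n m T : ℕ} {K κ δ C : ℝ} (hn : 2 ≤ n) (hκ : 0 < κ)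
    (hδ : 0 < δ) (hδ1 : δ < 1) (hK : 1 ≤ K) (hTK : (T : ℝ) ≤ K + 1) (hC : 50000000 ≤ C)
    (hm : C * ((1 / κ ^ 2) * (K * Real.log n + Real.log (4 / δ))) ≤ m) :
    (T : ℝ) ≤ κ ^ 2 * m / 100 ∧
      (n : ℝ) ^ (T + 1) * (8 * n + 1) ^ (T + 1) *
        (2 * Real.exp (-(m * (κ / 100) ^ 2 / 256))) ≤ δ := by
  have hn' : (2 : ℝ) ≤ n := by exact_mod_cast hn
  have hlog2 : 1 / 2 ≤ Real.log n := by
    have h1 := Real.log_two_gt_d9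
    have h2 := Real.log_le_log (by norm_num) hn'
    linarith
  have hlogδ : 0 ≤ Real.log (4 / δ) := by
    refine Real.log_nonneg ?_
    rw [le_div_iff₀ hδ]; linarith
  have hκ2 : 0 < κ ^ 2 := by positivity
  have hKl : 0 ≤ K * Real.log n := by positivity
  have hm' : 50000000 * (K * Real.log n + Real.log (4 / δ)) ≤ κ ^ 2 * m := by
    have h1 : C * (K * Real.log n + Real.log (4 / δ)) ≤ κ ^ 2 * m := by
      have := mul_le_mul_of_nonneg_left hm hκ2.le
      have e : κ ^ 2 * (C * ((1 / κ ^ 2) * (K * Real.log n + Real.log (4 / δ)))) =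
          C * (K * Real.log n + Real.log (4 / δ)) := by field_simp
      rwa [e] at this
    refine le_trans ?_ h1
    gcongr
  have hKK : K / 2 ≤ K * Real.log n := by nlinarith
  refine ⟨by linarith, ?_⟩
  -- So tuples and nets together contribute at most `n ^ (6 (T + 1))`.
  have hpow : (8 * (n : ℝ) + 1) ≤ n ^ 5 := by
    have : (16 : ℝ) ≤ n ^ 4 := by
      calc (16 : ℝ) = 2 ^ 4 := by norm_num
        _ ≤ n ^ 4 := by gcongr
    nlinarith
  have hn0 : (0 : ℝ) < n := by linarith
  calc (n : ℝ) ^ (T + 1) * (8 * n + 1) ^ (T + 1) * (2 * Real.exp (-(m * (κ / 100) ^ 2 / 256)))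
      ≤ (n : ℝ) ^ (T + 1) * (n ^ 5) ^ (T + 1) *
        (2 * Real.exp (-(m * (κ / 100) ^ 2 / 256))) := by gcongr
    _ = 2 * Real.exp ((6 * (T + 1)) * Real.log n - m * (κ / 100) ^ 2 / 256) := by
        rw [← mul_pow, ← pow_succ', ← pow_mul, sub_eq_add_neg, Real.exp_add]
        have : (n : ℝ) ^ ((5 + 1) * (T + 1)) = Real.exp (6 * (T + 1) * Real.log n) := by
          rw [← Real.rpow_natCast, Real.rpow_def_of_pos hn0]
          push_cast
          ring_nf
        rw [this]; ring
    _ ≤ 2 * Real.exp (-Real.log (4 / δ)) := by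
        gcongr
        -- Uses `T + 1 ≤ K + 2 ≤ 3 K`. The constant `50000000` is chosen so that, divided by `100² *
        -- 256`, it still exceeds `18 + 1`.
        have h1 : 6 * ((T : ℝ) + 1) * Real.log n ≤ 18 * (K * Real.log n) := by
          have : 6 * ((T : ℝ) + 1) ≤ 18 * K := by linarith
          nlinarith
        nlinarith
    _ = δ / 2 := by
        rw [← Real.log_inv, Real.exp_log (by positivity)]
        field_simp
        norm_num
    _ ≤ δ := by linarith

/-- The sample complexity of the algorithm. -/
theorem ofReal_one_sub_le_measure {n m d : ℕ} {κ δ C : ℝ} {Θ : Matrix (Fin n) (Fin n) ℝ}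
    (hn : 0 < n) (hm : 0 < m) (hκ : 0 < κ) (hκ1 : κ ≤ 1) (hδ : 0 < δ) (hδ1 : δ < 1)
    (hΘ : Θ.PosDef) (hA : IsAttractive Θ) (hN : IsNondegenerate κ Θ)
    (hd : ∀ i, (neighbors Θ i).card ≤ d) (hC : 50000000 ≤ C) {K : ℝ}
    (hK : K = 64 * d * Real.log (4 / κ ^ 2) + 1)
    (hCm : C * ((1 / κ ^ 2) * (K * Real.log n + Real.log (4 / δ))) ≤ m) :
    ENNReal.ofReal (1 - δ) ≤ Measure.pi (fun _ : Fin m => multivariateGaussian 0 Θ⁻¹)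
      {x : Fin m → EuclideanSpace ℝ (Fin n) | ∀ (i : Fin n) (R : Finset (Fin n)),
        IsGreedyAndPruneOutput (Matrix.of fun k j => x k j) ⌈K⌉₊ (κ ^ 2 / √32) i R ↔
          R = neighbors Θ i} := by
  set ν := Measure.pi (fun _ : Fin m => multivariateGaussian 0 Θ⁻¹)
  rcases Nat.lt_or_ge n 2 with h1 | h2
  · have : {x : Fin m → EuclideanSpace ℝ (Fin n) | ∀ (i : Fin n) (R : Finset (Fin n)),
        IsGreedyAndPruneOutput (Matrix.of fun k j => x k j) ⌈K⌉₊ (κ ^ 2 / √32) i R ↔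
          R = neighbors Θ i} = Set.univ := by
      refine Set.eq_univ_of_forall fun x i R => ?_
      exact isGreedyAndPruneOutput_iff_of_forall_eq _ _ _ _ (fun j => Fin.ext (by omega)) R
    rw [this, measure_univ]
    exact ENNReal.ofReal_le_one.2 (by linarith)
  have hlog : 0 ≤ Real.log (4 / κ ^ 2) := by
    refine Real.log_nonneg ?_
    rw [le_div_iff₀ (by positivity)]
    have : κ ^ 2 ≤ 1 := pow_le_one₀ hκ.le hκ1
    linarith
  have hK1 : 1 ≤ K := by
    have : 0 ≤ 64 * d * Real.log (4 / κ ^ 2) := by positivity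
    linarith
  have hTK : (⌈K⌉₊ : ℝ) ≤ K + 1 := (Nat.ceil_lt_add_one (by linarith)).le
  obtain ⟨hTm, hfail⟩ := failure_bound h2 hκ hδ hδ1 hK1 hTK hC hCm
  set T := ⌈K⌉₊
  obtain ⟨y, z, L, hpair, hLy, hLvar⟩ := exists_isPrecisionPair hΘ
  have hμ : ∀ v, ‖v‖ = 1 →
      (multivariateGaussian 0 Θ⁻¹).map (fun x => ⟪x, L v⟫) = gaussianReal 0 1 := fun v hv =>
    map_inner_multivariateGaussian hΘ.inv.posSemidef _ (by rw [hLvar, hv, one_pow])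
  have hbad := measureReal_not_near_le (m := m) L hμ y (T + 1) hn hm (ε := κ / 100)
    (by positivity) (by linarith)
  set G := {x : Fin m → EuclideanSpace ℝ (Fin n) | ∀ U : Finset (Fin n), U.card ≤ T + 1 →
      IsNearIsometry (sampleMap x ∘ₗ L) (Submodule.span ℝ (y '' U)) m (κ / 100)} with hG
  have hGc : ν Gᶜ ≤ ENNReal.ofReal δ := by
    rw [← ENNReal.ofReal_toReal (measure_ne_top ν Gᶜ)]
    exact ENNReal.ofReal_le_ofReal (hbad.trans hfail)
  have hGsub : G ⊆ {x : Fin m → EuclideanSpace ℝ (Fin n) | ∀ (i : Fin n) (R : Finset (Fin n)),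
        IsGreedyAndPruneOutput (Matrix.of fun k j => x k j) T (κ ^ 2 / √32) i R ↔
          R = neighbors Θ i} := by
    intro x hx i R
    have hgood : IsGoodSample Θ κ y z (sampleMap x ∘ₗ L) m (T + 1) :=
      ⟨hpair, hA, hN, hκ, hκ1, by exact_mod_cast hm, hx⟩
    -- Because `L` sends `y j` to the `j`-th basis vector, its image under the sample map collects
    -- the `j`-th coordinates of the samples.
    have hX : dataCol (Matrix.of fun k j => x k j) = fun j => (sampleMap x ∘ₗ L) (y j) := by
      funext j
      ext k
      simp [dataCol, sampleMap, hLy, EuclideanSpace.inner_single_right]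
    have key : ∀ R, IsGreedyAndPruneOutput (Matrix.of fun k j => x k j) T (κ ^ 2 / √32) i R →
        R = neighbors Θ i := fun R hR =>
      hgood.eq_neighbors_of_isGreedyAndPruneOutput hX (hd i)
        (hK ▸ Nat.le_ceil K) hTm le_rfl hR
    refine ⟨key R, ?_⟩
    -- Conversely, some output exists and it equals the neighborhood, so the neighborhood is an
    -- output.
    rintro rfl
    obtain ⟨R', hR'⟩ := exists_isGreedyAndPruneOutput (Matrix.of fun k j => x k j) T
      (κ ^ 2 / √32) i
    rwa [← key R' hR']
  refine le_trans ?_ (measure_mono hGsub)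
  rw [ENNReal.ofReal_sub _ hδ.le, ENNReal.ofReal_one, tsub_le_iff_right]
  calc (1 : ENNReal) = ν (G ∪ Gᶜ) := by rw [Set.union_compl_self, measure_univ]
    _ ≤ ν G + ν Gᶜ := measure_union_le _ _
    _ ≤ ν G + ENNReal.ofReal δ := by gcongr

end Sample

end GGM

namespace GGM

/-! ### Reasoning about programs: frames, loops and costs. -/

section Framework

/-- The scalar that is stored in entry `(0, 0)` of an array of natural numbers. -/
def NatExpr.var (a : ℕ) : NatExpr := .cell a (.const 0) (.const 0)

/-- The scalar that is stored in entry `(0, 0)` of an array of reals. -/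
def RealExpr.var (a : ℕ) : RealExpr := .cell a (.const 0) (.const 0)

@[simp] theorem NatExpr.eval_var (s : Store) (a : ℕ) : (NatExpr.var a).eval s = s.nat a 0 0 := rfl

@[simp] theorem NatExpr.cost_var (a : ℕ) : (NatExpr.var a).cost = 3 := rfl

@[simp] theorem RealExpr.eval_var (s : Store) (a : ℕ) :
    (RealExpr.var a).eval s = s.real a 0 0 := rfl

@[simp] theorem RealExpr.cost_var (a : ℕ) : (RealExpr.var a).cost = 3 := rfl

attribute [simp] NatExpr.eval NatExpr.cost RealExpr.eval RealExpr.cost Test.Holds Test.cost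

namespace Store

variable (s : Store)

@[simp] theorem real_setNat (a i j v : ℕ) : (s.setNat a i j v).real = s.real := rfl

@[simp] theorem nat_setReal (a i j : ℕ) (v : ℝ) : (s.setReal a i j v).nat = s.nat := rfl

@[simp] theorem nat_setNat_self (a i j v : ℕ) : (s.setNat a i j v).nat a i j = v := by
  simp [setNat]

@[simp] theorem real_setReal_self (a i j : ℕ) (v : ℝ) : (s.setReal a i j v).real a i j = v := by
  simp [setReal]

theorem nat_setNat_of_ne {a a' : ℕ} (h : a' ≠ a) (i j v : ℕ) :
    (s.setNat a i j v).nat a' = s.nat a' := by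
  simp [setNat, h]

theorem real_setReal_of_ne {a a' : ℕ} (h : a' ≠ a) (i j : ℕ) (v : ℝ) :
    (s.setReal a i j v).real a' = s.real a' := by
  simp [setReal, h]

theorem nat_setNat_apply (a i j v i' j' : ℕ) :
    (s.setNat a i j v).nat a i' j' = if i' = i ∧ j' = j then v else s.nat a i' j' := by
  simp [setNat]

theorem real_setReal_apply (a i j : ℕ) (v : ℝ) (i' j' : ℕ) :
    (s.setReal a i j v).real a i' j' = if i' = i ∧ j' = j then v else s.real a i' j' := by
  simp [setReal]

end Store

namespace Program

/-- The arrays of natural numbers that occur in assignments of the program. -/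
def natWrites : Program → List ℕ
  | skip => []
  | setNat a _ _ _ => [a]
  | setReal _ _ _ _ => []
  | seq p q => p.natWrites ++ q.natWrites
  | ite _ p q => p.natWrites ++ q.natWrites
  | loop a _ p => a :: p.natWrites

/-- The arrays of reals that occur in assignments of the program. -/
def realWrites : Program → List ℕ
  | skip => []
  | setNat _ _ _ _ => []
  | setReal a _ _ _ => [a]
  | seq p q => p.realWrites ++ q.realWrites
  | ite _ p q => p.realWrites ++ q.realWrites
  | loop _ _ p => p.realWrites

/-- The store `s'` differs from `s` only in arrays that the program may write. -/
structure Frame (p : Program) (s s' : Store) : Prop where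
  nat_eq : ∀ a, a ∉ p.natWrites → s'.nat a = s.nat a
  real_eq : ∀ a, a ∉ p.realWrites → s'.real a = s.real a

theorem iterate_inv {body : ℕ → Store → Store × ℕ} {s : Store} (J : Store → Prop) (N : ℕ)
    (h0 : J s) (hstep : ∀ k s', J s' → J (body k s').1) : J (iterate body s N).1 := by
  induction N with
  | zero => exact h0
  | succ N ih => exact hstep N _ ih

theorem iterate_rule {body : ℕ → Store → Store × ℕ} {s : Store} (J : ℕ → Store → Prop)
    (c : ℕ → ℕ) (N : ℕ) (h0 : J 0 s)
    (hstep : ∀ k < N, ∀ s', J k s' → J (k + 1) (body k s').1 ∧ (body k s').2 ≤ c k) :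
    J N (iterate body s N).1 ∧ (iterate body s N).2 ≤ ∑ k ∈ Finset.range N, (c k + 1) := by
  induction N with
  | zero => exact ⟨h0, le_rfl⟩
  | succ N ih =>
    obtain ⟨h1, h2⟩ := ih fun k hk => hstep k (by omega)
    obtain ⟨h3, h4⟩ := hstep N (by omega) _ h1
    refine ⟨h3, ?_⟩
    rw [Finset.sum_range_succ]
    change (iterate body s N).2 + (body N (iterate body s N).1).2 + 1 ≤ _
    omega

/-- With this each specification need only describe the arrays it computes; that all others survive
is decided from the syntax of the program. -/
theorem frame_exec (p : Program) (s : Store) : Frame p s (p.exec s).1 := by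
  induction p generalizing s with
  | skip => exact ⟨fun _ _ => rfl, fun _ _ => rfl⟩
  | setNat a i j e =>
    refine ⟨fun b hb => ?_, fun _ _ => rfl⟩
    exact s.nat_setNat_of_ne (by simpa [natWrites] using hb) _ _ _
  | setReal a i j x =>
    refine ⟨fun _ _ => rfl, fun b hb => ?_⟩
    exact s.real_setReal_of_ne (by simpa [realWrites] using hb) _ _ _
  | seq p q ihp ihq =>
    refine ⟨fun b hb => ?_, fun b hb => ?_⟩
    · simp only [natWrites, List.mem_append, not_or] at hb
      exact ((ihq _).nat_eq b hb.2).trans ((ihp _).nat_eq b hb.1)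
    · simp only [realWrites, List.mem_append, not_or] at hb
      exact ((ihq _).real_eq b hb.2).trans ((ihp _).real_eq b hb.1)
  | ite b p q ihp ihq =>
    refine ⟨fun b hb => ?_, fun b hb => ?_⟩
    · simp only [natWrites, List.mem_append, not_or] at hb
      simp only [exec]
      split_ifs
      · exact (ihp _).nat_eq b hb.1
      · exact (ihq _).nat_eq b hb.2
    · simp only [realWrites, List.mem_append, not_or] at hb
      simp only [exec]
      split_ifs
      · exact (ihp _).real_eq b hb.1
      · exact (ihq _).real_eq b hb.2
  | loop a e p ih =>
    change Frame _ s (iterate _ s _).1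
    refine iterate_inv (Frame (loop a e p) s) _ ⟨fun _ _ => rfl, fun _ _ => rfl⟩
      fun k s' hs' => ⟨fun b hb => ?_, fun b hb => ?_⟩
    · have hb' := hb
      simp only [natWrites, List.mem_cons, not_or] at hb'
      exact ((ih _).nat_eq b hb'.2).trans
        ((s'.nat_setNat_of_ne hb'.1 _ _ _).trans (hs'.nat_eq b hb))
    · exact ((ih _).real_eq b hb).trans (hs'.real_eq b hb)

/-- `hset` asks that the invariant ignore the counter, which is overwritten before each iteration.
The cost bound may depend on `k`, so that cheap iterations, which skip an index outside the current
set, are not charged like expensive ones. -/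
theorem loop_rule {a : ℕ} {e : NatExpr} {p : Program} {s : Store} (I : ℕ → Store → Prop)
    (c : ℕ → ℕ) (N : ℕ) (hN : e.eval s = N) (h0 : I 0 s)
    (hset : ∀ k s', I k s' → I k (s'.setNat a 0 0 k))
    (hstep : ∀ k < N, ∀ s', s'.nat a 0 0 = k → Frame (loop a e p) s s' → I k s' →
      I (k + 1) (p.exec s').1 ∧ (p.exec s').2 ≤ c k) :
    I N ((loop a e p).exec s).1 ∧
      ((loop a e p).exec s).2 ≤ ∑ k ∈ Finset.range N, (c k + 1) + e.cost + 1 := by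
  have h := iterate_rule (body := fun k s' => p.exec (s'.setNat a 0 0 k)) (s := s)
    (fun k s' => Frame (loop a e p) s s' ∧ I k s') c N
    ⟨⟨fun _ _ => rfl, fun _ _ => rfl⟩, h0⟩ ?_
  · rw [← hN] at h
    subst hN
    exact ⟨h.1.2, by simpa [exec] using h.2⟩
  · rintro k hk s' ⟨hF, hI⟩
    have hF' : Frame (loop a e p) s (s'.setNat a 0 0 k) := by
      refine ⟨fun b hb => ?_, hF.real_eq⟩
      have hb' := hb
      simp only [natWrites, List.mem_cons, not_or] at hb'
      exact (s'.nat_setNat_of_ne hb'.1 _ _ _).trans (hF.nat_eq b hb)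
    have h1 := hstep k hk _ (s'.nat_setNat_self a 0 0 k) hF' (hset k s' hI)
    refine ⟨⟨⟨fun b hb => ?_, fun b hb => ?_⟩, h1.1⟩, h1.2⟩
    · have hb' := hb
      simp only [natWrites, List.mem_cons, not_or] at hb'
      exact ((frame_exec p _).nat_eq b hb'.2).trans (hF'.nat_eq b hb)
    · exact ((frame_exec p _).real_eq b hb).trans (hF'.real_eq b hb)

theorem loop_rule_const {a : ℕ} {e : NatExpr} {p : Program} {s : Store} (I : ℕ → Store → Prop)
    (c N : ℕ) (hN : e.eval s = N) (h0 : I 0 s)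
    (hset : ∀ k s', I k s' → I k (s'.setNat a 0 0 k))
    (hstep : ∀ k < N, ∀ s', s'.nat a 0 0 = k → Frame (loop a e p) s s' → I k s' →
      I (k + 1) (p.exec s').1 ∧ (p.exec s').2 ≤ c) :
    I N ((loop a e p).exec s).1 ∧
      ((loop a e p).exec s).2 ≤ N * (c + 1) + e.cost + 1 := by
  simpa using loop_rule I (fun _ => c) N hN h0 hset hstep

theorem exec_seq (p q : Program) (s : Store) :
    (seq p q).exec s = ((q.exec (p.exec s).1).1, (p.exec s).2 + (q.exec (p.exec s).1).2) := rfl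

/-- Add up the values of `x`, with the scalar `v` running through the samples. -/
def sumLoop (acc v : ℕ) (x : RealExpr) : Program :=
  seq (setReal acc (.const 0) (.const 0) (.ofNat (.const 0)))
    (loop v (.var 1) (setReal acc (.const 0) (.const 0) (.add (.var acc) x)))

theorem sumLoop_spec {acc v : ℕ} {x : RealExpr} {s : Store} (g : ℕ → ℝ)
    (hx : ∀ s' : Store, (∀ b, b ≠ v → s'.nat b = s.nat b) → (∀ b, b ≠ acc → s'.real b = s.real b) →
      s'.nat v 0 0 < s.nat 1 0 0 → x.eval s' = g (s'.nat v 0 0)) :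
    ((sumLoop acc v x).exec s).1.real acc 0 0 = ∑ k ∈ Finset.range (s.nat 1 0 0), g k ∧
      ((sumLoop acc v x).exec s).2 ≤ s.nat 1 0 0 * (x.cost + 8) + 9 := by
  rw [sumLoop, exec_seq]
  set s₁ := ((setReal acc (.const 0) (.const 0) (.ofNat (.const 0))).exec s).1 with hs₁
  have h1 : s₁.real acc 0 0 = 0 := by simp [hs₁, exec]
  have h2 : ((setReal acc (.const 0) (.const 0) (.ofNat (.const 0))).exec s).2 = 5 := by
    simp [exec]
  have hnat : s₁.nat = s.nat := rfl
  have hreal : ∀ b, b ≠ acc → s₁.real b = s.real b := fun b hb => s.real_setReal_of_ne hb _ _ _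
  have hloop := loop_rule_const (a := v) (e := .var 1)
    (p := setReal acc (.const 0) (.const 0) (.add (.var acc) x)) (s := s₁)
    (fun k s' => s'.real acc 0 0 = ∑ l ∈ Finset.range k, g l) (x.cost + 7) (s.nat 1 0 0)
    rfl (by simpa using h1) (fun k s' h => h) ?_
  · refine ⟨hloop.1, ?_⟩
    have := hloop.2
    simp only [NatExpr.cost_var] at this
    simp only [h2]
    have e : x.cost + 7 + 1 = x.cost + 8 := rfl
    rw [e] at this
    omega
  · intro k hk s' hk' hF hI
    have hev : x.eval s' = g k := by
      rw [hx s' (fun b hb => ?_) (fun b hb => ?_) (by omega), hk']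
      · rw [hF.nat_eq b (by simpa [natWrites] using hb), hnat]
      · rw [hF.real_eq b (by simpa [realWrites] using hb), hreal b hb]
    constructor
    · simp [exec, hev, hI, Finset.sum_range_succ]
    · simp [exec]; omega

end Program

end Framework

end GGM

namespace GGM

/-! ### Copying the data and one Gram–Schmidt step. -/

section Subroutines

namespace Program

/-- Copy the data matrix to the real array `2`. -/
def copyData : Program :=
  loop 6 (.var 1) (loop 11 (.var 0) (setReal 2 (.var 6) (.var 11) (.cell 0 (.var 6) (.var 11))))

theorem copyData_spec (s : Store) :
    (∀ k < s.nat 1 0 0, ∀ j < s.nat 0 0 0, (copyData.exec s).1.real 2 k j = s.real 0 k j) ∧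
      (copyData.exec s).2 ≤ s.nat 1 0 0 * (s.nat 0 0 0 * 15 + 5) + 4 := by
  refine loop_rule_const (fun k₀ s' => ∀ k < k₀, ∀ j < s.nat 0 0 0, s'.real 2 k j = s.real 0 k j)
    (s.nat 0 0 0 * 15 + 4) _ rfl (by simp) (fun _ _ h => h) ?_
  intro k₀ hk₀ s' hs' hF hI
  have hn : s'.nat 0 = s.nat 0 := hF.nat_eq 0 (by decide)
  have hX : s'.real 0 = s.real 0 := hF.real_eq 0 (by decide)
  have h := loop_rule_const (a := 11) (e := .var 0)
    (p := setReal 2 (.var 6) (.var 11) (.cell 0 (.var 6) (.var 11))) (s := s')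
    (fun j₀ s'' => (∀ k < k₀, ∀ j < s.nat 0 0 0, s''.real 2 k j = s.real 0 k j) ∧
      ∀ j < j₀, s''.real 2 k₀ j = s.real 0 k₀ j) 14 (s.nat 0 0 0) (by simp [hn])
    ⟨hI, by simp⟩ (fun _ _ h => h) ?_
  · refine ⟨fun k hk j hj => ?_, ?_⟩
    · rcases Nat.lt_succ_iff_lt_or_eq.1 hk with hk | rfl
      · exact h.1.1 k hk j hj
      · exact h.1.2 j hj
    · simpa using h.2
  · rintro j₀ hj₀ s'' hs'' hF' ⟨hI1, hI2⟩
    have hk : s''.nat 6 0 0 = k₀ := by rw [hF'.nat_eq 6 (by decide), hs']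
    have hX' : s''.real 0 = s.real 0 := (hF'.real_eq 0 (by decide)).trans hX
    refine ⟨⟨fun k hk' j hj => ?_, fun j hj => ?_⟩, by simp [exec]⟩
    · simp only [exec, NatExpr.eval_var, RealExpr.eval, Store.real_setReal_apply, hk, hs'']
      rw [if_neg (fun h1 => absurd h1.1 (by omega)), hI1 k hk' j hj]
    · simp only [exec, NatExpr.eval_var, RealExpr.eval, Store.real_setReal_apply, hk, hs'', hX', true_and]
      split_ifs with h1
      · rw [h1]
      · exact hI2 j (by omega)

/-- Remove from all columns of the real array `2` their components along the column whose number
is the scalar `5`. -/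
def pivot : Program :=
  seq (loop 6 (.var 1) (setReal 3 (.var 6) (.const 0) (.cell 2 (.var 6) (.var 5))))
    (seq (sumLoop 5 6 (.mul (.cell 3 (.var 6) (.const 0)) (.cell 3 (.var 6) (.const 0))))
      (loop 11 (.var 0)
        (seq (sumLoop 4 6 (.mul (.cell 2 (.var 6) (.var 11)) (.cell 3 (.var 6) (.const 0))))
          (loop 6 (.var 1) (setReal 2 (.var 6) (.var 11) (.sub (.cell 2 (.var 6) (.var 11))
            (.mul (.div (.var 4) (.var 5)) (.cell 3 (.var 6) (.const 0)))))))))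

/-- The pivot column is saved in the real array `3` first, because the loop over columns also
overwrites column `p` itself. Natural and real arrays are named independently: the scalar `5` is the
index `p` among the naturals and the squared norm of the pivot among the reals. -/
theorem pivot_spec (s : Store) {m n p : ℕ} (hm : s.nat 1 0 0 = m) (hn : s.nat 0 0 0 = n)
    (hp : s.nat 5 0 0 = p) :
    (∀ k < m, ∀ j < n, (pivot.exec s).1.real 2 k j = s.real 2 k j -
      (∑ l ∈ Finset.range m, s.real 2 l j * s.real 2 l p) /
        (∑ l ∈ Finset.range m, s.real 2 l p * s.real 2 l p) * s.real 2 k p) ∧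
      (pivot.exec s).2 ≤ n * (m * 51 + 14) + m * 33 + 17 := by
  set R := s.real 2 with hR
  set new : ℕ → ℕ → ℝ := fun k j => R k j - (∑ l ∈ Finset.range m, R l j * R l p) /
        (∑ l ∈ Finset.range m, R l p * R l p) * R k p with hnew
  rw [pivot, exec_seq, exec_seq]
  set p₁ : Program := loop 6 (.var 1) (setReal 3 (.var 6) (.const 0) (.cell 2 (.var 6) (.var 5)))
    with hp₁
  set s₁ := (p₁.exec s).1 with hs₁
  have F₁ := frame_exec p₁ s
  rw [← hs₁] at F₁
  have h₁ : (∀ k < m, s₁.real 3 k 0 = R k p) ∧ (p₁.exec s).2 ≤ m * (13 + 1) + 3 + 1 := by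
    refine loop_rule_const (fun k₀ s' => ∀ k < k₀, s'.real 3 k 0 = R k p) 13 m hm (by simp)
      (fun _ _ h => h) ?_
    intro k₀ hk₀ s' hs' hF hI
    have hp' : s'.nat 5 0 0 = p := by rw [hF.nat_eq 5 (by decide), hp]
    have hR' : s'.real 2 = R := hF.real_eq 2 (by decide)
    refine ⟨fun k hk => ?_, by simp [exec]⟩
    simp only [exec, NatExpr.eval_var, NatExpr.eval, RealExpr.eval, Store.real_setReal_apply, hs',
      hp', hR', and_true]
    split_ifs with h1
    · rw [h1]
    · exact hI k (by omega)
  set p₂ : Program := sumLoop 5 6 (.mul (.cell 3 (.var 6) (.const 0)) (.cell 3 (.var 6) (.const 0)))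
    with hp₂
  set s₂ := (p₂.exec s₁).1 with hs₂
  have F₂ := frame_exec p₂ s₁
  rw [← hs₂] at F₂
  have hm₁ : s₁.nat 1 0 0 = m := by rw [F₁.nat_eq 1 (by decide), hm]
  have h₂ := sumLoop_spec (acc := 5) (v := 6)
    (x := .mul (.cell 3 (.var 6) (.const 0)) (.cell 3 (.var 6) (.const 0))) (s := s₁)
    (fun k => R k p * R k p) ?_
  swap
  · intro s' h1 h2 h3
    rw [hm₁] at h3
    simp only [RealExpr.eval, NatExpr.eval_var, NatExpr.eval]
    rw [h2 3 (by decide), h₁.1 _ h3]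
  rw [← hp₂, ← hs₂, hm₁] at h₂
  have hm₂ : s₂.nat 1 0 0 = m := by rw [F₂.nat_eq 1 (by decide), hm₁]
  have hn₂ : s₂.nat 0 0 0 = n := by rw [F₂.nat_eq 0 (by decide), F₁.nat_eq 0 (by decide), hn]
  have hR₂ : s₂.real 2 = R := by rw [F₂.real_eq 2 (by decide), F₁.real_eq 2 (by decide)]
  have hQ₂ : ∀ k < m, s₂.real 3 k 0 = R k p := fun k hk => by
    rw [F₂.real_eq 3 (by decide), h₁.1 k hk]
  set p₄ : Program := sumLoop 4 6 (.mul (.cell 2 (.var 6) (.var 11)) (.cell 3 (.var 6) (.const 0)))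
    with hp₄
  set p₅ : Program := loop 6 (.var 1) (setReal 2 (.var 6) (.var 11) (.sub (.cell 2 (.var 6)
    (.var 11)) (.mul (.div (.var 4) (.var 5)) (.cell 3 (.var 6) (.const 0))))) with hp₅
  have h₃ := loop_rule_const (a := 11) (e := .var 0) (p := seq p₄ p₅) (s := s₂)
    (fun j₀ s' => ∀ k < m, ∀ j < n, s'.real 2 k j = if j < j₀ then new k j else R k j)
    (m * 51 + 13) n hn₂ (by simp [hR₂]) (fun _ _ h => h) ?_
  · refine ⟨fun k hk j hj => ?_, ?_⟩
    · rw [h₃.1 k hk j hj, if_pos hj]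
    · have a1 := h₁.2
      have a2 := h₂.2
      have a3 := h₃.2
      simp only [NatExpr.cost_var, RealExpr.cost, NatExpr.cost] at a2 a3
      have e : m * 51 + 13 + 1 = m * 51 + 14 := rfl
      rw [e] at a3
      omega
  · intro j₀ hj₀ s' hs' hF hI
    rw [exec_seq]
    set s₄ := (p₄.exec s').1 with hs₄
    have F₄ := frame_exec p₄ s'
    rw [← hs₄] at F₄
    have hm' : s'.nat 1 0 0 = m := by rw [hF.nat_eq 1 (by decide), hm₂]
    have hQ' : ∀ k < m, s'.real 3 k 0 = R k p := fun k hk => by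
      rw [hF.real_eq 3 (by decide), hQ₂ k hk]
    have hden' : s'.real 5 0 0 = ∑ l ∈ Finset.range m, R l p * R l p := by
      rw [hF.real_eq 5 (by decide), h₂.1]
    have hcol : ∀ k < m, s'.real 2 k j₀ = R k j₀ := fun k hk => by
      rw [hI k hk j₀ hj₀, if_neg (lt_irrefl _)]
    have h₄ := sumLoop_spec (acc := 4) (v := 6)
      (x := .mul (.cell 2 (.var 6) (.var 11)) (.cell 3 (.var 6) (.const 0))) (s := s')
      (fun k => R k j₀ * R k p) ?_
    swap
    · intro s'' h1 h2 h3
      rw [hm'] at h3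
      simp only [RealExpr.eval, NatExpr.eval_var, NatExpr.eval]
      rw [h2 3 (by decide), h2 2 (by decide), h1 11 (by decide), hs', hcol _ h3, hQ' _ h3]
    rw [← hp₄, ← hs₄, hm'] at h₄
    have hm₄ : s₄.nat 1 0 0 = m := by rw [F₄.nat_eq 1 (by decide), hm']
    have hj₄ : s₄.nat 11 0 0 = j₀ := by rw [F₄.nat_eq 11 (by decide), hs']
    have h₅ := loop_rule_const (a := 6) (e := .var 1) (p := setReal 2 (.var 6) (.var 11)
      (.sub (.cell 2 (.var 6) (.var 11))
        (.mul (.div (.var 4) (.var 5)) (.cell 3 (.var 6) (.const 0))))) (s := s₄)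
      (fun k₀ s'' => ∀ k < m, ∀ j < n, s''.real 2 k j =
        if j < j₀ ∨ (j = j₀ ∧ k < k₀) then new k j else R k j) 28 m hm₄ ?_ (fun _ _ h => h) ?_
    · rw [← hp₅] at h₅
      refine ⟨fun k hk j hj => ?_, ?_⟩
      · have := h₅.1 k hk j hj
        rw [this]
        refine if_congr ?_ rfl rfl
        omega
      · have a4 := h₄.2
        have a5 := h₅.2
        simp only [NatExpr.cost_var, RealExpr.cost, NatExpr.cost] at a4 a5
        omega
    · intro k hk j hj
      rw [F₄.real_eq 2 (by decide), hI k hk j hj]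
      refine if_congr ?_ rfl rfl
      omega
    · intro k₀ hk₀ s'' hs'' hF'' hI''
      have e1 : s''.nat 11 0 0 = j₀ := by rw [hF''.nat_eq 11 (by decide), hj₄]
      have e2 : s''.real 3 k₀ 0 = R k₀ p := by
        rw [hF''.real_eq 3 (by decide), F₄.real_eq 3 (by decide), hQ' k₀ hk₀]
      have e3 : s''.real 5 0 0 = ∑ l ∈ Finset.range m, R l p * R l p := by
        rw [hF''.real_eq 5 (by decide), F₄.real_eq 5 (by decide), hden']
      have e4 : s''.real 4 0 0 = ∑ l ∈ Finset.range m, R l j₀ * R l p := by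
        rw [hF''.real_eq 4 (by decide), h₄.1]
      have e5 : s''.real 2 k₀ j₀ = R k₀ j₀ := by
        rw [hI'' k₀ hk₀ j₀ hj₀, if_neg (by omega)]
      refine ⟨fun k hk j hj => ?_, by simp [exec]⟩
      simp only [exec, NatExpr.eval_var, NatExpr.eval, RealExpr.eval, RealExpr.eval_var,
        Store.real_setReal_apply, hs'', e1, e2, e3, e4, e5]
      split_ifs with h1 h2 h2
      · rw [h1.1, h1.2]
      · omega
      · rw [hI'' k hk j hj, if_pos (by omega)]
      · rw [hI'' k hk j hj, if_neg (by omega)]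

end Program

end Subroutines

end GGM

namespace GGM

open scoped RealInnerProductSpace

/-! ### Residuals of all columns given the current set. -/

section ResidualProgram

variable {m n : ℕ}

theorem sum_range_mul_eq_inner {x y : EuclideanSpace ℝ (Fin m)} {f g : ℕ → ℝ}
    (hf : ∀ k : Fin m, f k = x k) (hg : ∀ k : Fin m, g k = y k) :
    ∑ l ∈ Finset.range m, f l * g l = ⟪x, y⟫ := by
  rw [Finset.sum_range, PiLp.inner_apply]
  exact Finset.sum_congr rfl fun k _ => by simp [hf, hg, mul_comm]

/-- The input registers of the store still hold the input. -/
structure IsInput (X : Matrix (Fin m) (Fin n) ℝ) (T : ℕ) (ν : ℝ) (s : Store) : Prop where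
  nodes : s.nat 0 0 0 = n
  samples : s.nat 1 0 0 = m
  rounds : s.nat 2 0 0 = T
  data : ∀ (k : Fin m) (j : Fin n), s.real 0 k j = X k j
  tol : s.real 1 0 0 = ν

variable {X : Matrix (Fin m) (Fin n) ℝ} {T : ℕ} {ν : ℝ} {s s' : Store} {i : Fin n}

theorem isInput_inputStore (X : Matrix (Fin m) (Fin n) ℝ) (T : ℕ) (ν : ℝ) :
    IsInput X T ν (inputStore X T ν) := by
  constructor <;> simp [inputStore]

theorem IsInput.of_frame {p : Program} (h : IsInput X T ν s) (hF : p.Frame s s')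
    (hn : ∀ a ∈ [0, 1, 2], a ∉ p.natWrites) (hr : ∀ a ∈ [0, 1], a ∉ p.realWrites) :
    IsInput X T ν s' where
  nodes := by rw [hF.nat_eq 0 (hn 0 (by simp)), h.nodes]
  samples := by rw [hF.nat_eq 1 (hn 1 (by simp)), h.samples]
  rounds := by rw [hF.nat_eq 2 (hn 2 (by simp)), h.rounds]
  data k j := by rw [hF.real_eq 0 (hr 0 (by simp)), h.data]
  tol := by rw [hF.real_eq 1 (hr 1 (by simp)), h.tol]

theorem outputSet_congr (h : ∀ j : Fin n, s.nat 3 i j = s'.nat 3 i j) :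
    outputSet n s i = outputSet n s' i := by
  simp [outputSet, h]

theorem mem_outputSet {j : Fin n} : j ∈ outputSet n s i ↔ s.nat 3 i j = 1 := by
  simp [outputSet]

/-- Cost accounting for a loop over all nodes that does real work only at members of the current
set. -/
theorem sum_range_ite_outputSet (s : Store) (i : Fin n) (A B : ℕ) :
    ∑ p ∈ Finset.range n, ((if s.nat 3 i p = 1 then A else 0) + B) =
      (outputSet n s i).card * A + n * B := by
  rw [Finset.sum_range, Finset.sum_add_distrib, ← Finset.sum_filter]
  simp [outputSet]

namespace Program

/-- Compute in the real array `2` the residuals of all columns given the current set of the node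
whose number is the scalar `4`. -/
def residProg : Program :=
  seq copyData
    (loop 5 (.var 0) (ite (.natEq (.cell 3 (.var 4) (.var 5)) (.const 1)) pivot skip))

/-- Gram–Schmidt in increasing order of the index: after `p₀` rounds array `2` holds the residuals
given the members of the set below `p₀`. One pivot costs `O(m n)`. -/
theorem residProg_spec (hm : 0 < m) (hs : IsInput X T ν s) (hi : s.nat 4 0 0 = i) :
    (∀ (k : Fin m) (j : Fin n), (residProg.exec s).1.real 2 k j =
        resid (dataCol X) (outputSet n s i) (dataCol X j) k) ∧
      (residProg.exec s).2 ≤ m * n * 115 * ((outputSet n s i).card + 1) := by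
  set y := dataCol X with hy
  set S := outputSet n s i with hS
  rw [residProg, exec_seq]
  have h₁ := copyData_spec s
  have F₁ := frame_exec copyData s
  set s₁ := (copyData.exec s).1 with hs₁
  have I₁ : IsInput X T ν s₁ := hs.of_frame F₁ (by decide) (by decide)
  rw [hs.nodes, hs.samples] at h₁
  have h := loop_rule (a := 5) (e := .var 0)
    (p := ite (.natEq (.cell 3 (.var 4) (.var 5)) (.const 1)) pivot skip) (s := s₁)
    (fun p₀ s' => ∀ (k : Fin m) (j : Fin n), s'.real 2 k j =
      resid y (S.filter fun q : Fin n => (q : ℕ) < p₀) (y j) k)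
    (fun p₀ => (if s.nat 3 i p₀ = 1 then n * (m * 51 + 14) + m * 33 + 17 else 0) + 11) n
    I₁.nodes ?_ (fun _ _ h => h) ?_
  · have hcost : ∑ p₀ ∈ Finset.range n,
        ((if s.nat 3 i p₀ = 1 then n * (m * 51 + 14) + m * 33 + 17 else 0) + 11 + 1) =
          S.card * (n * (m * 51 + 14) + m * 33 + 17) + n * 12 :=
      sum_range_ite_outputSet s i _ 12
    rw [hcost] at h
    refine ⟨fun k j => ?_, ?_⟩
    · rw [h.1 k j, Finset.filter_true_of_mem fun q _ => q.2]
    · have h2 := h.2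
      have h12 := h₁.2
      simp only [NatExpr.cost_var] at h2
      have hn : 0 < n := i.pos
      have e1 : m ≤ m * n := Nat.le_mul_of_pos_right _ hn
      have e2 : n ≤ m * n := Nat.le_mul_of_pos_left _ hm
      have e3 : 1 ≤ m := hm
      have hcard : S.card * (n * (m * 51 + 14) + m * 33 + 17) ≤ m * n * 115 * S.card := by
        have : n * (m * 51 + 14) + m * 33 + 17 ≤ m * n * 115 := by linarith
        calc _ ≤ S.card * (m * n * 115) := Nat.mul_le_mul_left _ this
          _ = _ := by ring
      rw [mul_add, mul_one]
      dsimp only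
      linarith
  · intro k j
    rw [h₁.1 k k.2 j j.2, hs.data]
    simp [y, dataCol]
  · intro p₀ hp₀ s' hs' hF hI
    have hflag : s'.nat 3 = s.nat 3 := by
      rw [hF.nat_eq 3 (by decide), F₁.nat_eq 3 (by decide)]
    have hi' : s'.nat 4 0 0 = i := by
      rw [hF.nat_eq 4 (by decide), F₁.nat_eq 4 (by decide), hi]
    have I' : IsInput X T ν s' := I₁.of_frame hF (by decide) (by decide)
    simp only [exec, Test.Holds, NatExpr.eval, NatExpr.eval_var, hflag, hi', hs', Test.cost,
      NatExpr.cost, NatExpr.cost_var]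
    by_cases hp : s.nat 3 i p₀ = 1
    · simp only [if_pos hp]
      have h₂ := pivot_spec s' I'.samples I'.nodes hs'
      refine ⟨fun k j => ?_, by omega⟩
      have hins : (S.filter fun q : Fin n => (q : ℕ) < p₀ + 1) =
          insert ⟨p₀, hp₀⟩ (S.filter fun q : Fin n => (q : ℕ) < p₀) := by
        ext q
        simp only [Finset.mem_filter, Finset.mem_insert, Fin.ext_iff, Nat.lt_succ_iff_lt_or_eq]
        constructor
        · rintro ⟨h1, h2 | h2⟩
          · exact .inr ⟨h1, h2⟩
          · exact .inl h2
        · rintro (h2 | ⟨h1, h2⟩)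
          · exact ⟨mem_outputSet.2 (by rw [h2]; exact hp), .inr h2⟩
          · exact ⟨h1, .inl h2⟩
      rw [h₂.1 k k.2 j j.2, hins, resid_insert, hI k j]
      have hp' : ∀ k : Fin m, s'.real 2 k p₀ = _ := fun k => hI k ⟨p₀, hp₀⟩
      rw [sum_range_mul_eq_inner (fun k => hI k j) hp', sum_range_mul_eq_inner hp' hp', hp' k]
      simp
    · simp only [if_neg hp]
      refine ⟨fun k j => ?_, by omega⟩
      have heq : (S.filter fun q : Fin n => (q : ℕ) < p₀ + 1) =
          S.filter fun q : Fin n => (q : ℕ) < p₀ := by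
        refine Finset.filter_congr fun q hq => ⟨fun h1 => ?_, fun h1 => by omega⟩
        rcases Nat.lt_succ_iff_lt_or_eq.1 h1 with h2 | h2
        · exact h2
        · exact absurd (h2 ▸ mem_outputSet.1 hq) hp
      rw [heq]
      exact hI k j

end Program

end ResidualProgram

end GGM

namespace GGM

open scoped RealInnerProductSpace

/-! ### Orthogonal matching pursuit as a program. -/

section PursuitProgram

variable {m n : ℕ} {X : Matrix (Fin m) (Fin n) ℝ} {T : ℕ} {ν : ℝ} {s s' : Store} {i : Fin n}

theorem outputSet_setNat_one (s : Store) (i j : Fin n) :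
    outputSet n (s.setNat 3 i j 1) i = insert j (outputSet n s i) := by
  ext l
  rw [mem_outputSet, Store.nat_setNat_apply, Finset.mem_insert, mem_outputSet]
  by_cases h : l = j <;> simp [h]
  simp only [Fin.ext_iff] at h
  simp [h]

theorem outputSet_setNat_zero (s : Store) (i j : Fin n) :
    outputSet n (s.setNat 3 i j 0) i = (outputSet n s i).erase j := by
  ext l
  rw [mem_outputSet, Store.nat_setNat_apply, Finset.mem_erase, mem_outputSet]
  by_cases h : l = j <;> simp [h]
  simp only [Fin.ext_iff] at h
  simp [h]

namespace Program

/-- Store in the scalar `8` an index, other than the scalar `4`, whose residual column in the real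
array `2` explains most of the residual of the column with number the scalar `4`. -/
def selectIndex : Program :=
  seq (setReal 6 (.const 0) (.const 0) (.sub (.ofNat (.const 0)) (.ofNat (.const 1))))
    (seq (setNat 8 (.const 0) (.const 0) (.var 4))
      (loop 5 (.var 0) (ite (.natEq (.var 5) (.var 4)) skip
        (seq (sumLoop 4 6 (.mul (.cell 2 (.var 6) (.var 4)) (.cell 2 (.var 6) (.var 5))))
          (seq (sumLoop 5 6 (.mul (.cell 2 (.var 6) (.var 5)) (.cell 2 (.var 6) (.var 5))))
            (ite (.realLt (.var 6) (.div (.mul (.var 4) (.var 4)) (.var 5)))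
              (seq (setReal 6 (.const 0) (.const 0) (.div (.mul (.var 4) (.var 4)) (.var 5)))
                (setNat 8 (.const 0) (.const 0) (.var 5)))
              skip))))))

/-- By the Schur complement, minimizing the new residual sum of squares means maximizing `gain`. The
record starts at `-1`, below every gain, so the first index other than `i` is always taken, even
with gain `0`. The stored index stays `i` only if there is no other node, which `ompStep` reads as
the idle case. -/
theorem selectIndex_spec (hm : 0 < m) (hs : IsInput X T ν s) (hi : s.nat 4 0 0 = i)
    {S : Finset (Fin n)}
    (hR : ∀ (k : Fin m) (j : Fin n), s.real 2 k j = resid (dataCol X) S (dataCol X j) k) :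
    (∃ b : Fin n, (selectIndex.exec s).1.nat 8 0 0 = b ∧ ((b = i ∧ ∀ j, j = i) ∨
        (b ≠ i ∧ ∀ l, l ≠ i → rss X i (insert b S) ≤ rss X i (insert l S)))) ∧
      (selectIndex.exec s).2 ≤ m * n * 130 := by
  set y := dataCol X with hy
  set gain : Fin n → ℝ := fun j => partialCov y S i j * partialCov y S i j / partialCov y S j j
    with hgain
  have hgain0 : ∀ j, 0 ≤ gain j := fun j =>
    div_nonneg (mul_self_nonneg _) (partialCov_self_nonneg y S j)
  have hrss : ∀ j, rss X i (insert j S) = partialCov y S i i - gain j := fun j => by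
    rw [rss_eq_partialCov, partialCov_insert, sq]
  rw [selectIndex, exec_seq, exec_seq]
  set s₁ := ((setReal 6 (.const 0) (.const 0)
    (.sub (.ofNat (.const 0)) (.ofNat (.const 1)))).exec s).1 with hs₁
  set s₂ := ((setNat 8 (.const 0) (.const 0) (.var 4)).exec s₁).1 with hs₂
  have I₂ : IsInput X T ν s₂ := (hs.of_frame (frame_exec _ _) (by decide) (by decide)).of_frame
    (frame_exec _ _) (by decide) (by decide)
  have hbest₂ : s₂.real 6 0 0 = -1 := by simp [hs₂, hs₁, exec]
  have hidx₂ : s₂.nat 8 0 0 = i := by simp [hs₂, hs₁, exec, hi]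
  have hi₂ : s₂.nat 4 0 0 = i := by
    rw [← hi, (frame_exec _ _).nat_eq 4 (by decide), (frame_exec _ _).nat_eq 4 (by decide)]
  have hR₂ : s₂.real 2 = s.real 2 := by
    rw [(frame_exec _ _).real_eq 2 (by decide), (frame_exec _ _).real_eq 2 (by decide)]
  have h := loop_rule_const (a := 5) (e := .var 0) (p := ite (.natEq (.var 5) (.var 4)) skip
        (seq (sumLoop 4 6 (.mul (.cell 2 (.var 6) (.var 4)) (.cell 2 (.var 6) (.var 5))))
          (seq (sumLoop 5 6 (.mul (.cell 2 (.var 6) (.var 5)) (.cell 2 (.var 6) (.var 5))))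
            (ite (.realLt (.var 6) (.div (.mul (.var 4) (.var 4)) (.var 5)))
              (seq (setReal 6 (.const 0) (.const 0) (.div (.mul (.var 4) (.var 4)) (.var 5)))
                (setNat 8 (.const 0) (.const 0) (.var 5)))
              skip)))) (s := s₂)
    (fun p₀ s' => ∃ b : Fin n, s'.nat 8 0 0 = b ∧
      ((b = i ∧ s'.real 6 0 0 = -1 ∧ ∀ j : Fin n, (j : ℕ) < p₀ → j = i) ∨
        (b ≠ i ∧ s'.real 6 0 0 = gain b ∧ ∀ l : Fin n, (l : ℕ) < p₀ → l ≠ i → gain l ≤ gain b)))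
    (m * 46 + 64) n I₂.nodes ⟨i, hidx₂, .inl ⟨rfl, hbest₂, by simp⟩⟩ (fun _ _ h => h) ?_
  · obtain ⟨⟨b, hb, hb'⟩, hc⟩ := h
    refine ⟨⟨b, hb, ?_⟩, ?_⟩
    · rcases hb' with ⟨h1, -, h2⟩ | ⟨h1, -, h2⟩
      · exact .inl ⟨h1, fun j => h2 j j.2⟩
      · refine .inr ⟨h1, fun l hl => ?_⟩
        rw [hrss, hrss]
        linarith [h2 l l.2 hl]
    · have e2 : n ≤ m * n := Nat.le_mul_of_pos_left _ hm
      have hn : 0 < n := i.pos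
      simp only [exec, NatExpr.cost_var, NatExpr.cost, RealExpr.cost] at hc ⊢
      linarith
  · rintro p₀ hp₀ s' hs' hF ⟨b, hb, hb'⟩
    have I' : IsInput X T ν s' := I₂.of_frame hF (by decide) (by decide)
    have hi' : s'.nat 4 0 0 = i := by rw [hF.nat_eq 4 (by decide), hi₂]
    have hR' : ∀ (k : Fin m) (j : Fin n), s'.real 2 k j = resid y S (y j) k := fun k j => by
      rw [hF.real_eq 2 (by decide), hR₂, hR]
    by_cases hpi : p₀ = i
    · have : ((ite (.natEq (.var 5) (.var 4)) skip
        (seq (sumLoop 4 6 (.mul (.cell 2 (.var 6) (.var 4)) (.cell 2 (.var 6) (.var 5))))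
          (seq (sumLoop 5 6 (.mul (.cell 2 (.var 6) (.var 5)) (.cell 2 (.var 6) (.var 5))))
            (ite (.realLt (.var 6) (.div (.mul (.var 4) (.var 4)) (.var 5)))
              (seq (setReal 6 (.const 0) (.const 0) (.div (.mul (.var 4) (.var 4)) (.var 5)))
                (setNat 8 (.const 0) (.const 0) (.var 5)))
              skip)))).exec s') = (s', 9) := by
        rw [exec]
        simp [hs', hi', hpi, exec]
      rw [this]
      refine ⟨⟨b, hb, ?_⟩, by omega⟩
      rcases hb' with ⟨h1, h2, h3⟩ | ⟨h1, h2, h3⟩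
      · refine .inl ⟨h1, h2, fun j hj => ?_⟩
        rcases Nat.lt_succ_iff_lt_or_eq.1 hj with hj | hj
        · exact h3 j hj
        · exact Fin.ext (hj.trans hpi)
      · refine .inr ⟨h1, h2, fun j hj hji => ?_⟩
        rcases Nat.lt_succ_iff_lt_or_eq.1 hj with hj | hj
        · exact h3 j hj hji
        · exact absurd (Fin.ext (hj.trans hpi)) hji
    · set p₃ : Program := sumLoop 4 6 (.mul (.cell 2 (.var 6) (.var 4)) (.cell 2 (.var 6) (.var 5)))
        with hp₃
      set p₄ : Program := sumLoop 5 6 (.mul (.cell 2 (.var 6) (.var 5)) (.cell 2 (.var 6) (.var 5)))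
        with hp₄
      have h₃ := sumLoop_spec (acc := 4) (v := 6)
        (x := .mul (.cell 2 (.var 6) (.var 4)) (.cell 2 (.var 6) (.var 5))) (s := s')
        (fun k => s'.real 2 k i * s'.real 2 k p₀) ?_
      swap
      · intro s'' h1 h2 h3
        simp only [RealExpr.eval, NatExpr.eval_var]
        rw [h2 2 (by decide), h1 4 (by decide), h1 5 (by decide), hs', hi']
      rw [← hp₃] at h₃
      set s₃ := (p₃.exec s').1 with hs₃
      have F₃ := frame_exec p₃ s'
      rw [← hs₃] at F₃
      have h₄ := sumLoop_spec (acc := 5) (v := 6)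
        (x := .mul (.cell 2 (.var 6) (.var 5)) (.cell 2 (.var 6) (.var 5))) (s := s₃)
        (fun k => s'.real 2 k p₀ * s'.real 2 k p₀) ?_
      swap
      · intro s'' h1 h2 h3
        simp only [RealExpr.eval, NatExpr.eval_var]
        rw [h2 2 (by decide), h1 5 (by decide), F₃.real_eq 2 (by decide),
          F₃.nat_eq 5 (by decide), hs']
      rw [← hp₄] at h₄
      set s₄ := (p₄.exec s₃).1 with hs₄
      have F₄ := frame_exec p₄ s₃
      rw [← hs₄] at F₄
      have hp' : ∀ k : Fin m, s'.real 2 k p₀ = _ := fun k => hR' k ⟨p₀, hp₀⟩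
      have e5 : s₄.real 5 0 0 = partialCov y S ⟨p₀, hp₀⟩ ⟨p₀, hp₀⟩ := by
        rw [h₄.1, F₃.nat_eq 1 (by decide), I'.samples, sum_range_mul_eq_inner hp' hp']
        rfl
      have e4 : s₄.real 4 0 0 = partialCov y S i ⟨p₀, hp₀⟩ := by
        rw [F₄.real_eq 4 (by decide), h₃.1, I'.samples,
          sum_range_mul_eq_inner (fun k => hR' k i) hp']
        rfl
      have e6 : s₄.real 6 0 0 = s'.real 6 0 0 := by
        rw [F₄.real_eq 6 (by decide), F₃.real_eq 6 (by decide)]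
      have e8 : s₄.nat 8 0 0 = b := by
        rw [F₄.nat_eq 8 (by decide), F₃.nat_eq 8 (by decide), hb]
      have e7 : s₄.nat 5 0 0 = p₀ := by
        rw [F₄.nat_eq 5 (by decide), F₃.nat_eq 5 (by decide), hs']
      have hc3 := h₃.2
      have hc4 := h₄.2
      rw [F₃.nat_eq 1 (by decide), I'.samples] at hc4
      rw [I'.samples] at hc3
      simp only [NatExpr.cost_var, RealExpr.cost] at hc3 hc4
      have hgp : partialCov y S i ⟨p₀, hp₀⟩ * partialCov y S i ⟨p₀, hp₀⟩ /
        partialCov y S ⟨p₀, hp₀⟩ ⟨p₀, hp₀⟩ = gain ⟨p₀, hp₀⟩ := rfl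
      have hpne : (⟨p₀, hp₀⟩ : Fin n) ≠ i := fun h => hpi (by rw [← h])
      rw [exec]
      simp only [Test.Holds, NatExpr.eval_var, hs', hi', if_neg hpi, exec_seq, ← hs₃, ← hs₄]
      rw [exec]
      simp only [Test.Holds, RealExpr.eval, RealExpr.eval_var, e4, e5, e6, hgp]
      split_ifs with hlt
      · refine ⟨⟨⟨p₀, hp₀⟩, by simp [exec, e7], .inr ⟨hpne, by simp [exec, e4, e5, hgp], ?_⟩⟩, ?_⟩
        · intro l hl hli
          rcases Nat.lt_succ_iff_lt_or_eq.1 hl with hl | hl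
          · rcases hb' with ⟨h1, h2, h3⟩ | ⟨h1, h2, h3⟩
            · exact absurd (h3 l hl) hli
            · exact (h3 l hl hli).trans (h2 ▸ hlt.le)
          · exact le_of_eq (congrArg gain (Fin.ext hl))
        · simp [exec]
          omega
      · refine ⟨⟨b, by simp [exec, e8], ?_⟩, ?_⟩
        · rcases hb' with ⟨h1, h2, h3⟩ | ⟨h1, h2, h3⟩
          · refine absurd ?_ hlt
            rw [h2]
            linarith [hgain0 ⟨p₀, hp₀⟩]
          · refine .inr ⟨h1, by simp [exec, e6, h2], fun l hl hli => ?_⟩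
            rcases Nat.lt_succ_iff_lt_or_eq.1 hl with hl | hl
            · exact h3 l hl hli
            · rw [← h2, show l = ⟨p₀, hp₀⟩ from Fin.ext hl]
              exact not_lt.1 hlt
        · simp [exec]
          omega

/-- One step of orthogonal matching pursuit. -/
def ompStep : Program :=
  seq residProg (seq selectIndex
    (ite (.natEq (.var 8) (.var 4)) skip (setNat 3 (.var 4) (.var 8) (.const 1))))

theorem ompStep_spec (hm : 0 < m) (hs : IsInput X T ν s) (hi : s.nat 4 0 0 = i) {t : ℕ}
    (hrun : OMPRun X i t (outputSet n s i)) :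
    OMPRun X i (t + 1) (outputSet n (ompStep.exec s).1 i) ∧
      (∀ a : ℕ, a ≠ i → (ompStep.exec s).1.nat 3 a = s.nat 3 a) ∧
      (ompStep.exec s).2 ≤ m * n * 280 * (t + 1) := by
  rw [ompStep, exec_seq, exec_seq]
  have h₁ := residProg_spec hm hs hi
  have F₁ := frame_exec residProg s
  set s₁ := (residProg.exec s).1 with hs₁
  have I₁ : IsInput X T ν s₁ := hs.of_frame F₁ (by decide) (by decide)
  have hi₁ : s₁.nat 4 0 0 = i := by rw [F₁.nat_eq 4 (by decide), hi]
  have h₂ := selectIndex_spec hm I₁ hi₁ h₁.1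
  have F₂ := frame_exec selectIndex s₁
  set s₂ := (selectIndex.exec s₁).1 with hs₂
  have hi₂ : s₂.nat 4 0 0 = i := by rw [F₂.nat_eq 4 (by decide), hi₁]
  have h3 : s₂.nat 3 = s.nat 3 := by rw [F₂.nat_eq 3 (by decide), F₁.nat_eq 3 (by decide)]
  have hO : outputSet n s₂ i = outputSet n s i := outputSet_congr (by simp [h3])
  have hcost : ((ite (.natEq (.var 8) (.var 4)) skip
      (setNat 3 (.var 4) (.var 8) (.const 1))).exec s₂).2 ≤ 16 := by
    rw [exec]
    split_ifs <;> simp [exec]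
  refine ⟨?_, ?_, ?_⟩
  · obtain ⟨b, hb, ⟨h4, h5⟩ | ⟨h4, h5⟩⟩ := h₂.1
    · have : ((ite (.natEq (.var 8) (.var 4)) skip
          (setNat 3 (.var 4) (.var 8) (.const 1))).exec s₂).1 = s₂ := by
        rw [exec]
        simp [hb, hi₂, h4, exec]
      rw [this, hO]
      exact .idle hrun h5
    · have : ((ite (.natEq (.var 8) (.var 4)) skip
          (setNat 3 (.var 4) (.var 8) (.const 1))).exec s₂).1 = s₂.setNat 3 i b 1 := by
        rw [exec]
        have hne : ¬ (b : ℕ) = i := fun h => h4 (Fin.ext h)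
        simp [hb, hi₂, hne, exec]
      rw [this, outputSet_setNat_one, hO]
      exact .step b hrun h4 h5
  · intro a ha
    rw [exec]
    dsimp only
    split_ifs
    · simp [exec, h3]
    · funext l
      simp [exec, hi₂, Store.nat_setNat_apply, ha, h3]
  · have hcard := hrun.card_le
    have e1 := h₁.2
    have e2 := h₂.2
    have hn : 0 < n := i.pos
    have e3 : 1 ≤ m * n := Nat.mul_pos hm hn
    have e4 : m * n * 115 * ((outputSet n s i).card + 1) ≤ m * n * 115 * (t + 1) :=
      Nat.mul_le_mul_left _ (by omega)
    have e5 : m * n ≤ m * n * (t + 1) := Nat.le_mul_of_pos_right _ (by omega)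
    dsimp only
    linarith

theorem ompLoop_spec (hm : 0 < m) (hs : IsInput X T ν s) (hi : s.nat 4 0 0 = i)
    (h0 : outputSet n s i = ∅) :
    OMPRun X i T (outputSet n ((loop 7 (.var 2) ompStep).exec s).1 i) ∧
      (∀ a : ℕ, a ≠ i → ((loop 7 (.var 2) ompStep).exec s).1.nat 3 a = s.nat 3 a) ∧
      ((loop 7 (.var 2) ompStep).exec s).2 ≤ T * (m * n * 280 * T + 1) + 4 := by
  have h := loop_rule_const (a := 7) (e := .var 2) (p := ompStep) (s := s)
    (fun t s' => OMPRun X i t (outputSet n s' i) ∧ ∀ a : ℕ, a ≠ i → s'.nat 3 a = s.nat 3 a)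
    (m * n * 280 * T) T hs.rounds ⟨by rw [h0]; exact .start, fun _ _ => rfl⟩
    (fun k s' h => h) ?_
  · exact ⟨h.1.1, h.1.2, h.2⟩
  · rintro t ht s' hs' hF ⟨h1, h2⟩
    have I' : IsInput X T ν s' := hs.of_frame hF (by decide) (by decide)
    have hi' : s'.nat 4 0 0 = i := by rw [hF.nat_eq 4 (by decide), hi]
    obtain ⟨h3, h4, h5⟩ := ompStep_spec hm I' hi' h1
    exact ⟨⟨h3, fun a ha => (h4 a ha).trans (h2 a ha)⟩,
      h5.trans (Nat.mul_le_mul_left _ ht)⟩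

end Program

end PursuitProgram

end GGM

namespace GGM

open scoped RealInnerProductSpace

/-! ### Pruning as a program, and the complete algorithm. -/

section PruningProgram

variable {m n : ℕ} {X : Matrix (Fin m) (Fin n) ℝ} {T : ℕ} {ν : ℝ} {s s' : Store} {i : Fin n}

namespace Program

/-- Store in the real scalar `7` the estimated conditional variance of the node whose number is the
scalar `4`, given its current set. -/
def condVar : Program :=
  seq residProg
    (seq (sumLoop 4 6 (.mul (.cell 2 (.var 6) (.var 4)) (.cell 2 (.var 6) (.var 4))))
      (seq (setNat 9 (.const 0) (.const 0) (.const 0))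
        (seq (loop 5 (.var 0) (ite (.natEq (.cell 3 (.var 4) (.var 5)) (.const 1))
            (setNat 9 (.const 0) (.const 0) (.add (.var 9) (.const 1))) skip))
          (setReal 7 (.const 0) (.const 0)
            (.div (.var 4) (.sub (.ofNat (.var 1)) (.ofNat (.var 9))))))))

/-- The program converts `m` and the counted size to reals before subtracting, so the denominator
agrees with `condVarEst` even when the set has more than `m` elements. -/
theorem condVar_spec (hm : 0 < m) (hs : IsInput X T ν s) (hi : s.nat 4 0 0 = i) :
    (condVar.exec s).1.real 7 0 0 = condVarEst X i (outputSet n s i) ∧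
      (condVar.exec s).2 ≤ m * n * 200 * ((outputSet n s i).card + 1) := by
  set S := outputSet n s i with hS
  rw [condVar, exec_seq, exec_seq, exec_seq, exec_seq]
  have h₁ := residProg_spec hm hs hi
  have F₁ := frame_exec residProg s
  set s₁ := (residProg.exec s).1 with hs₁
  have I₁ : IsInput X T ν s₁ := hs.of_frame F₁ (by decide) (by decide)
  have hi₁ : s₁.nat 4 0 0 = i := by rw [F₁.nat_eq 4 (by decide), hi]
  set p₂ : Program := sumLoop 4 6 (.mul (.cell 2 (.var 6) (.var 4)) (.cell 2 (.var 6) (.var 4)))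
    with hp₂
  have h₂ := sumLoop_spec (acc := 4) (v := 6)
    (x := .mul (.cell 2 (.var 6) (.var 4)) (.cell 2 (.var 6) (.var 4))) (s := s₁)
    (fun k => s₁.real 2 k i * s₁.real 2 k i) ?_
  swap
  · intro s'' h1 h2 h3
    simp only [RealExpr.eval, NatExpr.eval_var]
    rw [h2 2 (by decide), h1 4 (by decide), hi₁]
  rw [← hp₂, I₁.samples] at h₂
  have F₂ := frame_exec p₂ s₁
  set s₂ := (p₂.exec s₁).1 with hs₂
  have hrss : s₂.real 4 0 0 = rss X i S := by
    rw [h₂.1, sum_range_mul_eq_inner (fun k => h₁.1 k i) (fun k => h₁.1 k i), rss_eq_partialCov]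
    rfl
  set p₃ : Program := setNat 9 (.const 0) (.const 0) (.const 0) with hp₃
  have F₃ := frame_exec p₃ s₂
  have h₃ : (p₃.exec s₂).1.nat 9 0 0 = 0 := by simp [p₃, exec]
  have hc₃ : (p₃.exec s₂).2 = 4 := by simp [p₃, exec]
  set s₃ := (p₃.exec s₂).1 with hs₃
  have I₃ : IsInput X T ν s₃ := (I₁.of_frame F₂ (by decide) (by decide)).of_frame F₃ (by decide)
    (by decide)
  have hi₃ : s₃.nat 4 0 0 = i := by rw [F₃.nat_eq 4 (by decide), F₂.nat_eq 4 (by decide), hi₁]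
  have hf₃ : s₃.nat 3 = s.nat 3 := by
    rw [F₃.nat_eq 3 (by decide), F₂.nat_eq 3 (by decide), F₁.nat_eq 3 (by decide)]
  set p₄ : Program := loop 5 (.var 0) (ite (.natEq (.cell 3 (.var 4) (.var 5)) (.const 1))
            (setNat 9 (.const 0) (.const 0) (.add (.var 9) (.const 1))) skip) with hp₄
  have h₄ := loop_rule_const (a := 5) (e := .var 0)
    (p := ite (.natEq (.cell 3 (.var 4) (.var 5)) (.const 1))
            (setNat 9 (.const 0) (.const 0) (.add (.var 9) (.const 1))) skip) (s := s₃)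
    (fun p₀ s' => s'.nat 9 0 0 = ∑ p ∈ Finset.range p₀, ((if s.nat 3 i p = 1 then 1 else 0) + 0))
    18 n I₃.nodes (by simpa using h₃) (fun _ _ h => h) ?_
  swap
  · intro p₀ hp₀ s' hs' hF hI
    rw [Finset.sum_range_succ, exec]
    have e4 : s'.nat 4 0 0 = i := by rw [hF.nat_eq 4 (by decide), hi₃]
    have e3 : s'.nat 3 = s.nat 3 := by rw [hF.nat_eq 3 (by decide), hf₃]
    simp only [Test.Holds, NatExpr.eval, NatExpr.eval_var, e4, e3, hs']
    split_ifs with h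
    · exact ⟨by simp [exec, hI], by simp [exec]⟩
    · exact ⟨by simp [exec, hI], by simp [exec]⟩
  rw [← hp₄, sum_range_ite_outputSet, mul_one, mul_zero, add_zero, ← hS] at h₄
  have F₄ := frame_exec p₄ s₃
  set s₄ := (p₄.exec s₃).1 with hs₄
  have I₄ : IsInput X T ν s₄ := I₃.of_frame F₄ (by decide) (by decide)
  have e4 : s₄.real 4 0 0 = rss X i S := by
    rw [F₄.real_eq 4 (by decide), F₃.real_eq 4 (by decide), hrss]
  refine ⟨?_, ?_⟩
  · simp [exec, e4, I₄.samples, h₄.1, condVarEst]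
  · have e1 := h₁.2
    have e2 := h₂.2
    have e3 := h₄.2
    simp only [NatExpr.cost_var, RealExpr.cost] at e2 e3
    have e5 : m ≤ m * n := Nat.le_mul_of_pos_right _ i.pos
    have e6 : n ≤ m * n := Nat.le_mul_of_pos_left _ hm
    have e7 : m * n ≤ m * n * (S.card + 1) := Nat.le_mul_of_pos_right _ (by omega)
    have e8 : 1 ≤ m := hm
    simp only [exec, NatExpr.cost, NatExpr.cost_var, RealExpr.cost, RealExpr.cost_var]
    linarith

/-- Remove from the current set of the node whose number is the scalar `4` the element whose
number is the scalar `10`, provided this raises the estimated conditional variance by less than the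
real scalar `8`. -/
def pruneBody : Program :=
  seq condVar (seq (setReal 9 (.const 0) (.const 0) (.var 7))
    (seq (setNat 3 (.var 4) (.var 10) (.const 0))
      (seq condVar (ite (.realLt (.sub (.var 7) (.var 9)) (.var 8)) skip
        (setNat 3 (.var 4) (.var 10) (.const 1))))))

/-- The index is erased tentatively and put back if the estimate rises too much; `hmem` ensures that
putting it back restores the old set. -/
theorem pruneBody_spec (hm : 0 < m) (hs : IsInput X T ν s) (hi : s.nat 4 0 0 = i) {j : Fin n}
    (hj : s.nat 10 0 0 = j) (hmem : j ∈ outputSet n s i) :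
    outputSet n (pruneBody.exec s).1 i = pruneStep X i (s.real 8 0 0) (outputSet n s i) j ∧
      (∀ a b : ℕ, ¬(a = i ∧ b = j) → (pruneBody.exec s).1.nat 3 a b = s.nat 3 a b) ∧
      (pruneBody.exec s).2 ≤ m * n * 450 * ((outputSet n s i).card + 1) := by
  set S := outputSet n s i with hS
  rw [pruneBody, exec_seq, exec_seq, exec_seq, exec_seq]
  have h₁ := condVar_spec hm hs hi
  have F₁ := frame_exec condVar s
  set s₁ := (condVar.exec s).1 with hs₁
  have I₁ : IsInput X T ν s₁ := hs.of_frame F₁ (by decide) (by decide)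
  set p₂ : Program := setReal 9 (.const 0) (.const 0) (.var 7) with hp₂
  have h₂ : (p₂.exec s₁).1.real 9 0 0 = condVarEst X i S := by simp [p₂, exec, h₁.1, S]
  have hc₂ : (p₂.exec s₁).2 = 6 := by simp [p₂, exec]
  have F₂ := frame_exec p₂ s₁
  set s₂ := (p₂.exec s₁).1 with hs₂
  have I₂ : IsInput X T ν s₂ := I₁.of_frame F₂ (by decide) (by decide)
  have hi₂ : s₂.nat 4 0 0 = i := by rw [F₂.nat_eq 4 (by decide), F₁.nat_eq 4 (by decide), hi]
  have hj₂ : s₂.nat 10 0 0 = j := by rw [F₂.nat_eq 10 (by decide), F₁.nat_eq 10 (by decide), hj]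
  have hf₂ : s₂.nat 3 = s.nat 3 := by rw [F₂.nat_eq 3 (by decide), F₁.nat_eq 3 (by decide)]
  have hO₂ : outputSet n s₂ i = S := outputSet_congr (by simp [hf₂])
  set p₃ : Program := setNat 3 (.var 4) (.var 10) (.const 0) with hp₃
  have h₃ : (p₃.exec s₂).1 = s₂.setNat 3 i j 0 := by simp [p₃, exec, hi₂, hj₂]
  have hc₃ : (p₃.exec s₂).2 = 8 := by simp [p₃, exec]
  have F₃ := frame_exec p₃ s₂
  set s₃ := (p₃.exec s₂).1 with hs₃
  have I₃ : IsInput X T ν s₃ := I₂.of_frame F₃ (by decide) (by decide)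
  have hi₃ : s₃.nat 4 0 0 = i := by rw [F₃.nat_eq 4 (by decide), hi₂]
  have hO₃ : outputSet n s₃ i = S.erase j := by rw [h₃, outputSet_setNat_zero, hO₂]
  have h₄ := condVar_spec hm I₃ hi₃
  rw [hO₃] at h₄
  have F₄ := frame_exec condVar s₃
  set s₄ := (condVar.exec s₃).1 with hs₄
  have hi₄ : s₄.nat 4 0 0 = i := by rw [F₄.nat_eq 4 (by decide), hi₃]
  have hj₄ : s₄.nat 10 0 0 = j := by
    rw [F₄.nat_eq 10 (by decide), F₃.nat_eq 10 (by decide), hj₂]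
  have e9 : s₄.real 9 0 0 = condVarEst X i S := by
    rw [F₄.real_eq 9 (by decide), F₃.real_eq 9 (by decide), h₂]
  have e8 : s₄.real 8 0 0 = s.real 8 0 0 := by
    rw [F₄.real_eq 8 (by decide), F₃.real_eq 8 (by decide), F₂.real_eq 8 (by decide),
      F₁.real_eq 8 (by decide)]
  have hf₄ : s₄.nat 3 = s₃.nat 3 := F₄.nat_eq 3 (by decide)
  have hO₄ : outputSet n s₄ i = S.erase j := by
    rw [← hO₃]
    exact outputSet_congr (by simp [hf₄])
  have hrow : ∀ a b : ℕ, ¬(a = i ∧ b = j) → s₄.nat 3 a b = s.nat 3 a b := fun a b hab => by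
    rw [hf₄, h₃, Store.nat_setNat_apply, if_neg hab, hf₂]
  set p₅ : Program := ite (.realLt (.sub (.var 7) (.var 9)) (.var 8)) skip
        (setNat 3 (.var 4) (.var 10) (.const 1)) with hp₅
  have h₅ : (p₅.exec s₄).1 =
      if condVarEst X i (S.erase j) - condVarEst X i S < s.real 8 0 0 then s₄
      else s₄.setNat 3 i j 1 := by
    rw [hp₅, exec]
    simp only [Test.Holds, RealExpr.eval, RealExpr.eval_var, h₄.1, e9, e8]
    split_ifs
    · simp [exec]
    · simp [exec, hi₄, hj₄]
  have hc₅ : (p₅.exec s₄).2 ≤ 24 := by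
    rw [hp₅, exec]
    split_ifs <;> simp [exec]
  have hcost : (condVar.exec s).2 + ((p₂.exec s₁).2 + ((p₃.exec s₂).2 +
      ((condVar.exec s₃).2 + (p₅.exec s₄).2))) ≤ m * n * 450 * (S.card + 1) := by
    have e1 := h₁.2
    have e2 := h₄.2
    rw [← hS] at e1
    have e3 : m * n * 200 * ((S.erase j).card + 1) ≤ m * n * 200 * (S.card + 1) :=
      Nat.mul_le_mul_left _ (Nat.succ_le_succ (Finset.card_le_card (Finset.erase_subset _ _)))
    have e4 : 1 ≤ m * n * (S.card + 1) := Nat.mul_pos (Nat.mul_pos hm i.pos) (by omega)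
    rw [hc₂, hc₃]
    linarith
  refine ⟨?_, fun a b hab => ?_, hcost⟩
  · rw [h₅, pruneStep]
    split_ifs
    · exact hO₄
    · rw [outputSet_setNat_one, hO₄, Finset.insert_erase hmem]
  · rw [h₅]
    split_ifs
    · exact hrow a b hab
    · rw [Store.nat_setNat_apply, if_neg hab, hrow a b hab]

/-- The pruning phase at the node whose number is the scalar `4`. -/
def prune : Program :=
  seq condVar (seq (setReal 8 (.const 0) (.const 0) (.mul (.var 1) (.var 7)))
    (loop 10 (.var 0)
      (ite (.natEq (.cell 3 (.var 4) (.var 10)) (.const 1)) pruneBody skip)))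

theorem pruneStep_subset (X : Matrix (Fin m) (Fin n) ℝ) (i : Fin n) (τ : ℝ) (S : Finset (Fin n))
    (j : Fin n) : pruneStep X i τ S j ⊆ S := by
  rw [pruneStep]
  split_ifs
  · exact Finset.erase_subset _ _
  · exact le_rfl

/-- The loop order is the increasing one. When index `j₀` is reached only flags below `j₀` have
changed, so the flag read there is still membership in the initial set. Hence the list is
`List.finRange n` filtered by that set. -/
theorem prune_spec (hm : 0 < m) (hs : IsInput X T ν s) (hi : s.nat 4 0 0 = i) :
    (∃ l : List (Fin n), l.Nodup ∧ l.toFinset = outputSet n s i ∧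
        outputSet n (prune.exec s).1 i =
          l.foldl (pruneStep X i (ν * condVarEst X i (outputSet n s i))) (outputSet n s i)) ∧
      (∀ a : ℕ, a ≠ i → (prune.exec s).1.nat 3 a = s.nat 3 a) ∧
      (prune.exec s).2 ≤ m * n * 680 * ((outputSet n s i).card + 1) ^ 2 := by
  set S := outputSet n s i with hS
  set f := pruneStep X i (ν * condVarEst X i S) with hf
  rw [prune, exec_seq, exec_seq]
  have h₁ := condVar_spec hm hs hi
  have F₁ := frame_exec condVar s
  set s₁ := (condVar.exec s).1 with hs₁
  have I₁ : IsInput X T ν s₁ := hs.of_frame F₁ (by decide) (by decide)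
  set p₂ : Program := setReal 8 (.const 0) (.const 0) (.mul (.var 1) (.var 7)) with hp₂
  have h₂ : (p₂.exec s₁).1.real 8 0 0 = ν * condVarEst X i S := by
    simp [p₂, exec, h₁.1, I₁.tol, S]
  have hc₂ : (p₂.exec s₁).2 = 10 := by simp [p₂, exec]
  have F₂ := frame_exec p₂ s₁
  set s₂ := (p₂.exec s₁).1 with hs₂
  have I₂ : IsInput X T ν s₂ := I₁.of_frame F₂ (by decide) (by decide)
  have hi₂ : s₂.nat 4 0 0 = i := by rw [F₂.nat_eq 4 (by decide), F₁.nat_eq 4 (by decide), hi]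
  have hf₂ : s₂.nat 3 = s.nat 3 := by rw [F₂.nat_eq 3 (by decide), F₁.nat_eq 3 (by decide)]
  set A := m * n * 450 * (S.card + 1) with hA
  have h := loop_rule (a := 10) (e := .var 0)
    (p := ite (.natEq (.cell 3 (.var 4) (.var 10)) (.const 1)) pruneBody skip) (s := s₂)
    (fun j₀ s' => outputSet n s' i =
        (((List.finRange n).take j₀).filter (· ∈ S)).foldl f S ∧
      outputSet n s' i ⊆ S ∧ (∀ b, j₀ ≤ b → s'.nat 3 i b = s.nat 3 i b) ∧
      ∀ a : ℕ, a ≠ i → s'.nat 3 a = s.nat 3 a)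
    (fun j₀ => (if s.nat 3 i j₀ = 1 then A else 0) + 11) n I₂.nodes ?_ (fun _ _ h => h) ?_
  · have hcost : ∑ p₀ ∈ Finset.range n, ((if s.nat 3 i p₀ = 1 then A else 0) + 11 + 1) =
          S.card * A + n * 12 := sum_range_ite_outputSet s i _ 12
    rw [hcost] at h
    obtain ⟨⟨h3, -, -, h4⟩, h5⟩ := h
    refine ⟨⟨(List.finRange n).filter (· ∈ S), (List.nodup_finRange n).filter _, ?_, ?_⟩, h4, ?_⟩
    · ext j
      simp
    · rw [h3, List.take_of_length_le (by simp)]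
    · have e1 := h₁.2
      rw [← hS] at e1
      simp only [NatExpr.cost_var] at h5
      have e6 : n ≤ m * n := Nat.le_mul_of_pos_left _ hm
      have e8 : 1 ≤ m * n := Nat.mul_pos hm i.pos
      rw [hc₂]
      dsimp only
      set c := S.card
      have e9 : m * n ≤ m * n * (c + 1) := Nat.le_mul_of_pos_right _ (by omega)
      have e10 : m * n * (c + 1) ≤ m * n * (c + 1) * (c + 1) := Nat.le_mul_of_pos_right _ (by omega)
      have e11 : c * A ≤ m * n * 450 * (c + 1) ^ 2 := by
        calc c * A ≤ (c + 1) * A := Nat.mul_le_mul_right _ (by omega)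
          _ = _ := by rw [hA]; ring
      have e12 : m * n * (c + 1) * (c + 1) = m * n * (c + 1) ^ 2 := by ring
      linarith
  · have hO₂ : outputSet n s₂ i = S := outputSet_congr (by simp [hf₂])
    exact ⟨by simp [hO₂], hO₂.subset, fun _ _ => by rw [hf₂], fun _ _ => by rw [hf₂]⟩
  · rintro j₀ hj₀ s' hs' hF ⟨h3, h4, h5, h6⟩
    have I' : IsInput X T ν s' := I₂.of_frame hF (by decide) (by decide)
    have hi' : s'.nat 4 0 0 = i := by rw [hF.nat_eq 4 (by decide), hi₂]
    have h8 : s'.real 8 0 0 = ν * condVarEst X i S := by rw [hF.real_eq 8 (by decide), h₂]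
    have htake : (List.finRange n).take (j₀ + 1) = (List.finRange n).take j₀ ++ [⟨j₀, hj₀⟩] := by
      rw [List.take_succ_eq_append_getElem (by simpa using hj₀)]
      simp
    rw [htake, List.filter_append, List.foldl_append, ← h3]
    rw [exec]
    simp only [Test.Holds, NatExpr.eval, NatExpr.eval_var, hi', hs', h5 j₀ le_rfl, Test.cost,
      NatExpr.cost, NatExpr.cost_var]
    by_cases hj : s.nat 3 i j₀ = 1
    · simp only [if_pos hj]
      have hmemS : (⟨j₀, hj₀⟩ : Fin n) ∈ S := mem_outputSet.2 hj
      have hmem : (⟨j₀, hj₀⟩ : Fin n) ∈ outputSet n s' i :=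
        mem_outputSet.2 (by rw [h5 j₀ le_rfl]; exact hj)
      obtain ⟨g1, g2, g3⟩ := pruneBody_spec hm I' hi' hs' hmem
      rw [h8] at g1
      refine ⟨⟨?_, ?_, fun b hb => ?_, fun a ha => ?_⟩, ?_⟩
      · rw [g1]
        simp [hmemS, f]
      · rw [g1]
        exact (pruneStep_subset _ _ _ _ _).trans h4
      · rw [g2 _ _ (by simp; omega), h5 b (by omega)]
      · rw [← h6 a ha]
        funext b
        exact g2 _ _ (by simp [ha])
      · have : m * n * 450 * ((outputSet n s' i).card + 1) ≤ A :=
          Nat.mul_le_mul_left _ (Nat.succ_le_succ (Finset.card_le_card h4))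
        omega
    · simp only [if_neg hj]
      have hmemS : (⟨j₀, hj₀⟩ : Fin n) ∉ S := fun h => hj (mem_outputSet.1 h)
      exact ⟨⟨by simp [exec, hmemS], h4, fun b hb => h5 b (by omega), h6⟩, by simp [exec]⟩

/-- The algorithm GreedyAndPrune, run at all nodes. -/
def greedyAndPrune : Program :=
  loop 4 (.var 0) (seq (loop 7 (.var 2) ompStep) prune)

/-- Round `i` writes only row `i` of the natural array `3`, so each row starts empty and is final
after its round. Positivity of `T` absorbs `|S| + 1 ≤ 2 T`; the summand `4` is for `n = 0`. -/
theorem greedyAndPrune_spec (hm : 0 < m) (hT : 0 < T) (X : Matrix (Fin m) (Fin n) ℝ) (ν : ℝ) :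
    (∀ i, IsGreedyAndPruneOutput X T ν i (greedyAndPrune.result X T ν i)) ∧
      greedyAndPrune.steps X T ν ≤ m * n ^ 2 * T ^ 2 * 3100 + 4 := by
  set s := inputStore X T ν with hs
  have I : IsInput X T ν s := isInput_inputStore X T ν
  have h := loop_rule_const (a := 4) (e := .var 0) (p := seq (loop 7 (.var 2) ompStep) prune)
    (s := s) (fun i₀ s' => (∀ i : Fin n, (i : ℕ) < i₀ →
        IsGreedyAndPruneOutput X T ν i (outputSet n s' i)) ∧
      ∀ i, i₀ ≤ i → s'.nat 3 i = s.nat 3 i) (m * n * T ^ 2 * 3010) n I.nodes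
    ⟨by simp, fun _ _ => rfl⟩ (fun _ _ h => h) ?_
  · refine ⟨fun i => h.1.1 i i.2, ?_⟩
    rcases Nat.eq_zero_or_pos n with rfl | hn
    · simpa [steps, greedyAndPrune] using h.2
    · have e1 : n ≤ m * n ^ 2 * T ^ 2 := by
        have : 0 < m * n * T ^ 2 := by positivity
        calc n ≤ n * (m * n * T ^ 2) := Nat.le_mul_of_pos_right _ this
          _ = _ := by ring
      have h2 := h.2
      simp only [NatExpr.cost_var] at h2
      have e2 : n * (m * n * T ^ 2 * 3010 + 1) = m * n ^ 2 * T ^ 2 * 3010 + n := by ring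
      rw [e2] at h2
      change (greedyAndPrune.exec s).2 ≤ _
      rw [greedyAndPrune]
      linarith
  · rintro i₀ hi₀ s' hs' hF ⟨h1, h2⟩
    have I' : IsInput X T ν s' := I.of_frame hF (by decide) (by decide)
    have hO : outputSet n s' ⟨i₀, hi₀⟩ = ∅ := by
      ext j
      simp [mem_outputSet, h2 i₀ le_rfl, hs, inputStore]
    rw [exec_seq]
    obtain ⟨g1, g2, g3⟩ := ompLoop_spec (i := ⟨i₀, hi₀⟩) hm I' hs' hO
    have F₁ := frame_exec (loop 7 (.var 2) ompStep) s'
    set s₁ := ((loop 7 (.var 2) ompStep).exec s').1 with hs₁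
    have I₁ : IsInput X T ν s₁ := I'.of_frame F₁ (by decide) (by decide)
    have hi₁ : s₁.nat 4 0 0 = i₀ := by rw [F₁.nat_eq 4 (by decide), hs']
    obtain ⟨⟨l, k1, k2, k3⟩, k4, k5⟩ := prune_spec (i := ⟨i₀, hi₀⟩) hm I₁ hi₁
    refine ⟨⟨fun i hi => ?_, fun i hi => ?_⟩, ?_⟩
    · rcases Nat.lt_succ_iff_lt_or_eq.1 hi with hi | hi
      · have hne : (i : ℕ) ≠ i₀ := by omega
        rw [show outputSet n (prune.exec s₁).1 i = outputSet n s' i from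
          outputSet_congr fun j => by rw [k4 i hne, g2 i hne]]
        exact h1 i hi
      · obtain rfl : i = ⟨i₀, hi₀⟩ := Fin.ext hi
        exact ⟨_, l, g1, k1, k2, k3⟩
    · have hne : i ≠ i₀ := by omega
      rw [← h2 i (by omega), ← g2 i hne]
      exact k4 i hne
    · have hcard := g1.card_le
      have hn : 0 < n := by omega
      have e1 : 1 ≤ m * n := Nat.mul_pos hm hn
      have e2 : T ≤ m * n * T ^ 2 := by
        calc T ≤ T * (m * n * T) := Nat.le_mul_of_pos_right _ (by positivity)
          _ = _ := by ring
      have e3 : m * n * 680 * ((outputSet n s₁ ⟨i₀, hi₀⟩).card + 1) ^ 2 ≤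
          m * n * 680 * (2 * T) ^ 2 :=
        Nat.mul_le_mul_left _ (Nat.pow_le_pow_left (by omega) 2)
      have e4 : T * (m * n * 280 * T + 1) = m * n * T ^ 2 * 280 + T := by ring
      have e5 : m * n * 680 * (2 * T) ^ 2 = m * n * T ^ 2 * 2720 := by ring
      have e6 : 1 ≤ T := hT
      dsimp only
      linarith

end Program

end PruningProgram

end GGM

/-! ### Assembly of the statistical and the computational bounds. -/

theorem theorem4 :
    ∃ (C : ℝ) (P : GGM.Program), 0 < C ∧
      ∀ (n m d : ℕ) (κ δ : ℝ) (Θ : Matrix (Fin n) (Fin n) ℝ),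
        0 < n → 0 < m → 0 < κ → κ ≤ 1 → 0 < δ → δ < 1 →
        Θ.PosDef → GGM.IsAttractive Θ → GGM.IsNondegenerate κ Θ →
        (∀ i, (GGM.neighbors Θ i).card ≤ d) →
        let K : ℝ := 64 * d * Real.log (4 / κ ^ 2) + 1
        let T : ℕ := ⌈K⌉₊
        let ν : ℝ := κ ^ 2 / Real.sqrt 32
        (C * ((1 / κ ^ 2) * (K * Real.log n + Real.log (4 / δ))) ≤ m →
          ENNReal.ofReal (1 - δ) ≤
            MeasureTheory.Measure.pi
              (fun _ : Fin m => ProbabilityTheory.multivariateGaussian 0 Θ⁻¹)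
              {x : Fin m → EuclideanSpace ℝ (Fin n) |
                ∀ (i : Fin n) (R : Finset (Fin n)),
                  GGM.IsGreedyAndPruneOutput (Matrix.of fun k j => x k j) T ν i R ↔
                    R = GGM.neighbors Θ i}) ∧
        ∀ X : Matrix (Fin m) (Fin n) ℝ,
          (∀ i, GGM.IsGreedyAndPruneOutput X T ν i (P.result X T ν i)) ∧
            (P.steps X T ν : ℝ) ≤ C * (K ^ 3 * m * n ^ 2) := by
  refine ⟨50000000, GGM.Program.greedyAndPrune, by norm_num, ?_⟩
  intro n m d κ δ Θ hn hm hκ hκ1 hδ hδ1 hΘ hA hN hd K T ν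
  refine ⟨fun hC => GGM.ofReal_one_sub_le_measure hn hm hκ hκ1 hδ hδ1 hΘ hA hN hd le_rfl rfl hC,
    fun X => ?_⟩
  have hlog : 0 ≤ Real.log (4 / κ ^ 2) := by
    refine Real.log_nonneg ((one_le_div (by positivity)).2 ?_)
    nlinarith
  have hK : 1 ≤ K := le_add_of_nonneg_left (by positivity)
  have hT : 0 < T := Nat.ceil_pos.2 (by linarith)
  obtain ⟨h1, h2⟩ := GGM.Program.greedyAndPrune_spec hm hT X ν
  refine ⟨h1, ?_⟩
  have hTK : (T : ℝ) ≤ 2 * K := by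
    have := (Nat.ceil_lt_add_one (zero_le_one.trans hK)).le
    change (⌈K⌉₊ : ℝ) ≤ 2 * K
    linarith
  -- The program is quadratic in `T`; since `K ≥ 1`, the claimed cubic bound leaves slack.
  have hT3 : (T : ℝ) ^ 2 ≤ 4 * K ^ 3 := by
    calc (T : ℝ) ^ 2 ≤ (2 * K) ^ 2 := pow_le_pow_left₀ (Nat.cast_nonneg _) hTK 2
      _ = 4 * K ^ 2 := by ring
      _ ≤ 4 * K ^ 3 := by linarith [pow_le_pow_right₀ hK (show 2 ≤ 3 by norm_num)]
  have h3 : GGM.Program.greedyAndPrune.steps X T ν ≤ 3104 * (m * n ^ 2 * T ^ 2) := by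
    have : 0 < m * n ^ 2 * T ^ 2 := by positivity
    omega
  calc (GGM.Program.greedyAndPrune.steps X T ν : ℝ)
      ≤ ((3104 * (m * n ^ 2 * T ^ 2) : ℕ) : ℝ) := Nat.cast_le.2 h3
    _ = 3104 * (m * n ^ 2) * (T : ℝ) ^ 2 := by push_cast; ring
    _ ≤ 3104 * (m * n ^ 2) * (4 * K ^ 3) := mul_le_mul_of_nonneg_left hT3 (by positivity)
    _ ≤ 50000000 * (K ^ 3 * m * n ^ 2) := by
        have : 0 ≤ K ^ 3 * m * n ^ 2 := by positivity
        linarith
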